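/- For integers $1\le a_0<a_1<\dots<a_n$ with $\gcd(a_0,\dots,a_n)=1$, call $t\in\mathbb Z_{\ge 0}$ feasible if $a_0x_0+\dots+a_nx_n=t$ for some $x\in\mathbb Z_{\ge 0}^{n+1}$. The problem AllTargets asks, on input $a_0,\dots,a_n$, for the residue table $a[0],\dots,a[a_0-1]$, where $$a[i]=\min\{t\in\mathbb Z_{\ge 0} : t\equiv i \pmod{a_0} \text{ and } t \text{ is feasible}\}.$$ **Theorem.** AllTargets can be solved in time $O(a_n^{3/2}\log^{1/2}a_n)$ on a word RAM. That is, there are a fixed word-RAM program and constants $c$, $C$ such that for every input as above with $a_n\ge 2$ and every word size $w\ge c\cdot\ell(a_n)$, where $\ell(a_n)$ is the number of binary digits of $a_n$, the program, run with $w$-bit words on $a_0,\dots,a_n$, halts after at most $C\,a_n^{3/2}(\log a_n)^{1/2}$ steps with the residue table in its memory. Here each addition, subtraction, multiplication (all modulo $2^w$), integer division, remainder, comparison, register access, memory access and conditional jump counts as a constant number of steps. -/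

import Mathlib

/-! A word RAM with `w`-bit words and unit-cost instructions, programmed in structured form. -/

namespace WordRAM

/-- The machine's arithmetic and comparison instructions on words. -/
inductive Op
  | add | sub | mul | div | mod | lt | eq

/-- Expressions: constants, registers, one memory cell addressed by the value of an expression,
and one machine instruction applied to two values. -/
inductive Expr
  | const (k : ℕ)
  | reg (r : ℕ)
  | load (addr : Expr)
  | bin (o : Op) (e₁ e₂ : Expr)

/-- Programs. A program is a finite object that does not depend on the input or the word size,
so it refers to finitely many registers only. -/
inductive Cmd
  | skip
  | assign (r : ℕ) (e : Expr)
  | store (addr e : Expr)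
  | seq (p q : Cmd)
  | branch (e : Expr) (p q : Cmd)
  | loop (e : Expr) (p : Cmd)

/-- The contents of the registers and of the random access memory. -/
structure State where
  reg : ℕ → ℕ
  mem : ℕ → ℕ

/-- Word arithmetic: all results are reduced modulo `2 ^ w` (subtraction wraps around, too);
comparisons return `1` for true and `0` for false. -/
def Op.apply (w : ℕ) : Op → ℕ → ℕ → ℕ
  | .add, x, y => (x + y) % 2 ^ w
  | .sub, x, y => (x + (2 ^ w - y % 2 ^ w)) % 2 ^ w
  | .mul, x, y => (x * y) % 2 ^ w
  | .div, x, y => (x / y) % 2 ^ w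
  | .mod, x, y => (x % y) % 2 ^ w
  | .lt, x, y => if x < y then 1 % 2 ^ w else 0
  | .eq, x, y => if x = y then 1 % 2 ^ w else 0

/-- The value of an expression on a machine with `w`-bit words. -/
def Expr.eval (w : ℕ) (s : State) : Expr → ℕ
  | .const k => k % 2 ^ w
  | .reg r => s.reg r
  | .load e => s.mem (e.eval w s)
  | .bin o e₁ e₂ => o.apply w (e₁.eval w s) (e₂.eval w s)

/-- The number of steps that the evaluation of an expression takes: one for each constant,
register access, memory access and machine instruction in it. -/
def Expr.cost : Expr → ℕ
  | .const _ => 1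
  | .reg _ => 1
  | .load e => e.cost + 1
  | .bin _ e₁ e₂ => e₁.cost + e₂.cost + 1

/-- `Exec w p s t s'`: on a machine with `w`-bit words, the program `p` started in state `s`
halts after exactly `t` steps, in state `s'`. Each assignment, each store and each evaluation of
a branch or loop condition takes one step in addition to the cost of its expressions. -/
inductive Exec (w : ℕ) : Cmd → State → ℕ → State → Prop
  | skip (s : State) : Exec w .skip s 1 s
  | assign (s : State) (r : ℕ) (e : Expr) :
      Exec w (.assign r e) s (e.cost + 1)
        { s with reg := Function.update s.reg r (e.eval w s) }
  | store (s : State) (d e : Expr) :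
      Exec w (.store d e) s (d.cost + e.cost + 1)
        { s with mem := Function.update s.mem (d.eval w s) (e.eval w s) }
  | seq {p q : Cmd} {s s' s'' : State} {t t' : ℕ} :
      Exec w p s t s' → Exec w q s' t' s'' → Exec w (.seq p q) s (t + t') s''
  | branch_true {e : Expr} {p q : Cmd} {s s' : State} {t : ℕ} :
      e.eval w s ≠ 0 → Exec w p s t s' → Exec w (.branch e p q) s (e.cost + 1 + t) s'
  | branch_false {e : Expr} {p q : Cmd} {s s' : State} {t : ℕ} :
      e.eval w s = 0 → Exec w q s t s' → Exec w (.branch e p q) s (e.cost + 1 + t) s'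
  | loop_true {e : Expr} {p : Cmd} {s s' s'' : State} {t t' : ℕ} :
      e.eval w s ≠ 0 → Exec w p s t s' → Exec w (.loop e p) s' t' s'' →
        Exec w (.loop e p) s (e.cost + 1 + t + t') s''
  | loop_false {e : Expr} {p : Cmd} {s : State} :
      e.eval w s = 0 → Exec w (.loop e p) s (e.cost + 1) s

/-- The start state for an input sequence of length `m`: register `0` holds `m`, the memory
cells `0, …, m - 1` hold the sequence, everything else is `0`. -/
def inputState {m : ℕ} (a : Fin m → ℕ) : State where
  reg := fun r => if r = 0 then m else 0
  mem := fun j => if h : j < m then a ⟨j, h⟩ else 0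

end WordRAM

/-- `t` is a feasible target value: `a₀ x₀ + ⋯ + aₙ xₙ = t` for some nonnegative integers `xᵢ`. -/
def IsFeasible {n : ℕ} (a : Fin (n + 1) → ℕ) (t : ℕ) : Prop :=
  ∃ x : Fin (n + 1) → ℕ, ∑ i, a i * x i = t

/-- `b[0], …, b[a₀ - 1]` solves AllTargets: `b[i]` is the least feasible target value that is
congruent to `i` modulo `a₀`. -/
def IsResidueTable {n : ℕ} (a : Fin (n + 1) → ℕ) (b : ℕ → ℕ) : Prop :=
  ∀ i < a 0, IsLeast {t : ℕ | t ≡ i [MOD a 0] ∧ IsFeasible a t} (b i)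

/-! ### A language with numbered arrays on top of the word RAM

The word RAM memory above a base address is viewed as sixteen interleaved arrays. Arithmetic is
exact natural number arithmetic with side conditions that exclude overflow; the operations of
`AExpr.wbin` are the machine operations modulo `2 ^ w`. -/

/-! Write N for the largest coin, m for the number of coins, a for the first coin, l for the binary
length of N. All costs are compared with an integer Y such that N³ l ≤ Y². A table entry is an Apéry
value, the least feasible value in its residue class modulo a, and every sub-sum of a representation
of an Apéry value is again an Apéry value (`IsApery.of_add`).

The entries are bounded by T = 12 (N/m + 1) l N (`CoinSystem.tableBound`). This is a statement about
finite abelian groups G: if B contains 0 and generates G, then adding B to a set with at most half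
of the elements enlarges it by a factor of at least 1 + 1/(6(|G|/|B| + 1))
(`SumsetGrowth.card_add_growth`), so O((|G|/|B| + 1) log |G|) summands from B reach everything
(`SumsetGrowth.nsmul_eq_univ`). Here G is the integers modulo a and B the residues of the coins.
They generate because the gcd is 1, and there are at least m a / N of them.

Which algorithm runs depends on m; S denotes the rounded up square root of N.

Few coins, m² ≤ N l: the table is closed under one coin after the other. A coin splits the residues
into cycles, and walking twice around each cycle closes the table in O(a) steps
(`isCoinClosure_of_walks`), so the total is O(mN) = O(Y).

Middle range, N l < m² ≤ N S: now T = O(Y), so all values up to T can be scanned. Tabulating the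
least sum of two coins in each residue class costs O(m²). A coin is heavy if it takes part in at
least S of these minimal pairs whose residues no earlier heavy coin covers; every heavy coin covers
S new residues, so there are at most a/S of them, and closing under them costs O(a²/S). A light coin
has fewer than S uncovered pairs, and these are listed. If an Apéry value has no representation with
a heavy coin, then any two coins in it form a minimal uncovered pair, hence a listed one. So a scan
in increasing order that extends each entry only by the list of its last coin finds all such values
(`IsReached.succ`) in O(T + aS) steps. Peeling off heavy coins reduces the remaining values to these
(`isAperyTable_of_heavyClosure`).

Many coins, m² > N S: now T is O(N^(5/4) l), and the feasible values up to T are found by doubling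
the set of sums O(l) times. A value is written in base r = 256 and the digits are read in base 2r,
so that two codes add without carries. Sumsets then become products of polynomials in k variables,
computed by evaluation and interpolation along one digit at a time. The integer Vandermonde matrix
is inverted only up to its determinant d, and the arithmetic is modulo 2^w. The result is d^k times
the number of representations, which is smaller than 2^w in absolute value, so it vanishes only if
there is no representation (`TensorTransform.pow_mul_natCast_ne_zero`). The transform has O(T^(9/8))
entries, and 5/4 · 9/8 = 45/32 < 3/2 leaves a power of N to absorb all logarithms
(`TableCost.dense_cost_le`).

Programs are verified in an array language with exact arithmetic. `Rep` relates its states to the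
machine, and `Runs` is a total correctness triple with a step bound. -/

namespace ArrayRAM

open WordRAM

/-- Word size, first address of the arrays, and a bound for indices and exact results. -/
structure Machine where
  w : ℕ
  L : ℕ
  base : ℕ
  two_le : 2 ≤ L
  fits : base + 16 * L ≤ 2 ^ w

theorem Machine.L_lt (M : Machine) : M.L < 2 ^ M.w := by
  have := M.fits; have := M.two_le; omega

/-- Exact natural number semantics of the machine operations. -/
def exact : Op → ℕ → ℕ → ℕ
  | .add, x, y => x + y
  | .sub, x, y => x - y
  | .mul, x, y => x * y
  | .div, x, y => x / y
  | .mod, x, y => x % y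
  | .lt, x, y => if x < y then 1 else 0
  | .eq, x, y => if x = y then 1 else 0

/-- The condition under which a machine operation on words agrees with `exact`. -/
def Fits (L : ℕ) : Op → ℕ → ℕ → Prop
  | .add, x, y => x + y < L
  | .sub, x, y => y ≤ x
  | .mul, x, y => x * y < L
  | _, _, _ => True

theorem apply_eq_exact {w L : ℕ} (hL : L < 2 ^ w) (h2 : 2 ≤ L) {o : Op} {x y : ℕ}
    (hx : x < 2 ^ w) (hy : y < 2 ^ w) (h : Fits L o x y) : o.apply w x y = exact o x y := by
  cases o <;> simp only [Op.apply, exact, Fits] at *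
  · exact Nat.mod_eq_of_lt (by omega)
  · rw [Nat.mod_eq_of_lt hy, show x + (2 ^ w - y) = (x - y) + 2 ^ w by omega, Nat.add_mod_right]
    exact Nat.mod_eq_of_lt (by omega)
  · exact Nat.mod_eq_of_lt (by omega)
  · exact Nat.mod_eq_of_lt (lt_of_le_of_lt (Nat.div_le_self _ _) hx)
  · exact Nat.mod_eq_of_lt (lt_of_le_of_lt (Nat.mod_le _ _) hx)
  · rw [Nat.mod_eq_of_lt (by omega)]
  · rw [Nat.mod_eq_of_lt (by omega)]

theorem apply_lt {w : ℕ} {o : Op} {x y : ℕ} : o.apply w x y < 2 ^ w := by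
  have : 0 < 2 ^ w := by positivity
  cases o <;> simp only [Op.apply]
  iterate 5 exact Nat.mod_lt _ this
  all_goals split_ifs <;> first | exact Nat.mod_lt _ this | exact this

/-! ### Syntax and semantics of the array language. -/

inductive AExpr
  | const (k : ℕ)
  | reg (r : ℕ)
  | load (k : Fin 16) (i : AExpr)
  | bin (o : Op) (e₁ e₂ : AExpr)
  | wbin (o : Op) (e₁ e₂ : AExpr)

inductive ACmd
  | skip
  | assign (r : ℕ) (e : AExpr)
  | store (k : Fin 16) (i e : AExpr)
  | seq (p q : ACmd)
  | branch (e : AExpr) (p q : ACmd)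
  | loop (e : AExpr) (p : ACmd)

structure AState where
  reg : ℕ → ℕ
  arr : Fin 16 → ℕ → ℕ

namespace AExpr

instance : Add AExpr := ⟨.bin .add⟩
instance : Sub AExpr := ⟨.bin .sub⟩
instance : Mul AExpr := ⟨.bin .mul⟩
instance : Div AExpr := ⟨.bin .div⟩
instance : Mod AExpr := ⟨.bin .mod⟩
instance (n : ℕ) : OfNat AExpr n := ⟨.const n⟩

def eval (M : Machine) (s : AState) : AExpr → ℕ
  | .const k => k
  | .reg r => s.reg r
  | .load k i => s.arr k (i.eval M s)
  | .bin o e₁ e₂ => exact o (e₁.eval M s) (e₂.eval M s)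
  | .wbin o e₁ e₂ => o.apply M.w (e₁.eval M s) (e₂.eval M s)

/-- No overflow occurs and all indices are in range. -/
def Safe (M : Machine) (s : AState) : AExpr → Prop
  | .const k => k < M.L
  | .reg _ => True
  | .load _ i => i.Safe M s ∧ i.eval M s < M.L
  | .bin o e₁ e₂ => e₁.Safe M s ∧ e₂.Safe M s ∧ Fits M.L o (e₁.eval M s) (e₂.eval M s)
  | .wbin _ e₁ e₂ => e₁.Safe M s ∧ e₂.Safe M s

/-- Machine register 0 is reserved for the base address, hence the shift of register numbers by one.
Cell i of array k lies at base + 16 i + k. -/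
def compile : AExpr → Expr
  | .const k => .const k
  | .reg r => .reg (r + 1)
  | .load k i => .load (.bin .add (.bin .add (.reg 0) (.bin .mul (.const 16) i.compile)) (.const k))
  | .bin o e₁ e₂ => .bin o e₁.compile e₂.compile
  | .wbin o e₁ e₂ => .bin o e₁.compile e₂.compile

/-- The number of steps that the compiled expression takes. -/
def cost : AExpr → ℕ
  | .const _ => 1
  | .reg _ => 1
  | .load _ i => i.cost + 7
  | .bin _ e₁ e₂ => e₁.cost + e₂.cost + 1
  | .wbin _ e₁ e₂ => e₁.cost + e₂.cost + 1

theorem compile_cost (e : AExpr) : e.compile.cost = e.cost := by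
  induction e <;> simp_all [compile, cost, Expr.cost]; omega

section
variable (M : Machine) (s : AState)
@[simp] theorem eval_ofNat (n : ℕ) : (no_index (OfNat.ofNat n) : AExpr).eval M s = n := rfl
@[simp] theorem eval_const (n : ℕ) : (AExpr.const n).eval M s = n := rfl
@[simp] theorem eval_reg (r : ℕ) : (AExpr.reg r).eval M s = s.reg r := rfl
@[simp] theorem eval_load (k : Fin 16) (i : AExpr) :
    (AExpr.load k i).eval M s = s.arr k (i.eval M s) := rfl
@[simp] theorem eval_add (a b : AExpr) : (a + b).eval M s = a.eval M s + b.eval M s := rfl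
@[simp] theorem eval_sub (a b : AExpr) : (a - b).eval M s = a.eval M s - b.eval M s := rfl
@[simp] theorem eval_mul (a b : AExpr) : (a * b).eval M s = a.eval M s * b.eval M s := rfl
@[simp] theorem eval_div (a b : AExpr) : (a / b).eval M s = a.eval M s / b.eval M s := rfl
@[simp] theorem eval_mod (a b : AExpr) : (a % b).eval M s = a.eval M s % b.eval M s := rfl
@[simp] theorem eval_lt (a b : AExpr) :
    (AExpr.bin .lt a b).eval M s = if a.eval M s < b.eval M s then 1 else 0 := rfl
@[simp] theorem eval_eq (a b : AExpr) :
    (AExpr.bin .eq a b).eval M s = if a.eval M s = b.eval M s then 1 else 0 := rfl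
@[simp] theorem eval_wbin (o : Op) (a b : AExpr) :
    (AExpr.wbin o a b).eval M s = o.apply M.w (a.eval M s) (b.eval M s) := rfl
@[simp] theorem safe_ofNat (n : ℕ) : (no_index (OfNat.ofNat n) : AExpr).Safe M s ↔ n < M.L :=
  Iff.rfl
@[simp] theorem safe_const (n : ℕ) : (AExpr.const n).Safe M s ↔ n < M.L := Iff.rfl
@[simp] theorem safe_reg (r : ℕ) : (AExpr.reg r).Safe M s := trivial
@[simp] theorem safe_load (k : Fin 16) (i : AExpr) :
    (AExpr.load k i).Safe M s ↔ i.Safe M s ∧ i.eval M s < M.L := Iff.rfl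
@[simp] theorem safe_add (a b : AExpr) : (a + b).Safe M s ↔
    a.Safe M s ∧ b.Safe M s ∧ a.eval M s + b.eval M s < M.L := Iff.rfl
@[simp] theorem safe_sub (a b : AExpr) : (a - b).Safe M s ↔
    a.Safe M s ∧ b.Safe M s ∧ b.eval M s ≤ a.eval M s := Iff.rfl
@[simp] theorem safe_mul (a b : AExpr) : (a * b).Safe M s ↔
    a.Safe M s ∧ b.Safe M s ∧ a.eval M s * b.eval M s < M.L := Iff.rfl
@[simp] theorem safe_div (a b : AExpr) : (a / b).Safe M s ↔ a.Safe M s ∧ b.Safe M s :=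
  ⟨fun h => ⟨h.1, h.2.1⟩, fun h => ⟨h.1, h.2, trivial⟩⟩
@[simp] theorem safe_mod (a b : AExpr) : (a % b).Safe M s ↔ a.Safe M s ∧ b.Safe M s :=
  ⟨fun h => ⟨h.1, h.2.1⟩, fun h => ⟨h.1, h.2, trivial⟩⟩
@[simp] theorem safe_lt (a b : AExpr) :
    (AExpr.bin .lt a b).Safe M s ↔ a.Safe M s ∧ b.Safe M s :=
  ⟨fun h => ⟨h.1, h.2.1⟩, fun h => ⟨h.1, h.2, trivial⟩⟩
@[simp] theorem safe_eq (a b : AExpr) :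
    (AExpr.bin .eq a b).Safe M s ↔ a.Safe M s ∧ b.Safe M s :=
  ⟨fun h => ⟨h.1, h.2.1⟩, fun h => ⟨h.1, h.2, trivial⟩⟩
@[simp] theorem safe_wbin (o : Op) (a b : AExpr) :
    (AExpr.wbin o a b).Safe M s ↔ a.Safe M s ∧ b.Safe M s := Iff.rfl
end

end AExpr

/-- The array view of a word RAM state. -/
def view (M : Machine) (c : State) : AState where
  reg r := c.reg (r + 1)
  arr k i := c.mem (M.base + 16 * i + k)

/-- `c` holds words only, register `0` holds the base address, and the array view is `s`. -/
structure Rep (M : Machine) (c : State) (s : AState) : Prop where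
  base : c.reg 0 = M.base
  reg_lt : ∀ r, c.reg r < 2 ^ M.w
  mem_lt : ∀ a, c.mem a < 2 ^ M.w
  view_eq : view M c = s

theorem Rep.address {M : Machine} {c : State} {s : AState} (h : Rep M c s) {k : Fin 16} {e : Expr}
    {i : ℕ} (he : e.eval M.w c = i) (hi : i < M.L) :
    (Expr.bin .add (.bin .add (.reg 0) (.bin .mul (.const 16) e)) (.const k)).eval M.w c
      = M.base + 16 * i + k := by
  have hf := M.fits
  have hk := k.2
  have h2 := M.two_le
  simp only [Expr.eval, Op.apply, he, h.base]
  rw [Nat.mod_eq_of_lt (a := 16) (by omega), Nat.mod_eq_of_lt (a := 16 * i) (by omega),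
    Nat.mod_eq_of_lt (a := (k : ℕ)) (by omega), Nat.mod_eq_of_lt (a := M.base + 16 * i) (by omega),
    Nat.mod_eq_of_lt (by omega)]

/-- `Safe` excludes every wrap-around, so by induction the machine computes the exact value. The
bound on the value is part of the induction because exactness of an operation needs both arguments
to be words. -/
theorem Rep.eval {M : Machine} {c : State} {s : AState} (h : Rep M c s) {e : AExpr}
    (hs : e.Safe M s) : e.compile.eval M.w c = e.eval M s ∧ e.eval M s < 2 ^ M.w := by
  have hv := h.view_eq
  have hL := M.L_lt
  induction e with
  | const k =>
    have : k < M.L := hs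
    simp only [AExpr.compile, Expr.eval, AExpr.eval]
    exact ⟨Nat.mod_eq_of_lt (by omega), by omega⟩
  | reg r =>
    subst hv
    exact ⟨rfl, h.reg_lt _⟩
  | load k i ih =>
    have h1 := ih hs.1
    have h2 := h.address (k := k) h1.1 hs.2
    subst hv
    constructor
    · rw [AExpr.compile, Expr.eval, h2]; rfl
    · exact h.mem_lt _
  | bin o a b iha ihb =>
    have h1 := iha hs.1
    have h2 := ihb hs.2.1
    have h3 := apply_eq_exact hL M.two_le h1.2 h2.2 hs.2.2
    simp only [AExpr.compile, Expr.eval, AExpr.eval, h1.1, h2.1]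
    exact ⟨h3, h3 ▸ apply_lt⟩
  | wbin o a b iha ihb =>
    have h1 := iha hs.1
    have h2 := ihb hs.2
    simp only [AExpr.compile, Expr.eval, AExpr.eval, h1.1, h2.1]
    exact ⟨trivial, apply_lt⟩

namespace AState

def setReg (s : AState) (r v : ℕ) : AState := { s with reg := Function.update s.reg r v }

def setArr (s : AState) (k : Fin 16) (i v : ℕ) : AState :=
  { s with arr := Function.update s.arr k (Function.update (s.arr k) i v) }

@[simp] theorem setReg_arr (s : AState) (r v : ℕ) : (s.setReg r v).arr = s.arr := rfl
@[simp] theorem setArr_reg (s : AState) (k : Fin 16) (i v : ℕ) : (s.setArr k i v).reg = s.reg := rfl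
@[simp] theorem setReg_reg (s : AState) (r v r' : ℕ) :
    (s.setReg r v).reg r' = if r' = r then v else s.reg r' := by
  simp [setReg, Function.update_apply]
@[simp] theorem setArr_arr (s : AState) (k k' : Fin 16) (i v i' : ℕ) :
    (s.setArr k i v).arr k' i' = if k' = k then (if i' = i then v else s.arr k i')
      else s.arr k' i' := by
  by_cases h : k' = k
  · subst h; simp [setArr, Function.update_apply]
  · simp [setArr, h]

theorem setArr_arr_fun (s : AState) (k k' : Fin 16) (i v : ℕ) :
    (s.setArr k i v).arr k' = if k' = k then Function.update (s.arr k) i v else s.arr k' := by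
  by_cases h : k' = k
  · subst h; simp [setArr]
  · simp [setArr, h]

end AState

theorem Rep.setReg {M : Machine} {c : State} {s : AState} (h : Rep M c s) (r v : ℕ)
    (hv : v < 2 ^ M.w) :
    Rep M { c with reg := Function.update c.reg (r + 1) v } (s.setReg r v) := by
  refine ⟨by simpa using h.base, fun r' => ?_, h.mem_lt, ?_⟩
  · by_cases hr : r' = r + 1
    · subst hr; simpa using hv
    · simpa [Function.update_apply, hr] using h.reg_lt r'
  · rw [← h.view_eq]
    simp only [view, AState.setReg, AState.mk.injEq, and_true]
    funext r'
    simp [Function.update_apply]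

/-- Since k < 16, the address base + 16 i + k determines i and k, so a store changes one cell of one
array only. -/
theorem Rep.setArr {M : Machine} {c : State} {s : AState} (h : Rep M c s) (k : Fin 16) (i v : ℕ)
    (hv : v < 2 ^ M.w) :
    Rep M { c with mem := Function.update c.mem (M.base + 16 * i + k) v } (s.setArr k i v) := by
  refine ⟨h.base, h.reg_lt, fun a => ?_, ?_⟩
  · by_cases ha : a = M.base + 16 * i + k
    · subst ha; simpa using hv
    · simpa [Function.update_apply, ha] using h.mem_lt a
  · rw [← h.view_eq]
    simp only [view, AState.setArr, AState.mk.injEq, true_and]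
    funext k' i'
    have := k.2
    have := k'.2
    by_cases hk : k' = k
    · subst hk
      simp [Function.update_apply]
    · have : (k' : ℕ) ≠ k := fun h => hk (Fin.ext h)
      rw [Function.update_of_ne (by omega), Function.update_of_ne hk]

/-! ### Commands, weakest preconditions and step bounds. -/

namespace ACmd

def compile : ACmd → Cmd
  | .skip => .skip
  | .assign r e => .assign (r + 1) e.compile
  | .store k i e => .store (.bin .add (.bin .add (.reg 0) (.bin .mul (.const 16) i.compile))
      (.const k)) e.compile
  | .seq p q => .seq p.compile q.compile
  | .branch e p q => .branch e.compile p.compile q.compile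
  | .loop e p => .loop e.compile p.compile

/-- Bounds the running time of a loop-free program. -/
def cost : ACmd → ℕ
  | .skip => 1
  | .assign _ e => e.cost + 1
  | .store _ i e => i.cost + 6 + e.cost + 1
  | .seq p q => p.cost + q.cost
  | .branch e p q => e.cost + 1 + max p.cost q.cost
  | .loop _ _ => 0

/-- Weakest precondition of a loop-free program. -/
@[simp] def wp (M : Machine) : ACmd → (AState → Prop) → AState → Prop
  | .skip, Q, s => Q s
  | .assign r e, Q, s => e.Safe M s ∧ Q (s.setReg r (e.eval M s))
  | .store k i e, Q, s => i.Safe M s ∧ e.Safe M s ∧ i.eval M s < M.L ∧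
      Q (s.setArr k (i.eval M s) (e.eval M s))
  | .seq p q, Q, s => p.wp M (q.wp M Q) s
  | .branch e p q, Q, s => e.Safe M s ∧ (e.eval M s ≠ 0 → p.wp M Q s) ∧ (e.eval M s = 0 → q.wp M Q s)
  | .loop _ _, _, _ => False

@[simp] def block : List ACmd → ACmd
  | [] => .skip
  | p :: l => .seq p (block l)

/-- `for r = 0, 1, …` while `r` is less than register `b`. -/
def forLoop (r b : ℕ) (p : ACmd) : ACmd :=
  .seq (.assign r (.const 0))
    (.loop (.bin .lt (.reg r) (.reg b)) (.seq p (.assign r (.bin .add (.reg r) (.const 1)))))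

end ACmd

/-- Started in any word RAM state that represents `s`, the compiled program halts within `B` steps
in a state that represents some `s'` with `Q s'`. -/
def Runs (M : Machine) (p : ACmd) (s : AState) (B : ℕ) (Q : AState → Prop) : Prop :=
  ∀ c, Rep M c s → ∃ t c' s', Exec M.w p.compile c t c' ∧ t ≤ B ∧ Rep M c' s' ∧ Q s'

variable {M : Machine}

theorem Runs.mono {p : ACmd} {s : AState} {B B' : ℕ} {Q Q' : AState → Prop}
    (h : Runs M p s B Q) (hB : B ≤ B') (hQ : ∀ s', Q s' → Q' s') : Runs M p s B' Q' := by
  intro c hc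
  obtain ⟨t, c', s', h1, h2, h3, h4⟩ := h c hc
  exact ⟨t, c', s', h1, h2.trans hB, h3, hQ _ h4⟩

theorem Runs.seq {p q : ACmd} {s : AState} {B B' : ℕ} {Q Q' : AState → Prop}
    (h : Runs M p s B Q) (h' : ∀ s', Q s' → Runs M q s' B' Q') :
    Runs M (.seq p q) s (B + B') Q' := by
  intro c hc
  obtain ⟨t, c', s', h1, h2, h3, h4⟩ := h c hc
  obtain ⟨t', c'', s'', k1, k2, k3, k4⟩ := h' s' h4 c' h3
  exact ⟨t + t', c'', s'', .seq h1 k1, by omega, k3, k4⟩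

/-- For loop-free code correctness reduces to simplifying `wp`, and the time bound is a number read
off the syntax. Loops are excluded because `wp` is false on them. -/
theorem Runs.of_wp {p : ACmd} {s : AState} {Q : AState → Prop} (h : p.wp M Q s) :
    Runs M p s p.cost Q := by
  induction p generalizing s Q with
  | skip => exact fun c hc => ⟨1, c, s, .skip c, le_rfl, hc, h⟩
  | assign r e =>
    intro c hc
    have he := hc.eval h.1
    refine ⟨_, _, _, .assign c (r + 1) e.compile, ?_, ?_, h.2⟩
    · rw [AExpr.compile_cost]; rfl
    · rw [he.1]; exact hc.setReg r _ he.2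
  | store k i e =>
    intro c hc
    obtain ⟨h1, h2, h3, h4⟩ := h
    have he := hc.eval h2
    have hi := hc.address (k := k) (hc.eval h1).1 h3
    refine ⟨_, _, _, .store c _ e.compile, ?_, ?_, h4⟩
    · simp only [Expr.cost, AExpr.compile_cost, ACmd.cost]; omega
    · rw [he.1, hi]; exact hc.setArr k _ _ he.2
  | seq p q ihp ihq => exact (ihp h).seq fun s' h' => ihq h'
  | branch e p q ihp ihq =>
    intro c hc
    obtain ⟨h1, h2, h3⟩ := h
    have he := (hc.eval h1).1
    by_cases h0 : e.eval M s = 0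
    · obtain ⟨t, c', s', k1, k2, k3, k4⟩ := ihq (h3 h0) c hc
      refine ⟨_, c', s', .branch_false (he.trans h0) k1, ?_, k3, k4⟩
      rw [AExpr.compile_cost, ACmd.cost]; omega
    · obtain ⟨t, c', s', k1, k2, k3, k4⟩ := ihp (h2 h0) c hc
      refine ⟨_, c', s', .branch_true (by rwa [he]) k1, ?_, k3, k4⟩
      rw [AExpr.compile_cost, ACmd.cost]; omega
  | loop e p => exact h.elim

theorem Runs.branch {e : AExpr} {p q : ACmd} {s : AState} {B : ℕ} {Q : AState → Prop}
    (he : e.Safe M s) (hp : e.eval M s ≠ 0 → Runs M p s B Q)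
    (hq : e.eval M s = 0 → Runs M q s B Q) :
    Runs M (.branch e p q) s (e.cost + 1 + B) Q := by
  intro c hc
  have h1 := (hc.eval he).1
  by_cases h0 : e.eval M s = 0
  · obtain ⟨t, c', s', k1, k2, k3, k4⟩ := hq h0 c hc
    refine ⟨_, c', s', .branch_false (h1.trans h0) k1, ?_, k3, k4⟩
    rw [AExpr.compile_cost]; omega
  · obtain ⟨t, c', s', k1, k2, k3, k4⟩ := hp h0 c hc
    refine ⟨_, c', s', .branch_true (by rwa [h1]) k1, ?_, k3, k4⟩
    rw [AExpr.compile_cost]; omega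

/-- Strong induction on the remaining budget: evaluating the guard costs at least one step, so each
iteration lowers the budget. Termination and the time bound come out together. -/
theorem exec_loop {w : ℕ} {e : Expr} {p : Cmd} (I : ℕ → State → Prop) (Q : State → Prop)
    (h : ∀ b s, I b s → (e.eval w s = 0 ∧ e.cost + 1 ≤ b ∧ Q s) ∨
      (e.eval w s ≠ 0 ∧ ∃ t s' b', Exec w p s t s' ∧ I b' s' ∧ e.cost + 1 + t + b' ≤ b)) :
    ∀ b s, I b s → ∃ t s', Exec w (.loop e p) s t s' ∧ t ≤ b ∧ Q s' := by
  intro b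
  induction b using Nat.strong_induction_on with
  | _ b ih =>
    intro s hs
    rcases h b s hs with ⟨h0, hb, hQ⟩ | ⟨h0, t, s', b', hex, hI, hb⟩
    · exact ⟨_, s, .loop_false h0, hb, hQ⟩
    · obtain ⟨t', s'', h1, h2, h3⟩ := ih b' (by omega) s' hI
      exact ⟨_, s'', .loop_true h0 hex h1, by omega, h3⟩

/-- Loop rule. The invariant depends on the number of steps that are still available. -/
theorem Runs.loop {e : AExpr} {p : ACmd} (I : ℕ → AState → Prop) {Q : AState → Prop}
    (h : ∀ b s, I b s → e.Safe M s ∧ ((e.eval M s = 0 ∧ e.cost + 1 ≤ b ∧ Q s) ∨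
      (e.eval M s ≠ 0 ∧ ∃ c b', e.cost + 1 + c + b' ≤ b ∧ Runs M p s c (I b')))) {b : ℕ} {s : AState}
    (hI : I b s) : Runs M (.loop e p) s b Q := by
  intro c hc
  obtain ⟨t, c', h1, h2, s', h3, h4⟩ := exec_loop (w := M.w) (e := e.compile) (p := p.compile)
    (fun b c => ∃ s, Rep M c s ∧ I b s) (fun c => ∃ s, Rep M c s ∧ Q s) (by
      rintro b c ⟨s, hc, hI⟩
      obtain ⟨hs, h0⟩ := h b s hI
      rw [AExpr.compile_cost, (hc.eval hs).1]
      rcases h0 with ⟨h0, h1, h2⟩ | ⟨h0, k, b', h1, h2⟩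
      · exact .inl ⟨h0, h1, s, hc, h2⟩
      · obtain ⟨t, c', s', k1, k2, k3, k4⟩ := h2 c hc
        exact .inr ⟨h0, t, c', b', k1, ⟨s', k3, k4⟩, by omega⟩) b c ⟨s, hc, hI⟩
  exact ⟨t, c', s', h1, h2, h3, h4⟩

/-- Rule for counting loops whose iterations take different numbers of steps: `c j` bounds the
available steps before iteration `j`, and may depend on the state through the invariant. -/
theorem Runs.forLoop_budget {r b : ℕ} {p : ACmd} {K : ℕ} (I : ℕ → ℕ → AState → Prop)
    {Q : AState → Prop} {s : AState} {B : ℕ} (hK : K < M.L)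
    (h0 : I 0 B (s.setReg r 0))
    (hb : ∀ j β s, j ≤ K → I j β s → s.reg b = K)
    (hstep : ∀ j β s, j < K → s.reg r = j → I j β s → ∃ c β', c + 8 + β' ≤ β ∧
      Runs M p s c (fun s' => s'.reg r = j ∧ I (j + 1) β' (s'.setReg r (j + 1))))
    (hQ : ∀ β s, s.reg r = K → I K β s → Q s) :
    Runs M (ACmd.forLoop r b p) s (B + 6) Q := by
  have hinit : Runs M (.assign r (.const 0)) s 2 (fun s' => s' = s.setReg r 0) := by
    apply Runs.of_wp
    exact ⟨by have := M.two_le; simp only [AExpr.safe_const]; omega, rfl⟩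
  refine (hinit.seq (B' := B + 4) (Q' := Q) ?_).mono (by omega) (fun _ h => h)
  rintro _ rfl
  refine Runs.loop (fun β s => ∃ j γ, j ≤ K ∧ s.reg r = j ∧ I j γ s ∧ γ + 4 ≤ β) ?_
    ⟨0, B, Nat.zero_le _, by simp, h0, le_rfl⟩
  rintro β s ⟨j, γ, hj, hr, hI, hβ⟩
  have hbK := hb j γ s hj hI
  refine ⟨by simp, ?_⟩
  rcases hj.lt_or_eq with hj | rfl
  · right
    obtain ⟨c, γ', hc, hrun⟩ := hstep j γ s hj hr hI
    -- The overhead 8 of an iteration is 4 steps for the test and 4 for the increment; the final 4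
    -- in the budget pays for the last, failing test.
    refine ⟨by simp [hr, hbK, hj], c + 4, γ' + 4, ?_, ?_⟩
    · simp only [AExpr.cost]; omega
    · refine hrun.seq ?_
      rintro s' ⟨h1, h2⟩
      refine (Runs.of_wp (p := .assign r (.bin .add (.reg r) (.const 1))) ?_).mono
        (by simp [ACmd.cost, AExpr.cost]) (fun _ h => h)
      refine ⟨⟨trivial, ?_, ?_⟩, j + 1, γ', hj, ?_, ?_, le_rfl⟩
      · have := M.two_le; show 1 < M.L; omega
      · show s'.reg r + 1 < M.L; omega
      · simp [AExpr.eval, exact, h1]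
      · simpa [AExpr.eval, exact, h1] using h2
  · left
    refine ⟨by simp [hr, hbK], ?_, hQ γ s hr hI⟩
    simp only [AExpr.cost]; omega

/-- Rule for counting loops whose iterations take at most `c` steps each. -/
theorem Runs.forLoop {r b : ℕ} {p : ACmd} {K c : ℕ} (I : ℕ → AState → Prop)
    {Q : AState → Prop} {s : AState} (hK : K < M.L)
    (h0 : I 0 (s.setReg r 0))
    (hb : ∀ j s, j ≤ K → I j s → s.reg b = K)
    (hstep : ∀ j s, j < K → s.reg r = j → I j s →
      Runs M p s c (fun s' => s'.reg r = j ∧ I (j + 1) (s'.setReg r (j + 1))))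
    (hQ : ∀ s, s.reg r = K → I K s → Q s) :
    Runs M (ACmd.forLoop r b p) s (K * (c + 8) + 6) Q := by
  refine Runs.forLoop_budget (fun j β s => I j s ∧ (K - j) * (c + 8) ≤ β) hK ⟨h0, by simp⟩
    (fun j β s hj h => hb j s hj h.1) ?_ (fun β s hs h => hQ s hs h.1)
  rintro j β s hj hr ⟨hI, hβ⟩
  refine ⟨c, (K - (j + 1)) * (c + 8), ?_, (hstep j s hj hr hI).mono le_rfl
    fun s' h => ⟨h.1, h.2, le_rfl⟩⟩
  have : K - j = (K - (j + 1)) + 1 := by omega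
  rw [this] at hβ
  linarith

end ArrayRAM

/-! ### Sums of a generating set of a finite commutative group -/

namespace SumsetGrowth

set_option linter.unusedSectionVars false

open Finset Pointwise

variable {G : Type*} [AddCommGroup G] [Fintype G] [DecidableEq G]

/-- The number of elements that the translation by `x` moves out of `A`. -/
def escape (A : Finset G) (x : G) : ℕ := #{a ∈ A | a + x ∉ A}

theorem escape_zero (A : Finset G) : escape A 0 = 0 := by simp [escape]

/-- An element that leaves `A` under x + y either leaves under x already, or reaches a point of `A`
that leaves under y. -/
theorem escape_add (A : Finset G) (x y : G) : escape A (x + y) ≤ escape A x + escape A y := by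
  have h : ({a ∈ A | a + (x + y) ∉ A} : Finset G) ⊆
      {a ∈ A | a + x ∉ A} ∪ ({a ∈ A | a + y ∉ A} : Finset G).image (fun a => a - x) := by
    intro a ha
    simp only [mem_filter, mem_union, mem_image] at ha ⊢
    by_cases hx : a + x ∈ A
    · exact .inr ⟨a + x, ⟨hx, by rw [add_assoc]; exact ha.2⟩, by abel⟩
    · exact .inl ⟨ha.1, hx⟩
  exact (card_le_card h).trans ((card_union_le _ _).trans (Nat.add_le_add_left card_image_le _))

/-- Translation by x maps the elements that stay in `A` under x bijectively to those that stay under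
-x. -/
theorem escape_neg (A : Finset G) (x : G) : escape A (-x) = escape A x := by
  have h1 := card_filter_add_card_filter_not (s := A) (fun a => a + x ∈ A)
  have h2 := card_filter_add_card_filter_not (s := A) (fun a => a + -x ∈ A)
  have h3 : #{a ∈ A | a + x ∈ A} = #{a ∈ A | a + -x ∈ A} :=
    card_bij' (fun a _ => a + x) (fun a _ => a + -x) (by simp +contextual) (by simp +contextual)
      (by simp) (by simp)
  unfold escape
  omega

/-- Double counting: each a in `A` is moved out by exactly one x for each element of the complement.
-/
theorem sum_escape (A : Finset G) : ∑ x, escape A x = #A * (Fintype.card G - #A) := by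
  simp only [escape, card_filter]
  rw [sum_comm, sum_const_nat (m := Fintype.card G - #A)]
  intro a _
  rw [← card_filter, ← card_univ, ← card_sdiff_of_subset (subset_univ A)]
  exact card_bij' (fun x _ => a + x) (fun x _ => x - a) (by simp) (by simp) (by simp) (by simp)

/-- By finiteness X + b ⊆ X forces equality, so the stabilizer of X is a subgroup that contains the
generators. -/
theorem eq_univ_of_add_subset {B X : Finset G} (hB : AddSubgroup.closure (B : Set G) = ⊤)
    (hX : X.Nonempty) (h : ∀ x ∈ X, ∀ b ∈ B, x + b ∈ X) : X = univ := by
  let H : AddSubgroup G :=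
    { carrier := {g | ∀ x, x ∈ X ↔ x + g ∈ X}
      zero_mem' := by simp
      add_mem' := fun {a b} ha hb x => by rw [← add_assoc, ← hb (x + a)]; exact ha x
      neg_mem' := fun {a} ha x => by simpa using (ha (x + -a)).symm }
  have hBH : (B : Set G) ⊆ H := by
    intro b hb x
    refine ⟨fun hx => h x hx b hb, fun hx => ?_⟩
    have him : X.image (· + b) = X := eq_of_subset_of_card_le
      (image_subset_iff.2 fun x hx => h x hx b hb)
      (card_image_of_injective _ (add_left_injective b)).ge
    rw [← him, mem_image] at hx
    obtain ⟨y, hy, hyx⟩ := hx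
    rwa [← add_right_cancel hyx]
  have hH : H = ⊤ := top_le_iff.1 (hB ▸ (AddSubgroup.closure_le H).2 hBH)
  obtain ⟨x, hx⟩ := hX
  refine eq_univ_of_forall fun y => ?_
  have : y - x ∈ H := hH ▸ AddSubgroup.mem_top _
  simpa using (this x).1 hx

variable {A B : Finset G}

/-- Moving by a generator changes the escape count by at most ε. So as long as some count is large,
there is a point y in the middle of the next window of width 3ε, and the whole translate y + B lies
in that window. Each window thus contributes |B| new elements. -/
theorem escape_le_of_forall_le (hB : AddSubgroup.closure (B : Set G) = ⊤) {ε : ℕ}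
    (hε : ∀ b ∈ B, escape A b ≤ ε) (i : ℕ) :
    (∀ x, escape A x ≤ 3 * i * ε) ∨ i * #B ≤ #{x | escape A x ≤ 3 * i * ε} := by
  induction i with
  | zero => right; simp
  | succ i ih =>
    by_cases hall : ∀ x, escape A x ≤ (3 * i + 1) * ε
    · left
      intro x
      exact (hall x).trans (Nat.mul_le_mul_right _ (by omega))
    · have ih : i * #B ≤ #{x | escape A x ≤ 3 * i * ε} := by
        refine ih.resolve_left fun h => hall fun x => ?_
        exact (h x).trans (Nat.mul_le_mul_right _ (by omega))
      right
      -- Discrete intermediate value argument: if no count fell into this interval, the points with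
      -- count at most (3i + 1)ε would be closed under adding generators, hence be all of the group.
      obtain ⟨y, hy, hy'⟩ : ∃ y, (3 * i + 1) * ε < escape A y ∧ escape A y ≤ (3 * i + 2) * ε := by
        by_contra! hno
        have := eq_univ_of_add_subset (X := univ.filter fun x => escape A x ≤ (3 * i + 1) * ε) hB
          ⟨0, by simp [escape_zero]⟩ (by
            intro x hx b hb
            simp only [mem_filter, mem_univ, true_and] at hx ⊢
            by_contra! hlt
            have h1 := hno _ hlt
            have h2 := escape_add A x b
            have h3 := hε b hb
            nlinarith)
        refine hall fun x => ?_
        exact (mem_filter.1 (this.ge (mem_univ x))).2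
      have hdisj : Disjoint ({x | escape A x ≤ 3 * i * ε} : Finset G) (B.image (y + ·)) := by
        rw [disjoint_left]
        intro x hx hx'
        simp only [mem_filter, mem_univ, true_and, mem_image] at hx hx'
        obtain ⟨b, hb, rfl⟩ := hx'
        have h2 := escape_add A (y + b) (-b)
        rw [escape_neg, add_neg_cancel_right] at h2
        have h3 := hε b hb
        nlinarith
      have hsub : ({x | escape A x ≤ 3 * i * ε} : Finset G) ∪ B.image (y + ·) ⊆
          ({x | escape A x ≤ 3 * (i + 1) * ε} : Finset G) := by
        intro x hx
        simp only [mem_filter, mem_univ, true_and, mem_union, mem_image] at hx ⊢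
        rcases hx with hx | ⟨b, hb, rfl⟩
        · exact hx.trans (Nat.mul_le_mul_right _ (by omega))
        · have h2 := escape_add A y b
          have h3 := hε b hb
          nlinarith
      have hcard := card_le_card hsub
      rw [card_union_of_disjoint hdisj, card_image_of_injective _ (add_right_injective y)] at hcard
      linarith

/-- Adding a generating set `B` to a set with at most half of the elements makes it larger by
a factor of at least `1 + 1 / (6 * (|G| / |B| + 1))`. -/
theorem card_add_growth (hB : AddSubgroup.closure (B : Set G) = ⊤) (h0 : (0 : G) ∈ B)
    (hA : 2 * #A ≤ Fintype.card G) {q : ℕ} (hq : q = 6 * (Fintype.card G / #B + 1)) :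
    (q + 1) * #A ≤ q * #(A + B) := by
  have hBpos : 0 < #B := card_pos.2 ⟨0, h0⟩
  obtain ⟨β, hβ, hmax⟩ := exists_max_image B (escape A) ⟨0, h0⟩
  set ε := escape A β with hεdef
  set i := Fintype.card G / #B + 1 with hi
  -- Since i |B| > |G|, the alternative in the lemma would produce more elements than the group has.
  have hall : ∀ x, escape A x ≤ 3 * i * ε := by
    refine (escape_le_of_forall_le hB hmax i).resolve_right fun h => ?_
    have h1 : #({x | escape A x ≤ 3 * i * ε} : Finset G) ≤ Fintype.card G := card_le_univ _
    have h2 : Fintype.card G < #B * i := Nat.lt_mul_div_succ _ hBpos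
    nlinarith
  have hsum : #A * (Fintype.card G - #A) ≤ Fintype.card G * (3 * i * ε) := by
    rw [← sum_escape]
    exact (sum_le_card_nsmul _ _ _ fun x _ => hall x).trans (by simp [card_univ])
  have hG : 0 < Fintype.card G := Fintype.card_pos
  -- The average escape count is |A|(|G| - |A|)/|G| ≥ |A|/2, so the uniform bound 3iε is at least
  -- |A|/2; this is where q = 6i comes from.
  have hε : #A ≤ q * ε := by
    have h1 : #A * Fintype.card G ≤ 2 * (#A * (Fintype.card G - #A)) := by
      have : Fintype.card G ≤ 2 * (Fintype.card G - #A) := by omega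
      nlinarith
    have h2 : Fintype.card G * #A ≤ Fintype.card G * (q * ε) := by
      rw [hq]; nlinarith
    exact Nat.le_of_mul_le_mul_left h2 hG
  have hcard : #A + ε ≤ #(A + B) := by
    have hsub : A ∪ ({a ∈ A | a + β ∉ A} : Finset G).image (· + β) ⊆ A + B := by
      intro x hx
      simp only [mem_union, mem_image, mem_filter] at hx
      rcases hx with hx | ⟨a, ha, rfl⟩
      · simpa using add_mem_add hx h0
      · exact add_mem_add ha.1 hβ
    have hdisj : Disjoint A (({a ∈ A | a + β ∉ A} : Finset G).image (· + β)) := by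
      rw [disjoint_left]
      intro x hx hx'
      simp only [mem_image, mem_filter] at hx'
      obtain ⟨a, ha, rfl⟩ := hx'
      exact ha.2 hx
    have := card_le_card hsub
    rwa [card_union_of_disjoint hdisj, card_image_of_injective _ (add_left_injective β)] at this
  nlinarith

theorem nsmul_subset_nsmul (h0 : (0 : G) ∈ B) {i j : ℕ} (h : i ≤ j) : i • B ⊆ j • B :=
  Finset.nsmul_subset_nsmul_right h0 h

/-- While at most half of the group is reached, q further summands double the size. After l
doublings more than half is reached, and twice such a set is everything. -/
theorem nsmul_eq_univ (hB : AddSubgroup.closure (B : Set G) = ⊤) (h0 : (0 : G) ∈ B) {q l : ℕ}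
    (hq : q = 6 * (Fintype.card G / #B + 1)) (hl : Fintype.card G < 2 ^ l) :
    (2 * (q * l)) • B = univ := by
  -- Linear growth is enough: each further summand adds at least a q-th part of the size at the
  -- start k, so j = q gives a doubling.
  have hstep : ∀ k j, j ≤ q → Fintype.card G < 2 * #((k + j) • B) ∨
      (q + j) * #(k • B) ≤ q * #((k + j) • B) := by
    intro k j
    induction j with
    | zero => intro _; right; simp
    | succ j ih =>
      intro hj
      have hmono : #((k + j) • B) ≤ #((k + (j + 1)) • B) :=
        card_le_card (nsmul_subset_nsmul h0 (by omega))
      rcases ih (by omega) with h | h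
      · left; omega
      · by_cases hA : 2 * #((k + j) • B) ≤ Fintype.card G
        · right
          have hg := card_add_growth hB h0 hA hq
          rw [← add_assoc k, succ_nsmul]
          have hk : #(k • B) ≤ #((k + j) • B) := card_le_card (nsmul_subset_nsmul h0 (by omega))
          nlinarith
        · left; omega
  have hdouble : ∀ i, Fintype.card G < 2 * #((q * i) • B) ∨ 2 ^ i ≤ #((q * i) • B) := by
    intro i
    induction i with
    | zero => right; simp
    | succ i ih =>
      have hmono : #((q * i) • B) ≤ #((q * (i + 1)) • B) :=
        card_le_card (nsmul_subset_nsmul h0 (Nat.mul_le_mul_left _ (by omega)))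
      rcases ih with h | h
      · left; omega
      · refine (hstep (q * i) q le_rfl).imp (fun h => ?_) (fun h' => ?_)
        · rwa [mul_add_one]
        · rw [mul_add_one]
          have hqpos : 0 < q := by rw [hq]; positivity
          have : q * (2 * #((q * i) • B)) ≤ q * #((q * i + q) • B) := by linarith
          have := Nat.le_of_mul_le_mul_left this hqpos
          rw [pow_succ]; omega
  have hhalf : Fintype.card G < 2 * #((q * l) • B) := by
    rcases hdouble l with h | h
    · exact h
    · have : 0 < 2 ^ l := by positivity
      omega
  rw [two_mul, add_nsmul]
  refine eq_univ_of_forall fun x => ?_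
  by_contra hx
  -- If x were not a sum of two elements of X, then X and x - X would be disjoint, although each has
  -- more than half of the elements.
  have hdisj : Disjoint ((q * l) • B) (((q * l) • B).image (x - ·)) := by
    rw [disjoint_left]
    intro y hy hy'
    obtain ⟨z, hz, rfl⟩ := mem_image.1 hy'
    exact hx (by simpa using add_mem_add hy hz)
  have := card_le_univ ((q * l) • B ∪ ((q * l) • B).image (x - ·))
  rw [card_union_of_disjoint hdisj, card_image_of_injective _ sub_right_injective] at this
  omega

end SumsetGrowth

/-! ### Feasible values of a coin system -/

/-- Strictly increasing positive coins `A 0 < ⋯ < A (m - 1)` without a common factor. -/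
structure CoinSystem (A : ℕ → ℕ) (m : ℕ) : Prop where
  size_pos : 0 < m
  pos : 0 < A 0
  mono : ∀ i j, i < j → j < m → A i < A j
  gcd : ∀ d, (∀ i < m, d ∣ A i) → d = 1

/-- The feasible target values. -/
def Feas (A : ℕ → ℕ) (m : ℕ) : AddSubmonoid ℕ := AddSubmonoid.closure (A '' Set.Iio m)

/-- `T` is large enough for each residue class to have a feasible value up to `T`. -/
def TableBound (A : ℕ → ℕ) (m T : ℕ) : Prop := ∀ r, ∃ t ∈ Feas A m, t ≡ r [MOD A 0] ∧ t ≤ T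

/-- The least feasible value in its residue class modulo the first coin. -/
def IsApery (A : ℕ → ℕ) (m v : ℕ) : Prop :=
  v ∈ Feas A m ∧ ∀ u ∈ Feas A m, u ≡ v [MOD A 0] → v ≤ u

/-! ### Apéry values and the bound on the table entries. -/

section
variable {A : ℕ → ℕ} {m : ℕ}

theorem coin_mem_feas {i : ℕ} (hi : i < m) : A i ∈ Feas A m :=
  AddSubmonoid.subset_closure ⟨i, hi, rfl⟩

theorem feas_cases {v : ℕ} (hv : v ∈ Feas A m) : v = 0 ∨ ∃ i < m, ∃ u ∈ Feas A m, v = A i + u := by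
  induction hv using AddSubmonoid.closure_induction with
  | mem x hx =>
    obtain ⟨i, hi, rfl⟩ := hx
    exact .inr ⟨i, hi, 0, zero_mem _, rfl⟩
  | zero => exact .inl rfl
  | add x y hx hy ihx ihy =>
    rcases ihx with rfl | ⟨i, hi, u, hu, rfl⟩
    · simpa using ihy
    · exact .inr ⟨i, hi, u + y, add_mem hu hy, by ring⟩

/-- A smaller feasible value congruent to u, together with v, would undercut u + v. -/
theorem IsApery.of_add {u v : ℕ} (h : IsApery A m (u + v)) (hu : u ∈ Feas A m)
    (hv : v ∈ Feas A m) : IsApery A m u := by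
  refine ⟨hu, fun u' hu' hmod => ?_⟩
  have := h.2 (u' + v) (add_mem hu' hv) (hmod.add_right v)
  omega

theorem TableBound.exists_apery {T : ℕ} (h : TableBound A m T) (r : ℕ) :
    ∃ v, IsApery A m v ∧ v ≡ r [MOD A 0] ∧ v ≤ T := by
  classical
  obtain ⟨t, ht, hr, hT⟩ := h r
  have hex : ∃ t, t ∈ Feas A m ∧ t ≡ r [MOD A 0] := ⟨t, ht, hr⟩
  refine ⟨Nat.find hex, ⟨(Nat.find_spec hex).1, fun u hu hur => ?_⟩, (Nat.find_spec hex).2,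
    (Nat.find_min' hex ⟨ht, hr⟩).trans hT⟩
  exact Nat.find_min' hex ⟨hu, hur.trans (Nat.find_spec hex).2⟩

namespace CoinSystem

variable (h : CoinSystem A m)
include h

theorem le_last {i : ℕ} (hi : i < m) : A i ≤ A (m - 1) := by
  rcases Nat.lt_or_ge i (m - 1) with h1 | h1
  · exact (h.mono i (m - 1) h1 (by omega)).le
  · rw [show i = m - 1 by omega]

theorem pos_of_lt {i : ℕ} (hi : i < m) : A 0 ≤ A i := by
  rcases Nat.eq_zero_or_pos i with rfl | h0
  · exact le_rfl
  · exact (h.mono 0 i h0 hi).le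

theorem index_le {i : ℕ} (hi : i < m) : i + 1 ≤ A i := by
  induction i with
  | zero => exact h.pos
  | succ i ih => have := h.mono i (i + 1) (by omega) hi; have := ih (by omega); omega

theorem size_le_last : m ≤ A (m - 1) := by
  have := h.size_pos
  have := h.index_le (i := m - 1) (by omega)
  omega

theorem inj {i j : ℕ} (hi : i < m) (hj : j < m) (hij : A i = A j) : i = j := by
  rcases lt_trichotomy i j with h1 | h1 | h1
  · have := h.mono i j h1 hj; omega
  · exact h1
  · have := h.mono j i h1 hi; omega

/-- The residues of the coins modulo the first coin. -/
theorem closure_residues :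
    AddSubgroup.closure
      (((Finset.range m).image (fun i => (A i : ZMod (A 0))) : Finset (ZMod (A 0))) :
        Set (ZMod (A 0))) = ⊤ := by
  set H := AddSubgroup.closure
      (((Finset.range m).image (fun i => (A i : ZMod (A 0))) : Finset (ZMod (A 0))) :
        Set (ZMod (A 0))) with hH
  -- The preimage in ℤ is dℤ. It contains every coin, so d divides all coins and the gcd condition
  -- makes d a unit.
  obtain ⟨d, hd⟩ := Int.subgroup_cyclic (H.comap (Int.castAddHom (ZMod (A 0))))
  have hdvd : ∀ i < m, d.natAbs ∣ A i := by
    intro i hi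
    have : (A i : ℤ) ∈ H.comap (Int.castAddHom (ZMod (A 0))) := by
      simp only [AddSubgroup.mem_comap, Int.coe_castAddHom, Int.cast_natCast]
      exact AddSubgroup.subset_closure (by simpa using ⟨i, hi, rfl⟩)
    rw [hd, ← AddSubgroup.zmultiples_eq_closure, Int.mem_zmultiples_iff] at this
    exact Int.natCast_dvd_natCast.1 (by simpa using this)
  have h1 := h.gcd _ hdvd
  have hone : (1 : ZMod (A 0)) ∈ H := by
    have : (1 : ℤ) ∈ H.comap (Int.castAddHom (ZMod (A 0))) := by
      rw [hd, ← AddSubgroup.zmultiples_eq_closure, Int.mem_zmultiples_iff]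
      exact Int.natAbs_dvd_natAbs.1 (by simp [h1])
    simpa using this
  refine eq_top_iff.2 fun x _ => ?_
  have : NeZero (A 0) := ⟨h.pos.ne'⟩
  rw [← ZMod.natCast_zmod_val x, ← nsmul_one]
  exact H.nsmul_mem hone _

/-- Coins in the same residue class are told apart by their quotients by the first coin, which lie
between 1 and `A (m - 1) / A 0`. So each class contains at most that many coins. -/
theorem card_residues :
    m * A 0 ≤ ((Finset.range m).image (fun i => (A i : ZMod (A 0)))).card * A (m - 1) := by
  have hfib := Finset.card_le_mul_card_image (s := Finset.range m)
    (f := fun i => (A i : ZMod (A 0))) (A (m - 1) / A 0) (by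
      intro x _
      have := Finset.card_le_card_of_injOn (s := {i ∈ Finset.range m | (A i : ZMod (A 0)) = x})
        (t := Finset.Icc 1 (A (m - 1) / A 0)) (fun i => A i / A 0) (by
          intro i hi
          simp only [Finset.coe_filter, Finset.mem_range, Set.mem_ofPred_eq] at hi
          simp only [Finset.coe_Icc, Set.mem_Icc]
          exact ⟨(Nat.one_le_div_iff h.pos).2 (h.pos_of_lt hi.1),
            Nat.div_le_div_right (h.le_last hi.1)⟩) (by
          intro i hi j hj hij
          simp only [Finset.coe_filter, Finset.mem_range, Set.mem_ofPred_eq] at hi hj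
          have hmod : A i ≡ A j [MOD A 0] :=
            (ZMod.natCast_eq_natCast_iff _ _ _).1 (hi.2.trans hj.2.symm)
          refine h.inj hi.1 hj.1 ?_
          rw [← Nat.div_add_mod (A i) (A 0), ← Nat.div_add_mod (A j) (A 0)]
          rw [show A i / A 0 = A j / A 0 from hij, hmod])
      simpa using this)
  rw [Finset.card_range] at hfib
  have := Nat.div_mul_le_self (A (m - 1)) (A 0)
  calc m * A 0 ≤ A (m - 1) / A 0 * _ * A 0 := Nat.mul_le_mul_right _ hfib
    _ = _ * (A (m - 1) / A 0 * A 0) := by ring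
    _ ≤ _ := Nat.mul_le_mul_left _ this

open Pointwise in
theorem exists_feas_of_mem_nsmul {k : ℕ} {x : ZMod (A 0)}
    (hx : x ∈ k • (Finset.range m).image (fun i => (A i : ZMod (A 0)))) :
    ∃ t ∈ Feas A m, t ≤ k * A (m - 1) ∧ (t : ZMod (A 0)) = x := by
  induction k generalizing x with
  | zero =>
    refine ⟨0, zero_mem _, by simp, ?_⟩
    simpa [eq_comm] using hx
  | succ k ih =>
    rw [succ_nsmul] at hx
    obtain ⟨y, hy, z, hz, rfl⟩ := Finset.mem_add.1 hx
    obtain ⟨t, ht, htk, rfl⟩ := ih hy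
    obtain ⟨i, hi, rfl⟩ := Finset.mem_image.1 hz
    have hi := Finset.mem_range.1 hi
    refine ⟨t + A i, add_mem ht (coin_mem_feas hi), ?_, by push_cast; rfl⟩
    have := h.le_last hi
    linarith

/-- `SumsetGrowth.nsmul_eq_univ` reaches every residue with a bounded number of coins, each at most
`A (m - 1)`; `card_residues` replaces |G|/|B| by `A (m - 1) / m`. -/
theorem tableBound :
    TableBound A m (12 * (A (m - 1) / m + 1) * (A (m - 1)).size * A (m - 1)) := by
  have : NeZero (A 0) := ⟨h.pos.ne'⟩
  intro r
  set B := (Finset.range m).image (fun i => (A i : ZMod (A 0))) with hB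
  have h0 : (0 : ZMod (A 0)) ∈ B :=
    Finset.mem_image.2 ⟨0, Finset.mem_range.2 h.size_pos, by simp⟩
  have hBpos : 0 < B.card := Finset.card_pos.2 ⟨0, h0⟩
  have huniv := SumsetGrowth.nsmul_eq_univ h.closure_residues h0 rfl
    (l := (A 0).size) (by rw [ZMod.card]; exact Nat.lt_size_self _)
  rw [ZMod.card] at huniv
  obtain ⟨t, ht, htk, htr⟩ := h.exists_feas_of_mem_nsmul (k := _) (x := (r : ZMod (A 0)))
    (by rw [huniv]; exact Finset.mem_univ _)
  refine ⟨t, ht, (ZMod.natCast_eq_natCast_iff _ _ _).1 htr, htk.trans (Nat.mul_le_mul_right _ ?_)⟩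
  have hdiv : A 0 / B.card ≤ A (m - 1) / m := by
    rw [Nat.le_div_iff_mul_le h.size_pos]
    have h1 := Nat.div_mul_le_self (A 0) B.card
    have h2 := h.card_residues
    refine Nat.le_of_mul_le_mul_right ?_ h.pos
    calc A 0 / B.card * m * A 0 = A 0 / B.card * (m * A 0) := by ring
      _ ≤ A 0 / B.card * (B.card * A (m - 1)) := Nat.mul_le_mul_left _ h2
      _ = A 0 / B.card * B.card * A (m - 1) := by ring
      _ ≤ A 0 * A (m - 1) := Nat.mul_le_mul_right _ h1
      _ = _ := by ring
  have hsize : (A 0).size ≤ (A (m - 1)).size := Nat.size_le_size (h.pos_of_lt (by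
    have := h.size_pos; omega))
  calc 2 * (6 * (A 0 / B.card + 1) * (A 0).size) = 12 * (A 0 / B.card + 1) * (A 0).size := by ring
    _ ≤ _ := Nat.mul_le_mul (by omega) hsize

end CoinSystem
end

/-! ### Closing a residue table under one coin -/

/-- `b'` is the table obtained from `b` by adding any multiple of the coin `a`. -/
structure IsCoinClosure (n a : ℕ) (b b' : ℕ → ℕ) : Prop where
  eq_add : ∀ p < n, ∃ k, ∃ p₀ < n, b' p = b p₀ + k * a ∧ p₀ + k * a ≡ p [MOD n]
  step : ∀ p < n, b' ((p + a) % n) ≤ b' p + a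
  le : ∀ p < n, b' p ≤ b p

/-- Steps of length a split the residues modulo n into gcd(a, n) cycles of length n / gcd(a, n), and
the residues below the gcd represent them. Bézout gives the position on the cycle. -/
theorem exists_start_of_gcd {n a : ℕ} (hn : 0 < n) (p : ℕ) :
    ∃ q < Nat.gcd a n, ∃ i < n / Nat.gcd a n, q + i * a ≡ p [MOD n] := by
  set d := Nat.gcd a n with hd
  have hdpos : 0 < d := Nat.gcd_pos_of_pos_right a hn
  have hdn : d ∣ n := Nat.gcd_dvd_right a n
  have hda : d ∣ a := Nat.gcd_dvd_left a n
  have hlen : 0 < n / d := Nat.div_pos (Nat.le_of_dvd hn hdn) hdpos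
  have hbez : (d : ℤ) = a * Nat.gcdA a n + n * Nat.gcdB a n := Nat.gcd_eq_gcd_ab a n
  set z : ℤ := Nat.gcdA a n * (p / d : ℕ) with hz
  have hlenZ : (0 : ℤ) < ((n / d : ℕ) : ℤ) := by exact_mod_cast hlen
  refine ⟨p % d, Nat.mod_lt _ hdpos, (z % ((n / d : ℕ) : ℤ)).toNat, ?_, ?_⟩
  · have := Int.emod_lt_of_pos z hlenZ
    have := Int.emod_nonneg z hlenZ.ne'
    omega
  · rw [← Int.natCast_modEq_iff]
    rw [Nat.cast_add, Nat.cast_mul, Int.toNat_of_nonneg (Int.emod_nonneg z hlenZ.ne')]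
    have h1 : (z % ((n / d : ℕ) : ℤ)) * a ≡ z * a [ZMOD n] := by
      have hz1 : z % ((n / d : ℕ) : ℤ) = z - (n / d : ℕ) * (z / ((n / d : ℕ) : ℤ)) := by
        have := Int.emod_add_mul_ediv z ((n / d : ℕ) : ℤ); linarith
      rw [hz1]
      refine (Int.modEq_iff_dvd.2 ?_)
      obtain ⟨a', ha'⟩ := hda
      have hn' : (n : ℤ) = d * (n / d : ℕ) := by exact_mod_cast (Nat.mul_div_cancel' hdn).symm
      refine ⟨a' * (z / ((n / d : ℕ) : ℤ)), ?_⟩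
      rw [ha', hn']
      push_cast
      ring
    have h2 : z * a ≡ d * (p / d : ℕ) [ZMOD n] := by
      refine Int.modEq_iff_dvd.2 ⟨Nat.gcdB a n * (p / d : ℕ), ?_⟩
      rw [hz, hbez]; ring
    have h3 : ((p % d : ℕ) : ℤ) + d * (p / d : ℕ) = p := by exact_mod_cast Nat.mod_add_div p d
    have := ((h1.trans h2).add_left ((p % d : ℕ) : ℤ))
    rw [h3] at this
    exact_mod_cast this

/-- The table `b'` accounts for the first `k` steps of the walk from residue `q`. -/
def WalkClosed (n a : ℕ) (b b' : ℕ → ℕ) (q k : ℕ) : Prop :=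
  ∀ i j, i + j ≤ k → b' ((q + (i + j) * a) % n) ≤ b ((q + i * a) % n) + j * a

/-- Two turns suffice: within them every residue of the cycle is visited in the first turn and
followed by a full turn, and more than one full turn from a starting entry never helps. -/
theorem isCoinClosure_of_walks {n a : ℕ} {b b' : ℕ → ℕ} (hn : 0 < n)
    (h1 : ∀ p < n, ∃ k, ∃ p₀ < n, b' p = b p₀ + k * a ∧ p₀ + k * a ≡ p [MOD n])
    (h3 : ∀ p < n, b' p ≤ b p)
    (hw : ∀ q < Nat.gcd a n, WalkClosed n a b b' q (2 * (n / Nat.gcd a n))) :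
    IsCoinClosure n a b b' := by
  refine ⟨h1, fun p hp => ?_, h3⟩
  obtain ⟨k, p₀, hp₀, hk, hmod⟩ := h1 p hp
  obtain ⟨q, hq, i, hi, hqi⟩ := exists_start_of_gcd (a := a) hn p₀
  set len := n / Nat.gcd a n with hlen
  have hk' : k % len < len := Nat.mod_lt _ (by omega)
  -- Reducing k modulo the cycle length keeps the residue and only lowers the value. Then i + k %
  -- len + 1 is less than 2 len.
  have hw := hw q hq i (k % len + 1) (by omega)
  have hdvd : n ∣ len * a := by
    obtain ⟨a', ha'⟩ := Nat.gcd_dvd_left a n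
    refine ⟨a', ?_⟩
    conv_lhs => rw [ha']
    rw [← mul_assoc, hlen, Nat.div_mul_cancel (Nat.gcd_dvd_right a n)]
  have hka : k * a ≡ k % len * a [MOD n] := by
    have : k * a = k % len * a + k / len * (len * a) := by
      conv_lhs => rw [← Nat.mod_add_div k len]
      ring
    rw [this]
    have h0 : k / len * (len * a) ≡ 0 [MOD n] :=
      (Nat.modEq_zero_iff_dvd).2 (dvd_mul_of_dvd_right hdvd _)
    exact (h0.add_left _)
  have e1 : (q + (i + (k % len + 1)) * a) % n = (p + a) % n := by
    have : q + (i + (k % len + 1)) * a = (q + i * a) + k % len * a + a := by ring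
    rw [this]
    exact ((hqi.add hka.symm).trans hmod).add_right a
  have e2 : (q + i * a) % n = p₀ := by rw [hqi, Nat.mod_eq_of_lt hp₀]
  rw [e1, e2] at hw
  refine hw.trans ?_
  rw [hk]
  have := Nat.mul_le_mul_right a (Nat.mod_le k len)
  linarith

/-! ### Register and array frames, and round robin on the machine. -/

namespace ArrayRAM

variable {M : Machine}

/-- The registers below `l` agree. -/
def SameBelow (l : ℕ) (s s' : AState) : Prop := ∀ r < l, s'.reg r = s.reg r

theorem SameBelow.refl (l : ℕ) (s : AState) : SameBelow l s s := fun _ _ => rfl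

theorem SameBelow.trans {l l' : ℕ} {s s' s'' : AState} (h : SameBelow l s s')
    (h' : SameBelow l' s' s'') (hl : l ≤ l' := by omega) : SameBelow l s s'' :=
  fun r hr => (h' r (by omega)).trans (h r hr)

theorem SameBelow.mono {l l' : ℕ} {s s' : AState} (h : SameBelow l s s')
    (hl : l' ≤ l := by omega) : SameBelow l' s s' := fun r hr => h r (by omega)

theorem SameBelow.setReg {l r : ℕ} {s s' : AState} (h : SameBelow l s s') (v : ℕ)
    (hl : l ≤ r := by omega) : SameBelow l s (s'.setReg r v) := by
  intro i hi
  rw [AState.setReg_reg, if_neg (by omega)]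
  exact h i hi

@[simp] theorem sameBelow_setReg {l r v : ℕ} {s s' : AState} (hl : l ≤ r) :
    SameBelow l s (s'.setReg r v) ↔ SameBelow l s s' := by
  refine ⟨fun h i hi => ?_, fun h => h.setReg v hl⟩
  have := h i hi
  rwa [AState.setReg_reg, if_neg (by omega)] at this

@[simp] theorem sameBelow_setArr {l i v : ℕ} {k : Fin 16} {s s' : AState} :
    SameBelow l s (s'.setArr k i v) ↔ SameBelow l s s' := Iff.rfl

@[simp] theorem sameBelow_self (l : ℕ) (s : AState) : SameBelow l s s := SameBelow.refl l s

theorem AState.setArr_arr_eq {s s₀ : AState} {k : Fin 16} {f : ℕ → ℕ}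
    (h : s.arr = Function.update s₀.arr k f) (i v : ℕ) :
    (s.setArr k i v).arr = Function.update s₀.arr k (Function.update f i v) := by
  simp [AState.setArr, h]

open AExpr ACmd

/-- Closes table `1` modulo register `1` under the coin with the index in register `20`. -/
def roundRobin : ACmd :=
  .seq (block [assign 21 (load 0 (reg 20)), assign 22 (reg 21), assign 23 (reg 1)]) <|
  .seq (loop (reg 23)
    (block [assign 24 (reg 22 % reg 23), assign 22 (reg 23), assign 23 (reg 24)])) <|
  .seq (assign 26 (2 * (reg 1 / reg 22))) <|
  forLoop 27 22 (.seq (assign 28 (reg 27)) (forLoop 29 26 (block [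
    assign 30 ((reg 28 + reg 21) % reg 1),
    assign 31 (load 1 (reg 28) + reg 21),
    branch (bin .lt (reg 31) (load 1 (reg 30))) (store 1 (reg 30) (reg 31)) skip,
    assign 28 (reg 30)])))

/-- A bound linear in y is enough here, since closing the table takes linear time anyway; it only
uses that the second argument decreases. -/
theorem runs_gcd {s : AState} {x y : ℕ} (hx : s.reg 22 = x) (hy : s.reg 23 = y) :
    Runs M (loop (reg 23)
        (block [assign 24 (reg 22 % reg 23), assign 22 (reg 23), assign 23 (reg 24)])) s
      (20 * y + 20)
      (fun s' => SameBelow 22 s s' ∧ s'.arr = s.arr ∧ s'.reg 22 = Nat.gcd x y) := by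
  refine Runs.loop (fun b s' => SameBelow 22 s s' ∧ s'.arr = s.arr ∧
    Nat.gcd (s'.reg 22) (s'.reg 23) = Nat.gcd x y ∧ 20 * s'.reg 23 + 20 ≤ b) ?_
    ⟨SameBelow.refl _ _, rfl, by rw [hx, hy], by rw [hy]⟩
  rintro b s' ⟨h1, h2, h3, h4⟩
  refine ⟨trivial, ?_⟩
  by_cases h0 : s'.reg 23 = 0
  · left
    refine ⟨h0, by simp only [AExpr.cost]; omega, h1, h2, ?_⟩
    rw [← h3, h0, Nat.gcd_zero_right]
  · right
    have hlt : s'.reg 22 % s'.reg 23 < s'.reg 23 := Nat.mod_lt _ (by omega)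
    refine ⟨h0, 12, b - 14, by simp only [AExpr.cost]; omega, ?_⟩
    refine (Runs.of_wp ?_).mono (by decide) (fun _ h => h)
    simp
    refine ⟨h1, h2, ?_, ?_⟩
    · rw [← h3]
      rw [Nat.gcd_comm, ← Nat.gcd_rec, Nat.gcd_comm]
    · omega

/-- The table is updated in place, so b may already contain the changes of other walks. The
invariant compares with the original table b₀, for which b ≤ b₀ suffices at the start. -/
theorem runs_walk {s : AState} {n a q K Inf : ℕ} {b b₀ : ℕ → ℕ} (hn : 0 < n)
    (h1 : s.reg 1 = n) (h21 : s.reg 21 = a) (h28 : s.reg 28 = q) (h26 : s.reg 26 = K)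
    (hq : q < n) (hb : s.arr 1 = b)
    (hinf : ∀ p < n, b₀ p ≤ Inf) (hL : Inf + a + n < M.L) (hK : K < M.L)
    (heq : ∀ p < n, ∃ k, ∃ p₀ < n, b p = b₀ p₀ + k * a ∧ p₀ + k * a ≡ p [MOD n])
    (hle : ∀ p < n, b p ≤ b₀ p) :
    Runs M (forLoop 29 26 (block [
        assign 30 ((reg 28 + reg 21) % reg 1),
        assign 31 (load 1 (reg 28) + reg 21),
        branch (bin .lt (reg 31) (load 1 (reg 30))) (store 1 (reg 30) (reg 31)) skip,
        assign 28 (reg 30)])) s (K * 64 + 6)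
      (fun s' => SameBelow 28 s s' ∧ ∃ b', s'.arr = Function.update s.arr 1 b' ∧
        (∀ p < n, ∃ k, ∃ p₀ < n, b' p = b₀ p₀ + k * a ∧ p₀ + k * a ≡ p [MOD n]) ∧
        (∀ p, b' p ≤ b p) ∧ WalkClosed n a b₀ b' q K) := by
  refine (Runs.forLoop (K := K) (c := 56) (fun i s' => SameBelow 28 s s' ∧
    s'.reg 28 = (q + i * a) % n ∧ ∃ b', s'.arr = Function.update s.arr 1 b' ∧
        (∀ p < n, ∃ k, ∃ p₀ < n, b' p = b₀ p₀ + k * a ∧ p₀ + k * a ≡ p [MOD n]) ∧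
        (∀ p, b' p ≤ b p) ∧ WalkClosed n a b₀ b' q i) hK ?_ ?_ ?_ ?_)
  · refine ⟨(SameBelow.refl _ _).setReg _, ?_, b, ?_, heq, fun _ => le_rfl, ?_⟩
    · simp [h28, Nat.mod_eq_of_lt hq]
    · simp [← hb]
    · intro i j hij
      have : i = 0 ∧ j = 0 := by omega
      simpa [this, Nat.mod_eq_of_lt hq] using hle q hq
  · intro i s' _ h
    rw [h.1 26 (by omega), h26]
  · rintro i s' hi h29 ⟨hs, hp, b', hb', heq', hle', hw⟩
    have hplt : s'.reg 28 < n := hp ▸ Nat.mod_lt _ hn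
    have e1 : s'.reg 1 = n := (hs 1 (by omega)).trans h1
    have e21 : s'.reg 21 = a := (hs 21 (by omega)).trans h21
    have hread : s'.arr 1 = b' := by rw [hb']; simp
    have hbinf : ∀ p < n, b' p ≤ Inf := fun p hp => (hle' p).trans ((hle p hp).trans (hinf p hp))
    set p := s'.reg 28 with hpdef
    have hp'lt : (p + a) % n < n := Nat.mod_lt _ hn
    have hwp : (p + a) % n = (q + (i + 1) * a) % n := by
      rw [hp, Nat.mod_add_mod]; congr 1; ring
    have hbp := hbinf p hplt
    -- any table that takes the relaxation into account keeps the invariant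
    have key : ∀ b'', (∀ x, b'' x ≤ b' x) → b'' ((p + a) % n) ≤ b' p + a →
        WalkClosed n a b₀ b'' q (i + 1) := by
      intro b'' hmono hnew x y hxy
      rcases Nat.lt_or_ge (x + y) (i + 1) with hlt | hge
      · exact (hmono _).trans (hw x y (by omega))
      · have hxy' : x + y = i + 1 := by omega
        rw [hxy', ← hwp]
        rcases Nat.eq_zero_or_pos y with rfl | hy
        · have hx : x = i + 1 := by omega
          rw [hx, ← hwp]
          simpa using (hmono _).trans ((hle' _).trans (hle _ hp'lt))
        · have h2 := hw x (y - 1) (by omega)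
          have hxy2 : x + (y - 1) = i := by omega
          rw [hxy2, ← hp] at h2
          obtain ⟨z, rfl⟩ : ∃ z, y = z + 1 := ⟨y - 1, by omega⟩
          simp only [Nat.add_sub_cancel] at h2
          have : (z + 1) * a = z * a + a := by ring
          omega
    refine (Runs.of_wp ?_).mono (by decide) (fun _ h => h)
    simp [e1, e21, hread, ← hpdef, h29, hs]
    refine ⟨by omega, ⟨by omega, by omega⟩, by omega, ?_, ?_⟩
    · intro hcond
      have hcond : b' p + a < b' ((p + a) % n) := by by_contra hc; simp [hc] at hcond
      refine ⟨by omega, hwp, Function.update b' ((p + a) % n) (b' p + a), ?_, ?_, ?_, ?_⟩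
      · exact AState.setArr_arr_eq hb' _ _
      · intro x hx
        by_cases hxp : x = (p + a) % n
        · obtain ⟨k, p₀, hp₀, hk, hmod⟩ := heq' p hplt
          refine ⟨k + 1, p₀, hp₀, ?_, ?_⟩
          · rw [hxp, Function.update_self, hk]; ring
          · rw [hxp, add_one_mul, ← add_assoc]
            exact (hmod.add_right a).trans (Nat.mod_modEq _ _).symm
        · rw [Function.update_of_ne hxp]; exact heq' x hx
      · intro x
        by_cases hxp : x = (p + a) % n
        · rw [hxp, Function.update_self]; exact hcond.le.trans (hle' _)
        · rw [Function.update_of_ne hxp]; exact hle' x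
      · refine key _ (fun x => ?_) (by simp)
        by_cases hxp : x = (p + a) % n
        · rw [hxp, Function.update_self]; exact hcond.le
        · rw [Function.update_of_ne hxp]
    · intro hcond
      have hcond : ¬ b' p + a < b' ((p + a) % n) := by simpa using hcond
      exact ⟨hwp, b', hb', heq', hle',
        key _ (fun _ => le_rfl) (by omega)⟩
  · rintro s' - ⟨hs, -, b', hb', h⟩
    exact ⟨hs, b', hb', h⟩

/-- There are d = gcd(a, n) walks of 2 (n / d) steps each, so their total length is at most 2n
whatever d is. -/
theorem runs_roundRobin {s : AState} {n a Inf : ℕ} (hn : 0 < n) (h1 : s.reg 1 = n)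
    (h20 : s.reg 20 < M.L) (ha : s.arr 0 (s.reg 20) = a)
    (hinf : ∀ p < n, s.arr 1 p ≤ Inf) (hL : Inf + a + 2 * n + 2 < M.L) :
    Runs M roundRobin s (300 * n + 100) (fun s' => SameBelow 20 s s' ∧ s'.reg 20 = s.reg 20 ∧
      ∃ b', s'.arr = Function.update s.arr 1 b' ∧ IsCoinClosure n a (s.arr 1) b') := by
  set d := Nat.gcd a n with hd
  have hdpos : 0 < d := Nat.gcd_pos_of_pos_right a hn
  have hdn : d ≤ n := Nat.gcd_le_right a hn
  have hKn : n / d ≤ n := Nat.div_le_self _ _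
  have hdK : d * (n / d) ≤ n := Nat.mul_div_le n d
  set Q : AState → Prop := fun s' => SameBelow 20 s s' ∧ s'.reg 20 = s.reg 20 ∧
      ∃ b', s'.arr = Function.update s.arr 1 b' ∧ IsCoinClosure n a (s.arr 1) b' with hQ
  have hinit : Runs M (block [assign 21 (load 0 (reg 20)), assign 22 (reg 21), assign 23 (reg 1)])
      s 14 (fun s' => SameBelow 21 s s' ∧ s'.arr = s.arr ∧ s'.reg 21 = a ∧ s'.reg 22 = a ∧
        s'.reg 23 = n) := by
    refine (Runs.of_wp ?_).mono (by decide) (fun _ h => h)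
    simp [h1, ha]
    exact h20
  set K := 2 * (n / d) with hKdef
  unfold roundRobin
  refine Runs.mono (hinit.seq fun s₁ h => (runs_gcd (x := a) (y := n) h.2.2.2.1 h.2.2.2.2).seq
    fun s₂ h' => Runs.seq (Q := fun s₃ => SameBelow 21 s s₃ ∧ s₃.arr = s.arr ∧ s₃.reg 21 = a ∧
      s₃.reg 22 = d ∧ s₃.reg 26 = K) (B := 7) (B' := d * ((K * 64 + 8) + 8) + 6) ?_ ?_)
      (B := 14 + (20 * n + 20 + (7 + (d * ((K * 64 + 8) + 8) + 6)))) ?_ (fun _ h => h)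
  · obtain ⟨hs₁, harr₁, h21₁, -, -⟩ := h
    obtain ⟨hs₂, harr₂, h22₂⟩ := h'
    have e1 : s₂.reg 1 = n := by rw [hs₂ 1 (by omega), hs₁ 1 (by omega), h1]
    refine (Runs.of_wp ?_).mono (by decide) (fun _ h => h)
    have h22 : s₂.reg 22 = d := h22₂
    simp [e1, h22, harr₂, harr₁, hKdef]
    refine ⟨⟨by omega, by omega⟩, hs₁.trans hs₂, ?_⟩
    rw [hs₂ 21 (by omega), h21₁]
  · rintro s₃ ⟨hs, harr, h21, h22, h26⟩
    refine (Runs.forLoop (K := d) (c := K * 64 + 8) (fun q s' => SameBelow 26 s₃ s' ∧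
      s'.reg 26 = K ∧
      ∃ b', s'.arr = Function.update s.arr 1 b' ∧
        (∀ p < n, ∃ k, ∃ p₀ < n, b' p = s.arr 1 p₀ + k * a ∧ p₀ + k * a ≡ p [MOD n]) ∧
        (∀ p, b' p ≤ s.arr 1 p) ∧ ∀ q' < q, WalkClosed n a (s.arr 1) b' q' K) (by omega)
        ?_ ?_ ?_ ?_)
    · refine ⟨(SameBelow.refl _ _).setReg _, by simpa using h26, s.arr 1, by simp [harr],
        fun p hp => ⟨0, p, hp, by simp, by simp; rfl⟩, fun _ => le_rfl, by simp⟩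
    · intro q s' _ h
      rw [h.1 22 (by omega), h22]
    · rintro q s' hq h27 ⟨hs', h26', b', hb', heq, hle, hw⟩
      refine (Runs.seq (B := 2) (B' := K * 64 + 6) (Runs.of_wp (p := assign 28 (reg 27))
        (Q := fun s'' => SameBelow 28 s' s'' ∧ s''.arr = s'.arr ∧ s''.reg 28 = q)
        ⟨trivial, (SameBelow.refl _ _).setReg _, rfl, by simp [h27]⟩)
        fun s'' ⟨hs'', harr'', h28⟩ => ?_).mono (by omega) (fun _ h => h)
      have hr : ∀ r < 21, s''.reg r = s.reg r := fun r hr => by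
        rw [hs'' r (by omega), hs' r (by omega), hs r (by omega)]
      refine (runs_walk (a := a) (q := q) (K := K) (Inf := Inf) (b := b') (b₀ := s.arr 1) hn
        (by rw [hr 1 (by omega), h1]) (by rw [hs'' 21 (by omega), hs' 21 (by omega), h21]) h28
        (by rw [hs'' 26 (by omega), h26']) (by omega) (by rw [harr'', hb']; simp) hinf (by omega)
        (by omega) heq (fun p _ => hle p)).mono le_rfl ?_
      rintro t ⟨ht, b'', hb'', heq'', hle'', hw''⟩
      refine ⟨by rw [ht 27 (by omega), hs'' 27 (by omega), h27],
        (((hs'.trans hs'').trans ht).setReg _), ?_, b'', ?_, heq'', fun p => (hle'' p).trans (hle p), ?_⟩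
      · simp [ht 26 (by omega), hs'' 26 (by omega), h26']
      · simp [hb'', harr'', hb']
      · intro q' hq'
        rcases Nat.lt_succ_iff_lt_or_eq.1 hq' with hlt | rfl
        · exact fun i j hij => (hle'' _).trans (hw q' hlt i j hij)
        · exact hw''
    · rintro s' - ⟨hs', -, b', hb', heq, hle, hw⟩
      have hr := hs.trans hs'
      exact ⟨hr.mono, hr 20 (by omega), b', hb', isCoinClosure_of_walks hn heq (fun p _ => hle p) hw⟩
  · have : d * ((K * 64 + 8) + 8) = 128 * (d * (n / d)) + 16 * d := by rw [hKdef]; ring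
    omega

end ArrayRAM

/-! ### Heavy and light coins -/

namespace ArrayRAM

variable {M : Machine}

/-- All arrays except those in `ks` agree. -/
def SameArr (ks : List (Fin 16)) (s s' : AState) : Prop := ∀ k, k ∉ ks → s'.arr k = s.arr k

theorem SameArr.refl (ks : List (Fin 16)) (s : AState) : SameArr ks s s := fun _ _ => rfl

theorem SameArr.trans {ks ks' ks'' : List (Fin 16)} {s s' s'' : AState} (h : SameArr ks s s')
    (h' : SameArr ks' s' s'') (h1 : ks ⊆ ks'' := by decide) (h2 : ks' ⊆ ks'' := by decide) :
    SameArr ks'' s s'' :=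
  fun k hk => (h' k fun hh => hk (h2 hh)).trans (h k fun hh => hk (h1 hh))

theorem SameArr.setArr {ks : List (Fin 16)} {s s' : AState} (h : SameArr ks s s') (k : Fin 16)
    (i v : ℕ) (hk : k ∈ ks := by decide) : SameArr ks s (s'.setArr k i v) := by
  intro k' hk'
  have : k' ≠ k := fun hh => hk' (hh ▸ hk)
  rw [← h k' hk']
  funext i'
  simp [this]

theorem SameArr.setReg {ks : List (Fin 16)} {s s' : AState} (h : SameArr ks s s') (r v : ℕ) :
    SameArr ks s (s'.setReg r v) := h

@[simp] theorem sameArr_setArr {ks : List (Fin 16)} {s s' : AState} {k : Fin 16} {i v : ℕ}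
    (hk : k ∈ ks) : SameArr ks s (s'.setArr k i v) ↔ SameArr ks s s' := by
  refine ⟨fun h k' hk' => ?_, fun h => h.setArr k i v hk⟩
  have : k' ≠ k := fun hh => hk' (hh ▸ hk)
  rw [← h k' hk']
  funext i'
  simp [this]

@[simp] theorem sameArr_setReg {ks : List (Fin 16)} {s s' : AState} {r v : ℕ} :
    SameArr ks s (s'.setReg r v) ↔ SameArr ks s s' := Iff.rfl

@[simp] theorem sameArr_self (ks : List (Fin 16)) (s : AState) : SameArr ks s s := SameArr.refl ks s

/-- The parameters of the algorithm in the registers below `20`: number of coins, first coin, bound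
for the table, infinity, list length. -/
structure Setup (M : Machine) (A : ℕ → ℕ) (m T D : ℕ) (s : AState) : Prop where
  coins : CoinSystem A m
  m_eq : s.reg 0 = m
  a_eq : s.reg 1 = A 0
  T_eq : s.reg 5 = T
  inf_eq : s.reg 6 = T + 1
  D_eq : s.reg 7 = D
  coin_eq : ∀ i < m, s.arr 0 i = A i
  two_mul_le : 2 * A (m - 1) ≤ T
  lt_L : 4 * T + 10 < M.L
  list_lt : (m + 1) * (D + 1) < M.L

namespace Setup

variable {A : ℕ → ℕ} {m T D : ℕ} {s : AState}

theorem of_same {s' : AState} (h : Setup M A m T D s) (hr : SameBelow 20 s s')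
    (ha : s'.arr 0 = s.arr 0) : Setup M A m T D s' where
  coins := h.coins
  m_eq := (hr _ (by omega)).trans h.m_eq
  a_eq := (hr _ (by omega)).trans h.a_eq
  T_eq := (hr _ (by omega)).trans h.T_eq
  inf_eq := (hr _ (by omega)).trans h.inf_eq
  D_eq := (hr _ (by omega)).trans h.D_eq
  coin_eq := fun i hi => by rw [ha]; exact h.coin_eq i hi
  two_mul_le := h.two_mul_le
  lt_L := h.lt_L
  list_lt := h.list_lt

variable (h : Setup M A m T D s)
include h

theorem coin_le {i : ℕ} (hi : i < m) : 2 * A i ≤ T := by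
  have := h.coins.le_last hi; have := h.two_mul_le; omega

theorem m_le : 2 * m ≤ T := by
  have := h.coins.size_le_last; have := h.two_mul_le; omega

theorem m_lt_L : m < M.L := by have := h.m_le; have := h.lt_L; omega

theorem a_le : 2 * A 0 ≤ T := h.coin_le h.coins.size_pos

theorem a_lt_L : A 0 < M.L := by have := h.a_le; have := h.lt_L; omega

theorem mod_lt (v : ℕ) : v % A 0 < A 0 := Nat.mod_lt _ h.coins.pos

theorem mod_lt_L (v : ℕ) : v % A 0 < M.L := (h.mod_lt v).trans h.a_lt_L

end Setup

open AExpr ACmd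

/-- Array `2` becomes constantly infinite and array `3` becomes zero. -/
def initPairs : ACmd := forLoop 20 1 (block [store 2 (reg 20) (reg 6), store 3 (reg 20) 0])

/-- Array `2` becomes the table of minimal sums of two coins. -/
def pairMin : ACmd := forLoop 20 0 (forLoop 21 0 (block [
  assign 22 (load 0 (reg 20) + load 0 (reg 21)),
  assign 23 (reg 22 % reg 1),
  branch (bin .lt (reg 22) (load 2 (reg 23))) (store 2 (reg 23) (reg 22)) skip]))

variable {A : ℕ → ℕ} {m T D : ℕ} {s : AState}

theorem runs_initPairs (h : Setup M A m T D s) :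
    Runs M initPairs s (A 0 * 40 + 10) (fun s' => SameBelow 20 s s' ∧ SameArr [2, 3] s s' ∧
      ∀ p < A 0, s'.arr 2 p = T + 1 ∧ s'.arr 3 p = 0) := by
  refine (Runs.forLoop (K := A 0) (c := 20) (fun j s' => SameBelow 20 s s' ∧ SameArr [2, 3] s s' ∧
      ∀ p < j, s'.arr 2 p = T + 1 ∧ s'.arr 3 p = 0) h.a_lt_L ?_ ?_ ?_ ?_).mono (by omega)
      (fun _ h => h)
  · exact ⟨(SameBelow.refl _ _).setReg _, (SameArr.refl _ _).setReg _ _, by simp⟩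
  · intro j s' _ hs
    rw [hs.1 1 (by omega), h.a_eq]
  · rintro j s' hj h20 ⟨hs, ha, hp⟩
    have := h.a_lt_L
    have h6 : s'.reg 6 = T + 1 := (hs 6 (by omega)).trans h.inf_eq
    refine (Runs.of_wp ?_).mono (by decide) (fun _ h => h)
    simp [h20, h6, hs, ha]
    exact ⟨by omega, by omega, by omega, fun p hpj => ⟨fun hpe => (hp p (by omega)).1,
      fun hpe => (hp p (by omega)).2⟩⟩
  · exact fun s' _ hs => hs

/-- Table of minimal sums of two coins; residues that are no such sum have infinite entries. -/
structure IsPairMin (A : ℕ → ℕ) (m inf : ℕ) (b : ℕ → ℕ) : Prop where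
  le : ∀ c < m, ∀ l < m, b ((A c + A l) % A 0) ≤ A c + A l
  eq : ∀ p < A 0, b p = inf ∨ ∃ c < m, ∃ l < m, b p = A c + A l ∧ (A c + A l) % A 0 = p

theorem runs_pairMin (h : Setup M A m T D s) (h2 : ∀ p < A 0, s.arr 2 p = T + 1) :
    Runs M pairMin s (m * (m * 70 + 14) + 6) (fun s' => SameBelow 20 s s' ∧ SameArr [2] s s' ∧
      IsPairMin A m (T + 1) (s'.arr 2)) := by
  refine (Runs.forLoop (K := m) (c := m * 70 + 6) (fun i s' => SameBelow 20 s s' ∧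
    SameArr [2] s s' ∧
    (∀ c < i, ∀ l < m, s'.arr 2 ((A c + A l) % A 0) ≤ A c + A l) ∧
    (∀ p < A 0, s'.arr 2 p = T + 1 ∨
      ∃ c < m, ∃ l < m, s'.arr 2 p = A c + A l ∧ (A c + A l) % A 0 = p)) h.m_lt_L ?_ ?_ ?_ ?_)
  · exact ⟨(SameBelow.refl _ _).setReg _, (SameArr.refl _ _).setReg _ _, by simp,
      fun p hp => .inl (h2 p hp)⟩
  · intro j s' _ hs
    rw [hs.1 0 (by omega), h.m_eq]
  · rintro i s' hi h20 ⟨hs, ha, hle, heq⟩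
    refine (Runs.forLoop (K := m) (c := 62) (fun j t => SameBelow 21 s' t ∧ SameArr [2] s' t ∧
      (∀ p, t.arr 2 p ≤ s'.arr 2 p) ∧
      (∀ l < j, t.arr 2 ((A i + A l) % A 0) ≤ A i + A l) ∧
      (∀ p < A 0, t.arr 2 p = T + 1 ∨
        ∃ c < m, ∃ l < m, t.arr 2 p = A c + A l ∧ (A c + A l) % A 0 = p)) h.m_lt_L ?_ ?_ ?_ ?_).mono
      (by omega) (fun _ h => h)
    · exact ⟨(SameBelow.refl _ _).setReg _, (SameArr.refl _ _).setReg _ _, fun _ => le_rfl,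
        by simp, heq⟩
    · intro j t _ ht
      rw [ht.1 0 (by omega), hs 0 (by omega), h.m_eq]
    · rintro j t hj h21 ⟨ht, hat, hmono, hlet, heqt⟩
      have hT : Setup M A m T D t := h.of_same (hs.trans ht) (by
        rw [hat 0 (by decide), ha 0 (by decide)])
      have e20 : t.reg 20 = i := by rw [ht 20 (by omega), h20]
      have hm := h.m_lt_L
      have c1 := h.coin_le hi
      have c2 := h.coin_le hj
      have hL := h.lt_L
      have hv := h.mod_lt_L (A i + A j)
      have hv' := h.mod_lt (A i + A j)
      refine (Runs.of_wp ?_).mono (by decide) (fun _ h => h)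
      simp [e20, h21, hT.coin_eq i hi, hT.coin_eq j hj, hT.a_eq, ht, hat]
      refine ⟨by omega, by omega, fun hcond => ?_, fun hcond => ?_⟩
      · refine ⟨by omega, fun p => ?_, fun l hl => ?_, fun p hp => ?_⟩
        · by_cases hp : p = (A i + A j) % A 0
          · simp only [hp, if_true]; exact hcond.le.trans (hmono _)
          · simpa [hp] using hmono p
        · by_cases hp : (A i + A l) % A 0 = (A i + A j) % A 0
          · simp only [hp, if_true]
            rcases Nat.lt_or_eq_of_le hl with hl | rfl
            · have := hlet l hl; rw [hp] at this; omega
            · exact le_rfl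
          · simp only [hp, if_false]
            rcases Nat.lt_or_eq_of_le hl with hl | rfl
            · exact hlet l hl
            · exact absurd rfl hp
        · by_cases hp' : p = (A i + A j) % A 0
          · exact .inr ⟨i, hi, j, hj, by simp [hp'], hp'.symm⟩
          · simpa [hp'] using heqt p hp
      · refine ⟨hmono, fun l hl => ?_, heqt⟩
        rcases Nat.lt_or_eq_of_le hl with hl | rfl
        · exact hlet l hl
        · omega
    · rintro t - ⟨ht, hat, hmono, hlet, heqt⟩
      refine ⟨by rw [ht 20 (by omega), h20], (hs.trans ht).setReg _, (ha.trans hat).setReg _ _,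
        fun c hc l hl => ?_, heqt⟩
      rcases Nat.lt_succ_iff_lt_or_eq.1 hc with hc | rfl
      · exact (hmono _).trans (hle c hc l hl)
      · exact hlet l hl
  · rintro s' - ⟨hs, ha, hle, heq⟩
    exact ⟨hs, ha, hle, heq⟩

end ArrayRAM

/-! ### Classification of the coins as heavy or light. -/

namespace ArrayRAM

open AExpr ACmd Finset

variable {M : Machine} {A : ℕ → ℕ} {m T D : ℕ} {s : AState}

/-- For the coin with the index in register `20`: counts in register `24` the coins that form an
uncovered minimal pair with it, and lists the first ones in array `4` from register `25` on. -/
def countPairs : ACmd := forLoop 21 0 (block [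
  assign 22 (load 0 (reg 20) + load 0 (reg 21)),
  assign 23 (reg 22 % reg 1),
  branch (bin .eq (load 2 (reg 23)) (reg 22) * bin .eq (load 3 (reg 23)) 0)
    (block [branch (bin .lt (reg 24) (reg 7)) (store 4 (reg 25 + reg 24) (reg 21)) skip,
      assign 24 (reg 24 + 1)]) skip])

/-- Covers in array `3` the residues of the minimal pairs with the coin in register `20`. -/
def coverPairs : ACmd := forLoop 21 0 (block [
  assign 22 (load 0 (reg 20) + load 0 (reg 21)),
  assign 23 (reg 22 % reg 1),
  branch (bin .eq (load 2 (reg 23)) (reg 22)) (store 3 (reg 23) 1) skip])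

/-- Marks in array `6` the heavy coins, and stores in array `5` the list lengths of the others. -/
def classify : ACmd := forLoop 20 0 (
  .seq (block [assign 24 0, assign 25 (reg 20 * reg 7)]) <|
  .seq countPairs <|
  branch (bin .lt (reg 24) (reg 7))
    (block [store 6 (reg 20) 0, store 5 (reg 20) (reg 24)])
    (.seq (store 6 (reg 20) 1) coverPairs))

/-- The coins `c` and `l` form a minimal pair for an uncovered residue. -/
def FreePair (A pmin cov : ℕ → ℕ) (c l : ℕ) : Prop :=
  pmin ((A c + A l) % A 0) = A c + A l ∧ cov ((A c + A l) % A 0) = 0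

instance (A pmin cov : ℕ → ℕ) (c l : ℕ) : Decidable (FreePair A pmin cov c l) := by
  unfold FreePair; infer_instance

/-- The count is always exact, but only the first D pairs are stored, so that the block of coin c
does not run into the next block. The list is therefore claimed to be complete only if the count is
at most D. -/
theorem runs_countPairs (h : Setup M A m T D s) {c : ℕ} (hc : c < m) (h20 : s.reg 20 = c)
    (h24 : s.reg 24 = 0) (h25 : s.reg 25 = c * D) :
    Runs M countPairs s (m * 88 + 6) (fun s' => SameBelow 21 s s' ∧ SameArr [4] s s' ∧
      s'.reg 24 = #{l ∈ range m | FreePair A (s.arr 2) (s.arr 3) c l} ∧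
      (∀ x, (x < c * D ∨ c * D + D ≤ x) → s'.arr 4 x = s.arr 4 x) ∧
      (s'.reg 24 ≤ D → ∀ l < m, FreePair A (s.arr 2) (s.arr 3) c l →
        ∃ i < s'.reg 24, s'.arr 4 (c * D + i) = l) ∧
      (∀ i < s'.reg 24, i < D → s'.arr 4 (c * D + i) < m)) := by
  refine (Runs.forLoop (K := m) (c := 80) (fun j s' => SameBelow 21 s s' ∧ SameArr [4] s s' ∧
      s'.reg 25 = c * D ∧
      s'.reg 24 = #{l ∈ range j | FreePair A (s.arr 2) (s.arr 3) c l} ∧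
      (∀ x, (x < c * D ∨ c * D + D ≤ x) → s'.arr 4 x = s.arr 4 x) ∧
      (s'.reg 24 ≤ D → ∀ l < j, FreePair A (s.arr 2) (s.arr 3) c l →
        ∃ i < s'.reg 24, s'.arr 4 (c * D + i) = l) ∧
      (∀ i < s'.reg 24, i < D → s'.arr 4 (c * D + i) < m)) h.m_lt_L ?_ ?_ ?_ ?_)
  · simp [h25, h24]
  · intro j s' _ hs
    rw [hs.1 0 (by omega), h.m_eq]
  · rintro j t hj h21 ⟨ht, hat, e25, e24, hold, hlist, hlt⟩
    have hT : Setup M A m T D t := h.of_same ht.mono (hat 0 (by decide))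
    have e20 : t.reg 20 = c := by rw [ht 20 (by omega), h20]
    have hm := h.m_lt_L
    have c1 := h.coin_le hc
    have c2 := h.coin_le hj
    have hL := h.lt_L
    have hv := h.mod_lt_L (A c + A j)
    have a2 : t.arr 2 = s.arr 2 := hat 2 (by decide)
    have a3 : t.arr 3 = s.arr 3 := hat 3 (by decide)
    have hcnt : t.reg 24 ≤ j := by
      rw [e24]; exact (card_filter_le _ _).trans (by simp)
    have hcD : c * D + D ≤ m * D := by
      rw [← add_one_mul]; exact Nat.mul_le_mul_right _ hc
    have hmD := h.list_lt
    have hmD' : (m + 1) * (D + 1) = m * D + m + D + 1 := by ring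
    set P := fun l => FreePair A (s.arr 2) (s.arr 3) c l with hP
    have hrange : #{l ∈ range (j + 1) | P l} = #{l ∈ range j | P l} + if P j then 1 else 0 := by
      rw [range_add_one, filter_insert]
      split_ifs with hPj
      · rw [card_insert_of_notMem (by simp)]
      · rfl
    have hPj : P j ↔ (s.arr 2 ((A c + A j) % A 0) = A c + A j ∧
        s.arr 3 ((A c + A j) % A 0) = 0) := Iff.rfl
    refine (Runs.of_wp ?_).mono (by decide) (fun _ h => h)
    simp [e20, h21, hT.coin_eq c hc, hT.coin_eq j hj, hT.a_eq, ht, hat, a2, a3, hT.D_eq, e25]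
    refine ⟨by omega, ⟨hv, by omega, by split_ifs <;> omega⟩, ?_, ?_⟩
    · intro hp2 hp1
      have hPj' : P j := hPj.2 ⟨hp1, hp2⟩
      rw [hrange, if_pos hPj', ← e24]
      refine ⟨fun hD => ⟨by omega, by omega, rfl, fun x hx => ?_, fun hle l hl hPl => ?_,
        fun i hi hiD => ?_⟩, fun hD => ⟨by omega, rfl, hold, fun hle => by omega,
        fun i hi hiD => hlt i (by omega) hiD⟩⟩
      · have hx' : x ≠ c * D + t.reg 24 := by omega
        simpa [hx'] using hold x hx
      · rcases Nat.lt_or_eq_of_le hl with hl | rfl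
        · obtain ⟨i, hi, hil⟩ := hlist (by omega) l hl hPl
          have : i ≠ t.reg 24 := by omega
          exact ⟨i, by omega, by simpa [this] using hil⟩
        · exact ⟨t.reg 24, by omega, by simp⟩
      · by_cases hi' : i = t.reg 24
        · simpa [hi'] using hj
        · simpa [hi'] using hlt i (by omega) hiD
    · intro hp
      have hPj' : ¬ P j := fun hh => hp (hPj.1 hh).2 (hPj.1 hh).1
      rw [hrange, if_neg hPj', ← e24]
      refine ⟨rfl, hold, fun hle l hl hPl => ?_, hlt⟩
      rcases Nat.lt_or_eq_of_le hl with hl | rfl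
      · exact hlist hle l hl hPl
      · exact absurd hPl hPj'
  · rintro s' - ⟨h1, h2, -, h3⟩
    exact ⟨h1, h2, h3⟩

theorem runs_coverPairs (h : Setup M A m T D s) {c : ℕ} (hc : c < m) (h20 : s.reg 20 = c) :
    Runs M coverPairs s (m * 68 + 6) (fun s' => SameBelow 21 s s' ∧ SameArr [3] s s' ∧
      (∀ p, s'.arr 3 p ≠ 0 ↔ (s.arr 3 p ≠ 0 ∨ ∃ l < m, s.arr 2 p = A c + A l ∧
        (A c + A l) % A 0 = p))) := by
  refine (Runs.forLoop (K := m) (c := 60) (fun j s' => SameBelow 21 s s' ∧ SameArr [3] s s' ∧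
      (∀ p, s'.arr 3 p ≠ 0 ↔ (s.arr 3 p ≠ 0 ∨ ∃ l < j, s.arr 2 p = A c + A l ∧
        (A c + A l) % A 0 = p))) h.m_lt_L ?_ ?_ ?_ ?_)
  · simp
  · intro j s' _ hs
    rw [hs.1 0 (by omega), h.m_eq]
  · rintro j t hj h21 ⟨ht, hat, hiff⟩
    have hT : Setup M A m T D t := h.of_same ht.mono (hat 0 (by decide))
    have e20 : t.reg 20 = c := by rw [ht 20 (by omega), h20]
    have hm := h.m_lt_L
    have c1 := h.coin_le hc
    have c2 := h.coin_le hj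
    have hL := h.lt_L
    have hv := h.mod_lt_L (A c + A j)
    have a2 : t.arr 2 = s.arr 2 := hat 2 (by decide)
    have hstep : ∀ p, (∃ l < j + 1, s.arr 2 p = A c + A l ∧ (A c + A l) % A 0 = p) ↔
        (∃ l < j, s.arr 2 p = A c + A l ∧ (A c + A l) % A 0 = p) ∨
          (s.arr 2 p = A c + A j ∧ (A c + A j) % A 0 = p) := by
      intro p
      constructor
      · rintro ⟨l, hl, hh⟩
        rcases Nat.lt_succ_iff_lt_or_eq.1 hl with hl | rfl
        · exact .inl ⟨l, hl, hh⟩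
        · exact .inr hh
      · rintro (⟨l, hl, hh⟩ | hh)
        · exact ⟨l, by omega, hh⟩
        · exact ⟨j, by omega, hh⟩
    refine (Runs.of_wp ?_).mono (by decide) (fun _ h => h)
    simp only [hstep]
    simp [e20, h21, hT.coin_eq c hc, hT.coin_eq j hj, hT.a_eq, ht, hat, a2]
    refine ⟨by omega, hv, fun hp => ⟨by omega, hv, fun p => ?_⟩, fun hp p => ?_⟩
    · by_cases hpe : p = (A c + A j) % A 0
      · simp [hpe, hp]
      · simp only [hpe, if_false, Ne.symm (hpe : p ≠ _), and_false, or_false]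
        simpa using hiff p
    · have hno : ¬ (s.arr 2 p = A c + A j ∧ (A c + A j) % A 0 = p) := by
        rintro ⟨hh, rfl⟩; exact hp hh
      simp only [hno, or_false]
      simpa using hiff p
  · rintro s' - ⟨h1, h2, h3⟩
    exact ⟨h1, h2, h3⟩

/-- The first `i` coins are divided into heavy coins and light coins with lists of length at most
`D`, such that each minimal pair is covered by a heavy coin or listed. -/
structure IsClassified (A : ℕ → ℕ) (m D i : ℕ) (pmin cov list len heavy : ℕ → ℕ) : Prop where
  covered : ∀ p < A 0, cov p ≠ 0 → ∃ c < i, heavy c ≠ 0 ∧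
    ∃ l < m, pmin p = A c + A l ∧ (A c + A l) % A 0 = p
  listed : ∀ c < i, heavy c = 0 → ∀ l < m, FreePair A pmin cov c l →
    ∃ j < len c, list (c * D + j) = l
  len_le : ∀ c < i, heavy c = 0 → len c ≤ D
  list_lt : ∀ c < i, heavy c = 0 → ∀ j < len c, list (c * D + j) < m
  card_heavy : #{c ∈ range i | heavy c ≠ 0} * D ≤ #{p ∈ range (A 0) | cov p ≠ 0}

theorem IsClassified.card_heavy_mul_le {i : ℕ} {pmin cov list len heavy : ℕ → ℕ}
    (h : IsClassified A m D i pmin cov list len heavy) :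
    #{c ∈ range i | heavy c ≠ 0} * D ≤ A 0 :=
  h.card_heavy.trans ((card_filter_le _ _).trans (by simp))

theorem card_filter_range_succ (p : ℕ → Prop) [DecidablePred p] (i : ℕ) :
    #{c ∈ range (i + 1) | p c} = #{c ∈ range i | p c} + if p i then 1 else 0 := by
  rw [range_add_one, filter_insert]
  split_ifs
  · rw [card_insert_of_notMem (by simp)]
  · rfl

theorem IsClassified.light {c : ℕ} {pmin cov list len heavy list' : ℕ → ℕ} {cnt : ℕ}
    (h : IsClassified A m D c pmin cov list len heavy) (hcnt : cnt < D)
    (hold : ∀ x, x < c * D → list' x = list x)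
    (hlist : ∀ l < m, FreePair A pmin cov c l → ∃ i < cnt, list' (c * D + i) = l)
    (hlt : ∀ i < cnt, list' (c * D + i) < m) :
    IsClassified A m D (c + 1) pmin cov list' (Function.update len c cnt)
      (Function.update heavy c 0) := by
  have hidx : ∀ c' < c, ∀ j < D, c' * D + j < c * D := by
    intro c' hc' j hj
    have : (c' + 1) * D ≤ c * D := Nat.mul_le_mul_right _ hc'
    linarith
  have hne : ∀ c' < c, c' ≠ c := fun c' hc' => hc'.ne
  refine ⟨fun p hp hcp => ?_, fun c' hc' h0 l hl hf => ?_, fun c' hc' h0 => ?_,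
    fun c' hc' h0 j hj => ?_, ?_⟩
  · obtain ⟨c', hc', hh, l, hl⟩ := h.covered p hp hcp
    exact ⟨c', by omega, by rwa [Function.update_of_ne (hne c' hc')], l, hl⟩
  · rcases Nat.lt_succ_iff_lt_or_eq.1 hc' with hc' | rfl
    · rw [Function.update_of_ne (hne c' hc')] at h0 ⊢
      obtain ⟨j, hj, hjl⟩ := h.listed c' hc' h0 l hl hf
      have := h.len_le c' hc' h0
      exact ⟨j, hj, by rw [hold _ (hidx c' hc' j (by omega)), hjl]⟩
    · rw [Function.update_self]; exact hlist l hl hf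
  · rcases Nat.lt_succ_iff_lt_or_eq.1 hc' with hc' | rfl
    · rw [Function.update_of_ne (hne c' hc')] at h0 ⊢
      exact h.len_le c' hc' h0
    · rw [Function.update_self]; exact hcnt.le
  · rcases Nat.lt_succ_iff_lt_or_eq.1 hc' with hc' | rfl
    · rw [Function.update_of_ne (hne c' hc')] at h0 hj
      have := h.len_le c' hc' h0
      rw [hold _ (hidx c' hc' j (by omega))]
      exact h.list_lt c' hc' h0 j hj
    · rw [Function.update_self] at hj; exact hlt j hj
  · rw [card_filter_range_succ, Function.update_self, if_neg (by simp), add_zero,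
      filter_congr (q := fun c => heavy c ≠ 0)]
    · exact h.card_heavy
    · intro x hx
      rw [Function.update_of_ne (hne x (mem_range.1 hx))]

/-- The free pairs of c have different residues, because the minimal sum of a residue determines the
partner of c. So at least D residues are covered for the first time, which pays for the new heavy
coin. -/
theorem IsClassified.heavy_step {c : ℕ} {pmin cov cov' list len heavy list' : ℕ → ℕ}
    (hA : CoinSystem A m) (h : IsClassified A m D c pmin cov list len heavy)
    (hD : D ≤ #{l ∈ range m | FreePair A pmin cov c l})
    (hold : ∀ x, x < c * D → list' x = list x)
    (hcov : ∀ p, cov' p ≠ 0 ↔ (cov p ≠ 0 ∨ ∃ l < m, pmin p = A c + A l ∧ (A c + A l) % A 0 = p)) :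
    IsClassified A m D (c + 1) pmin cov' list' len (Function.update heavy c 1) := by
  have hidx : ∀ c' < c, ∀ j < D, c' * D + j < c * D := by
    intro c' hc' j hj
    have : (c' + 1) * D ≤ c * D := Nat.mul_le_mul_right _ hc'
    linarith
  have hne : ∀ c' < c, c' ≠ c := fun c' hc' => hc'.ne
  refine ⟨fun p hp hcp => ?_, fun c' hc' h0 l hl hf => ?_, fun c' hc' h0 => ?_,
    fun c' hc' h0 j hj => ?_, ?_⟩
  · rcases (hcov p).1 hcp with hcp | ⟨l, hl, h1, h2⟩
    · obtain ⟨c', hc', hh, l, hl⟩ := h.covered p hp hcp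
      exact ⟨c', by omega, by rwa [Function.update_of_ne (hne c' hc')], l, hl⟩
    · exact ⟨c, by omega, by simp, l, hl, h1, h2⟩
  · rcases Nat.lt_succ_iff_lt_or_eq.1 hc' with hc' | rfl
    · rw [Function.update_of_ne (hne c' hc')] at h0
      -- Coverage only grows, so a pair that is free now was free when the list of c' was made;
      -- older lists may be too long but never miss a pair.
      have hf' : FreePair A pmin cov c' l := by
        refine ⟨hf.1, ?_⟩
        by_contra hne0
        exact ((hcov _).2 (.inl hne0)) hf.2
      obtain ⟨j, hj, hjl⟩ := h.listed c' hc' h0 l hl hf'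
      have := h.len_le c' hc' h0
      exact ⟨j, hj, by rw [hold _ (hidx c' hc' j (by omega)), hjl]⟩
    · simp at h0
  · rcases Nat.lt_succ_iff_lt_or_eq.1 hc' with hc' | rfl
    · rw [Function.update_of_ne (hne c' hc')] at h0
      exact h.len_le c' hc' h0
    · simp at h0
  · rcases Nat.lt_succ_iff_lt_or_eq.1 hc' with hc' | rfl
    · rw [Function.update_of_ne (hne c' hc')] at h0
      have := h.len_le c' hc' h0
      rw [hold _ (hidx c' hc' j (by omega))]
      exact h.list_lt c' hc' h0 j hj
    · simp at h0
  · rw [card_filter_range_succ, Function.update_self, if_pos (by simp),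
      filter_congr (q := fun c => heavy c ≠ 0) (fun x hx => by
        rw [Function.update_of_ne (hne x (mem_range.1 hx))]), add_one_mul]
    set F := {l ∈ range m | FreePair A pmin cov c l} with hF
    set f : ℕ → ℕ := fun l => (A c + A l) % A 0 with hf
    have hinj : Set.InjOn f F := by
      intro x hx y hy hxy
      simp only [hF, coe_filter, mem_range, Set.mem_ofPred_eq] at hx hy
      have h1 := hx.2.1
      have h2 := hy.2.1
      rw [show (A c + A x) % A 0 = (A c + A y) % A 0 from hxy, h2] at h1
      exact hA.inj hx.1 hy.1 (by omega)
    have hdisj : Disjoint {p ∈ range (A 0) | cov p ≠ 0} (F.image f) := by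
      rw [disjoint_left]
      intro p hp hp'
      obtain ⟨l, hl, rfl⟩ := mem_image.1 hp'
      exact (mem_filter.1 hp).2 (mem_filter.1 hl).2.2
    have hsub : {p ∈ range (A 0) | cov p ≠ 0} ∪ F.image f ⊆ {p ∈ range (A 0) | cov' p ≠ 0} := by
      intro p hp
      rcases mem_union.1 hp with hp | hp
      · exact mem_filter.2 ⟨(mem_filter.1 hp).1, (hcov p).2 (.inl (mem_filter.1 hp).2)⟩
      · obtain ⟨l, hl, rfl⟩ := mem_image.1 hp
        have hl' := mem_filter.1 hl
        exact mem_filter.2 ⟨mem_range.2 (Nat.mod_lt _ hA.pos),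
          (hcov _).2 (.inr ⟨l, mem_range.1 hl'.1, hl'.2.1, rfl⟩)⟩
    have hcard := card_le_card hsub
    rw [card_union_of_disjoint hdisj, card_image_of_injOn hinj] at hcard
    have := h.card_heavy
    omega

theorem runs_classify (h : Setup M A m T D s) (hcov : ∀ p < A 0, s.arr 3 p = 0) :
    Runs M classify s (m * (m * 160 + 80) + 6) (fun s' => SameBelow 20 s s' ∧
      SameArr [3, 4, 5, 6] s s' ∧
      IsClassified A m D m (s'.arr 2) (s'.arr 3) (s'.arr 4) (s'.arr 5) (s'.arr 6)) := by
  refine (Runs.forLoop (K := m) (c := m * 160 + 72) (fun i s' => SameBelow 20 s s' ∧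
      SameArr [3, 4, 5, 6] s s' ∧
      IsClassified A m D i (s'.arr 2) (s'.arr 3) (s'.arr 4) (s'.arr 5) (s'.arr 6))
      h.m_lt_L ?_ ?_ ?_ ?_)
  · refine ⟨by simp, by simp, fun p hp hc => absurd (hcov p hp) hc, ?_, ?_, ?_, by
      rw [range_zero, filter_empty, card_empty, zero_mul]; exact Nat.zero_le _⟩ <;> simp
  · intro j s' _ hs
    rw [hs.1 0 (by omega), h.m_eq]
  · rintro c t hc h20 ⟨ht, hat, hcl⟩
    have hT : Setup M A m T D t := h.of_same ht (hat 0 (by decide))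
    have hcD : c * D + D ≤ m * D := by
      rw [← add_one_mul]; exact Nat.mul_le_mul_right _ hc
    have hmD := h.list_lt
    have hmD' : (m + 1) * (D + 1) = m * D + m + D + 1 := by ring
    have hm := h.m_lt_L
    refine (Runs.seq (B := 9) (Q := fun t₁ => SameBelow 24 t t₁ ∧ t₁.arr = t.arr ∧
      t₁.reg 24 = 0 ∧ t₁.reg 25 = c * D) ?_ fun t₁ ⟨h1, a1, h24, h25⟩ => ?_).mono
      (B := 9 + (m * 88 + 6 + (m * 68 + 6 + 24))) (by omega) (fun _ h => h)
    · refine (Runs.of_wp ?_).mono (by decide) (fun _ h => h)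
      simp [h20, hT.D_eq]
      omega
    have hT₁ : Setup M A m T D t₁ := hT.of_same h1.mono (by rw [a1])
    have h20₁ : t₁.reg 20 = c := by rw [h1 20 (by omega), h20]
    refine (runs_countPairs hT₁ hc h20₁ h24 h25).seq ?_
    rintro t₂ ⟨h2, a2, hcnt, hold, hlist, hlt⟩
    have hT₂ : Setup M A m T D t₂ := hT₁.of_same h2.mono (a2 0 (by decide))
    have h20₂ : t₂.reg 20 = c := by rw [h2 20 (by omega), h20₁]
    have ea : ∀ k, k ≠ 4 → t₂.arr k = t.arr k := fun k hk => by
      rw [a2 k (by simpa using hk), a1]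
    have hreg : SameBelow 20 s t₂ := (ht.trans h1).trans h2
    have harr : SameArr [3, 4, 5, 6] s t₂ := by
      intro k hk
      have : k ≠ 4 := by rintro rfl; exact hk (by decide)
      rw [ea k this, hat k hk]
    rw [a1] at hcnt hold hlist
    refine (Runs.branch (B := m * 68 + 6 + 16) ?_ (fun hcond => ?_) (fun hcond => ?_)).mono
      (by simp only [AExpr.cost]; omega) (fun _ h => h)
    · simp
    · have hcond : t₂.reg 24 < D := by simpa [hT₂.D_eq] using hcond
      have hnew := hcl.light hcond (fun x hx => hold x (.inl hx)) (hlist hcond.le)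
        (fun i hi => hlt i hi (by omega))
      refine (Runs.of_wp ?_).mono (show _ ≤ 20 by decide) (fun _ h => h) |>.mono (by omega)
        (fun _ h => h)
      have hM := M.two_le
      simp [h20₂, hreg, harr, AState.setArr_arr_fun, ea]
      exact ⟨by omega, by omega, hnew⟩
    · have hcond : D ≤ t₂.reg 24 := by simpa [hT₂.D_eq] using hcond
      refine (Runs.seq (B := 12) (B' := m * 68 + 6) (Q := fun t₃ => SameBelow 24 t₂ t₃ ∧
        t₃ = t₂.setArr 6 c 1) ?_ ?_).mono (by omega) (fun _ h => h)
      · refine (Runs.of_wp ?_).mono (by decide) (fun _ h => h)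
        have hM := M.two_le
        simp [h20₂]
        omega
      · rintro t₃ ⟨h3, a3⟩
        have hT₃ : Setup M A m T D t₃ := hT₂.of_same h3.mono (by
          rw [a3, AState.setArr_arr_fun, if_neg (by decide)])
        refine (runs_coverPairs hT₃ hc (by rw [h3 20 (by omega), h20₂])).mono le_rfl ?_
        rintro t₄ ⟨h4, a4, hcv⟩
        have e3 : t₃.arr 3 = t.arr 3 := by simp [a3, AState.setArr_arr_fun, ea]
        have e2 : t₃.arr 2 = t.arr 2 := by simp [a3, AState.setArr_arr_fun, ea]
        have hnew := hcl.heavy_step h.coins (hcnt ▸ hcond) (fun x hx => hold x (.inl hx))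
          (cov' := t₄.arr 3) (by rwa [e2, e3] at hcv)
        refine ⟨by rw [h4 20 (by omega), h3 20 (by omega), h20₂], ?_, ?_, ?_⟩
        · simpa using (hreg.trans h3).trans h4
        · simp only [sameArr_setReg]
          refine SameArr.trans (ks := [3, 4, 5, 6]) (ks' := [3]) ?_ a4
          rw [a3]
          simpa using harr
        · simp only [AState.setReg_arr]
          rw [a4 2 (by decide), a4 4 (by decide), a4 5 (by decide), a4 6 (by decide), e2]
          simpa [a3, AState.setArr_arr_fun, ea] using hnew
  · exact fun s' _ hs => hs

end ArrayRAM

/-! ### Residue tables by a scan over the light coins and a closure under the heavy coins -/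

open Finset ArrayRAM

/-- All entries are least feasible values of their residue classes. -/
def IsAperyTable (A : ℕ → ℕ) (m : ℕ) (b : ℕ → ℕ) : Prop :=
  ∀ p < A 0, IsApery A m (b p) ∧ b p ≡ p [MOD A 0]

/-- No heavy coin occurs in a representation of `v`. -/
def IsPure (A : ℕ → ℕ) (m : ℕ) (heavy : ℕ → ℕ) (v : ℕ) : Prop :=
  ∀ h < m, heavy h ≠ 0 → ∀ u ∈ Feas A m, v ≠ A h + u

/-- Finite nonzero entries of `b` are feasible values whose representation has the light
coin `co`. -/
def IsGood (A : ℕ → ℕ) (m T : ℕ) (heavy b co : ℕ → ℕ) : Prop :=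
  ∀ p < A 0, b p ≤ T + 1 ∧ (b p = T + 1 ∨ b p ≡ p [MOD A 0] ∧ (b p = 0 ∨
    co p < m ∧ heavy (co p) = 0 ∧ ∃ u ∈ Feas A m, b p = A (co p) + u))

/-- The table accounts for all pure values that are a coin or a coin added to a value below `t`. -/
def IsReached (A : ℕ → ℕ) (m : ℕ) (heavy : ℕ → ℕ) (t : ℕ) (b : ℕ → ℕ) : Prop :=
  ∀ v, IsApery A m v → IsPure A m heavy v → ∀ l < m, ∀ u ∈ Feas A m, u < t → v = A l + u →
    b (v % A 0) ≤ v

/-- `b'` arises from `b` by adding feasible values and is closed under the first `i` heavy coins. -/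
def IsHeavyClosure (A : ℕ → ℕ) (m : ℕ) (heavy b : ℕ → ℕ) (i : ℕ) (b' : ℕ → ℕ) : Prop :=
  ∀ p < A 0, b' p ≤ b p ∧ (∃ p₀ < A 0, ∃ u ∈ Feas A m, b' p = b p₀ + u ∧ p₀ + u ≡ p [MOD A 0]) ∧
    ∀ h < i, heavy h ≠ 0 → b' ((p + A h) % A 0) ≤ b' p + A h

section
variable {A : ℕ → ℕ} {m T D : ℕ} {heavy b co : ℕ → ℕ}

theorem IsPure.of_add {u v : ℕ} (h : IsPure A m heavy (u + v)) (hv : v ∈ Feas A m) :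
    IsPure A m heavy u := by
  intro x hx hh w hw hu
  exact h x hx hh (w + v) (add_mem hw hv) (by omega)

theorem IsGood.mem_feas (h : IsGood A m T heavy b co) {p : ℕ} (hp : p < A 0) (hT : b p ≠ T + 1) :
    b p ∈ Feas A m ∧ b p ≡ p [MOD A 0] := by
  obtain ⟨hmod, h0 | ⟨hc, -, u, hu, he⟩⟩ := (h p hp).2.resolve_left hT
  · exact ⟨h0 ▸ zero_mem _, hmod⟩
  · exact ⟨he ▸ add_mem (coin_mem_feas hc) hu, hmod⟩

theorem IsGood.update (h : IsGood A m T heavy b co) {c u v r : ℕ} (hc : c < m) (hl : heavy c = 0)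
    (hu : u ∈ Feas A m) (hv : v = A c + u) (hr : r = v % A 0) (hlt : v < b r) (hr' : r < A 0) :
    IsGood A m T heavy (Function.update b r v) (Function.update co r c) := by
  intro p hp
  by_cases hpr : p = r
  · subst hpr
    simp only [Function.update_self]
    have := (h p hp).1
    exact ⟨by omega, .inr ⟨hr ▸ (Nat.mod_modEq _ _).symm, .inr ⟨hc, hl, u, hu, hv⟩⟩⟩
  · simp only [Function.update_of_ne hpr]
    exact h p hp

theorem CoinSystem.mod_lt (hA : CoinSystem A m) (v : ℕ) : v % A 0 < A 0 := Nat.mod_lt _ hA.pos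

/-- The last coin of t leaves a smaller feasible rest, so the entry is at most t; it is itself
feasible and t is least in its class. -/
theorem IsReached.eq (hA : CoinSystem A m) (hg : IsGood A m T heavy b co) {t : ℕ}
    (hr : IsReached A m heavy t b) (ht : IsApery A m t) (hp : IsPure A m heavy t)
    (h0 : 0 < t) (htT : t ≤ T) : b (t % A 0) = t := by
  obtain h0' | ⟨l, hl, u, hu, he⟩ := feas_cases ht.1
  · omega
  · have hlpos := hA.pos_of_lt hl
    have hpos := hA.pos
    have hle := hr t ht hp l hl u hu (by omega) he
    have hm := hA.mod_lt t
    obtain ⟨hf, hmod⟩ := hg.mem_feas hm (by omega)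
    exact le_antisymm hle (ht.2 _ hf (hmod.trans (Nat.mod_modEq _ _)))

/-- Let v = A l + t be an Apéry value without heavy coins. Then t is already final in the table,
with a recorded light coin c. The pair of c and l is part of v, hence it is least among all feasible
values in its class, and it is not covered. So l is in the list of c, and relaxing along this list
alone gives v. -/
theorem IsReached.succ (hA : CoinSystem A m) (hg : IsGood A m T heavy b co)
    {pmin cov list len b' : ℕ → ℕ} {t : ℕ} (hpm : IsPairMin A m (T + 1) pmin)
    (hcl : IsClassified A m D m pmin cov list len heavy) (h2 : 2 * A (m - 1) ≤ T)
    (hr : IsReached A m heavy t b) (h0 : 0 < t) (htT : t ≤ T) (hle : ∀ p, b' p ≤ b p)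
    (hnew : b (t % A 0) = t → ∀ j < len (co (t % A 0)),
      b' ((t + A (list (co (t % A 0) * D + j))) % A 0) ≤
        t + A (list (co (t % A 0) * D + j))) : IsReached A m heavy (t + 1) b' := by
  intro v hv hp l hl u hu hut he
  rcases Nat.lt_succ_iff_lt_or_eq.1 hut with hut | rfl
  · exact (hle _).trans (hr v hv hp l hl u hu hut he)
  have hua : IsApery A m u := IsApery.of_add (v := A l) (by rwa [add_comm, ← he]) hu
    (coin_mem_feas hl)
  have hup : IsPure A m heavy u := IsPure.of_add (v := A l) (by rwa [add_comm, ← he])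
    (coin_mem_feas hl)
  have hbu := hr.eq hA hg hua hup h0 htT
  have hm := hA.mod_lt u
  obtain ⟨-, h' | ⟨hc, hlight, w, hw, hbw⟩⟩ := (hg _ hm).2.resolve_left (by omega)
  · omega
  set c := co (u % A 0) with hcdef
  rw [hbu] at hbw
  have hpair : IsApery A m (A c + A l) := IsApery.of_add (v := w) (by
    rwa [show A c + A l + w = v by omega]) (add_mem (coin_mem_feas hc) (coin_mem_feas hl)) hw
  have hmp := hA.mod_lt (A c + A l)
  have hmin := hpm.le c hc l hl
  have hcle := hA.le_last hc
  have hlle := hA.le_last hl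
  have hfree : FreePair A pmin cov c l := by
    constructor
    · obtain hinf | ⟨c', hc', l', hl', hcl', hmod⟩ := hpm.eq _ hmp
      · omega
      · refine le_antisymm hmin ?_
        rw [hcl']
        exact hpair.2 _ (add_mem (coin_mem_feas hc') (coin_mem_feas hl')) hmod
    -- Covered would mean that a heavy coin and some partner have the same minimal sum as c and l;
    -- exchanging the pairs puts a heavy coin into v.
    · by_contra hcov
      obtain ⟨x, hx, hheavy, l', hl', hcl', hmod⟩ := hcl.covered _ hmp hcov
      have hge := hpair.2 _ (add_mem (coin_mem_feas hx) (coin_mem_feas hl')) hmod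
      exact hp x hx hheavy (A l' + w) (add_mem (coin_mem_feas hl') hw) (by omega)
  obtain ⟨j, hj, hjl⟩ := hcl.listed c hc hlight l hl hfree
  have := hnew hbu j hj
  rw [hjl] at this
  rwa [he, add_comm (A l)]

theorem IsHeavyClosure.zero (b : ℕ → ℕ) : IsHeavyClosure A m heavy b 0 b := fun p hp =>
  ⟨le_rfl, ⟨p, hp, 0, zero_mem _, by simp, by simp; rfl⟩, by simp⟩

theorem IsHeavyClosure.succ_of_light {i : ℕ} {b' : ℕ → ℕ} (h : IsHeavyClosure A m heavy b i b')
    (hi : heavy i = 0) : IsHeavyClosure A m heavy b (i + 1) b' := by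
  intro p hp
  refine ⟨(h p hp).1, (h p hp).2.1, fun x hx hh => ?_⟩
  rcases Nat.lt_succ_iff_lt_or_eq.1 hx with hx | rfl
  · exact (h p hp).2.2 x hx hh
  · exact absurd hi hh

/-- Adding coins commutes: an entry of b'' is an entry of b' plus copies of coin i, and an earlier
heavy coin x can be added before these copies. Hence one pass over the coins is enough. -/
theorem IsHeavyClosure.succ {i : ℕ} {b' b'' : ℕ → ℕ} (hA : CoinSystem A m) (hi : i < m)
    (h : IsHeavyClosure A m heavy b i b') (hc : IsCoinClosure (A 0) (A i) b' b'') :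
    IsHeavyClosure A m heavy b (i + 1) b'' := by
  have hmul : ∀ k, k * A i ∈ Feas A m := fun k => by
    rw [← smul_eq_mul]; exact nsmul_mem (coin_mem_feas hi) k
  intro p hp
  refine ⟨(hc.le p hp).trans (h p hp).1, ?_, fun x hx hh => ?_⟩
  · obtain ⟨k, q, hq, he, hmod⟩ := hc.eq_add p hp
    obtain ⟨q₀, hq₀, u, hu, he', hmod'⟩ := (h q hq).2.1
    exact ⟨q₀, hq₀, u + k * A i, add_mem hu (hmul k), by omega, by
      rw [← add_assoc]; exact (hmod'.add_right _).trans hmod⟩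
  · rcases Nat.lt_succ_iff_lt_or_eq.1 hx with hx | rfl
    · obtain ⟨k, q, hq, he, hmod⟩ := hc.eq_add p hp
      have hstep := (h q hq).2.2 x hx hh
      -- the closure under coin `i` keeps the table closed under coin `x`
      have hk : ∀ k q, q < A 0 → b'' ((q + k * A i) % A 0) ≤ b' q + k * A i := by
        intro k q hq
        induction k with
        | zero => simpa [Nat.mod_eq_of_lt hq] using hc.le q hq
        | succ k ih =>
          have := hc.step _ (hA.mod_lt (q + k * A i))
          rw [Nat.mod_add_mod] at this
          have e : q + (k + 1) * A i = q + k * A i + A i := by ring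
          rw [e]
          linarith
      have h2 := hk k _ (hA.mod_lt (q + A x))
      have e : ((q + A x) % A 0 + k * A i) % A 0 = (p + A x) % A 0 := by
        rw [Nat.mod_add_mod, show q + A x + k * A i = q + k * A i + A x by ring]
        exact hmod.add_right _
      rw [e] at h2
      omega
    · exact hc.step p hp

/-- Strong induction on the Apéry value: a pure one is in b by hypothesis, and otherwise removing a
heavy coin leaves a smaller Apéry value, from which closure under that coin leads back. Infinite
entries cannot survive because T bounds the whole table. -/
theorem isAperyTable_of_heavyClosure {b' : ℕ → ℕ} (hA : CoinSystem A m) (hT : TableBound A m T)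
    (hg : ∀ p < A 0, b p = T + 1 ∨ b p ∈ Feas A m ∧ b p ≡ p [MOD A 0])
    (hp : ∀ v, IsApery A m v → IsPure A m heavy v → v ≤ T → b (v % A 0) ≤ v)
    (hc : IsHeavyClosure A m heavy b m b') : IsAperyTable A m b' := by
  have hle : ∀ v, IsApery A m v → v ≤ T → b' (v % A 0) ≤ v := by
    intro v
    induction v using Nat.strong_induction_on with
    | _ v ih =>
      intro hv hvT
      by_cases hpure : IsPure A m heavy v
      · exact ((hc _ (hA.mod_lt v)).1).trans (hp v hv hpure hvT)
      · unfold IsPure at hpure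
        push Not at hpure
        obtain ⟨x, hx, hh, u, hu, he⟩ := hpure
        have hxpos := hA.pos_of_lt hx
        have hpos := hA.pos
        have hua : IsApery A m u := IsApery.of_add (v := A x) (by rwa [add_comm, ← he]) hu
          (coin_mem_feas hx)
        have h1 := ih u (by omega) hua (by omega)
        have h2 := (hc _ (hA.mod_lt u)).2.2 x hx hh
        rw [Nat.mod_add_mod, add_comm u, ← he] at h2
        omega
  intro p hpA
  obtain ⟨v, hv, hvp, hvT⟩ := hT.exists_apery p
  have h1 := hle v hv hvT
  have e : v % A 0 = p := by rw [hvp, Nat.mod_eq_of_lt hpA]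
  rw [e] at h1
  obtain ⟨q, hq, u, hu, he, hmod⟩ := (hc p hpA).2.1
  obtain ⟨hf, hmodq⟩ := (hg q hq).resolve_left (by omega)
  have hmodp : b' p ≡ p [MOD A 0] := by rw [he]; exact (hmodq.add_right u).trans hmod
  have h2 := hv.2 (b' p) (he ▸ add_mem hf hu) (hmodp.trans hvp.symm)
  rw [show b' p = v by omega]
  exact ⟨hv, hvp⟩

end

/-! ### The scan and the heavy closure on the machine. -/

namespace ArrayRAM

open AExpr ACmd

variable {M : Machine} {A : ℕ → ℕ} {m T D : ℕ} {s : AState}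

/-- The table in array `1` becomes infinite except for the entry of residue zero. -/
def initTable : ACmd := .seq (forLoop 20 1 (store 1 (reg 20) (reg 6))) (store 1 0 0)

/-- Enters the light coins into the table; array `7` holds the coins used. -/
def initCoins : ACmd := forLoop 20 0 (block [
  assign 21 (load 0 (reg 20)),
  assign 22 (reg 21 % reg 1),
  branch (bin .eq (load 6 (reg 20)) 0)
    (branch (bin .lt (reg 21) (load 1 (reg 22)))
      (block [store 1 (reg 22) (reg 21), store 7 (reg 22) (reg 20)]) skip) skip])

/-- Adds the coins listed for the coin in register `22` to the value in register `20`. -/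
def relax : ACmd := forLoop 25 23 (block [
  assign 26 (reg 20 + load 0 (load 4 (reg 24 + reg 25))),
  assign 27 (reg 26 % reg 1),
  branch (bin .lt (reg 26) (load 1 (reg 27)))
    (block [store 1 (reg 27) (reg 26), store 7 (reg 27) (reg 22)]) skip])

/-- Register `20` holds the positive table entry of its residue. -/
def scanCond : AExpr := bin .eq (load 1 (reg 21)) (reg 20) * bin .lt 0 (reg 20)

/-- Scans all values up to the table bound in increasing order. -/
def scan : ACmd := forLoop 20 6 (.seq (assign 21 (reg 20 % reg 1))
  (branch scanCond
    (.seq (block [assign 22 (load 7 (reg 21)), assign 23 (load 5 (reg 22)),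
      assign 24 (reg 22 * reg 7)]) relax)
    skip))

/-- Closes the table under all heavy coins. -/
def closeHeavy : ACmd := forLoop 20 0 (branch (load 6 (reg 20)) roundRobin skip)

theorem runs_initTable (h : Setup M A m T D s) :
    Runs M initTable s (A 0 * 40 + 30) (fun s' => SameBelow 20 s s' ∧ SameArr [1] s s' ∧
      ∀ p < A 0, s'.arr 1 p = if p = 0 then 0 else T + 1) := by
  refine (Runs.seq (B := A 0 * (12 + 8) + 6) (B' := 12) (Q := fun s' => SameBelow 20 s s' ∧
    SameArr [1] s s' ∧ ∀ p < A 0, s'.arr 1 p = T + 1) ?_ ?_).mono (by omega) (fun _ h => h)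
  · refine (Runs.forLoop (K := A 0) (c := 12) (fun j s' => SameBelow 20 s s' ∧ SameArr [1] s s' ∧
      ∀ p < j, s'.arr 1 p = T + 1) h.a_lt_L ?_ ?_ ?_ ?_)
    · simp
    · intro j s' _ hs
      rw [hs.1 1 (by omega), h.a_eq]
    · rintro j s' hj h20 ⟨hs, ha, hp⟩
      have := h.a_lt_L
      have h6 : s'.reg 6 = T + 1 := (hs 6 (by omega)).trans h.inf_eq
      refine (Runs.of_wp ?_).mono (by decide) (fun _ h => h)
      simp [h20, h6, hs, ha]
      exact ⟨by omega, fun p hpj hne => hp p (by omega)⟩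
    · exact fun s' _ hs => hs
  · rintro s' ⟨hs, ha, hp⟩
    refine (Runs.of_wp ?_).mono (by decide) (fun _ h => h)
    have := M.two_le
    simp [hs, ha]
    refine ⟨by omega, fun p hpA => ?_⟩
    split_ifs
    · rfl
    · exact hp p hpA

/-- Below 1 the only feasible value is zero, so `IsReached` at 1 concerns single coins; a coin that
is pure is light, and only light coins are entered. -/
theorem runs_initCoins (h : Setup M A m T D s)
    (hb : ∀ p < A 0, s.arr 1 p = if p = 0 then 0 else T + 1) :
    Runs M initCoins s (m * 70 + 6) (fun s' => SameBelow 20 s s' ∧ SameArr [1, 7] s s' ∧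
      IsGood A m T (s.arr 6) (s'.arr 1) (s'.arr 7) ∧
      IsReached A m (s.arr 6) 1 (s'.arr 1)) := by
  refine (Runs.forLoop (K := m) (c := 62) (fun j s' => SameBelow 20 s s' ∧ SameArr [1, 7] s s' ∧
      IsGood A m T (s.arr 6) (s'.arr 1) (s'.arr 7) ∧
      ∀ l < j, s.arr 6 l = 0 → s'.arr 1 (A l % A 0) ≤ A l) h.m_lt_L ?_ ?_ ?_ ?_)
  · refine ⟨by simp, by simp, fun p hp => ?_, by simp⟩
    rw [AState.setReg_arr, hb p hp]
    by_cases h0 : p = 0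
    · simp [h0]; rfl
    · simp [h0]
  · intro j s' _ hs
    rw [hs.1 0 (by omega), h.m_eq]
  · rintro j t hj h20 ⟨ht, hat, hg, hl⟩
    have hT : Setup M A m T D t := h.of_same ht (hat 0 (by decide))
    have a6 : t.arr 6 = s.arr 6 := hat 6 (by decide)
    have hm := h.m_lt_L
    have hv := h.mod_lt_L (A j)
    have hM := M.two_le
    refine (Runs.of_wp ?_).mono (by decide) (fun _ h => h)
    simp [h20, hT.coin_eq j hj, hT.a_eq, ht, hat, a6, AState.setArr_arr_fun]
    refine ⟨by omega, ⟨by omega, by omega⟩, fun h6 => ⟨hv, fun hlt => ⟨hv, ?_,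
      fun l hl' hl6 => ?_⟩, fun hle => ⟨hg, fun l hl' hl6 => ?_⟩⟩, fun h6 => ⟨hg, fun l hl' hl6 => ?_⟩⟩
    · exact hg.update hj h6 (zero_mem _) (by omega) rfl hlt (h.mod_lt _)
    · by_cases he : A l % A 0 = A j % A 0
      · rw [if_pos he]
        rcases Nat.lt_or_eq_of_le hl' with hl' | rfl
        · have := hl l hl' hl6; rw [he] at this; omega
        · exact le_rfl
      · rw [if_neg he]
        rcases Nat.lt_or_eq_of_le hl' with hl' | rfl
        · exact hl l hl' hl6
        · exact absurd rfl he
    · rcases Nat.lt_or_eq_of_le hl' with hl' | rfl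
      · exact hl l hl' hl6
      · exact hle
    · rcases Nat.lt_or_eq_of_le hl' with hl' | rfl
      · exact hl l hl' hl6
      · exact absurd hl6 h6
  · rintro s' - ⟨hs, ha, hg, hl⟩
    refine ⟨hs, ha, hg, fun v hv hp l hlm u hu hu1 he => ?_⟩
    obtain rfl : u = 0 := by omega
    obtain rfl : v = A l := by omega
    refine hl l hlm ?_
    by_contra hh
    exact hp l hlm hh 0 (zero_mem _) (by omega)

theorem runs_relax (h : Setup M A m T D s) {t c : ℕ} (h20 : s.reg 20 = t) (h22 : s.reg 22 = c)
    (h23 : s.reg 23 = s.arr 5 c) (h24 : s.reg 24 = c * D) (ht : t ≤ T)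
    (hc : c < m) (hl : s.arr 6 c = 0) {u : ℕ} (hu : u ∈ Feas A m) (htc : t = A c + u)
    (hg : IsGood A m T (s.arr 6) (s.arr 1) (s.arr 7)) (hlen : s.arr 5 c ≤ D)
    (hlt : ∀ j < s.arr 5 c, s.arr 4 (c * D + j) < m) :
    Runs M relax s (s.arr 5 c * 80 + 6) (fun s' => SameBelow 21 s s' ∧ SameArr [1, 7] s s' ∧
      IsGood A m T (s.arr 6) (s'.arr 1) (s'.arr 7) ∧ (∀ p, s'.arr 1 p ≤ s.arr 1 p) ∧
      ∀ j < s.arr 5 c, s'.arr 1 ((t + A (s.arr 4 (c * D + j))) % A 0) ≤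
        t + A (s.arr 4 (c * D + j))) := by
  have hcD : c * D + D ≤ m * D := by
    rw [← add_one_mul]; exact Nat.mul_le_mul_right _ hc
  have hmD := h.list_lt
  have hmD' : (m + 1) * (D + 1) = m * D + m + D + 1 := by ring
  refine (Runs.forLoop (K := s.arr 5 c) (c := 72) (fun i s' => SameBelow 25 s s' ∧
      SameArr [1, 7] s s' ∧
      IsGood A m T (s.arr 6) (s'.arr 1) (s'.arr 7) ∧ (∀ p, s'.arr 1 p ≤ s.arr 1 p) ∧
      ∀ j < i, s'.arr 1 ((t + A (s.arr 4 (c * D + j))) % A 0) ≤ t + A (s.arr 4 (c * D + j)))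
      (by omega) ?_ ?_ ?_ ?_)
  · simp [hg]
  · intro j s' _ hs
    rw [hs.1 23 (by omega), h23]
  · rintro i s' hi h25 ⟨hs, ha, hg', hmono, hdone⟩
    have hT : Setup M A m T D s' := h.of_same hs.mono (ha 0 (by decide))
    have a4 : s'.arr 4 = s.arr 4 := ha 4 (by decide)
    have e20 : s'.reg 20 = t := by rw [hs 20 (by omega), h20]
    have e22 : s'.reg 22 = c := by rw [hs 22 (by omega), h22]
    have e24 : s'.reg 24 = c * D := by rw [hs 24 (by omega), h24]
    have hlm := hlt i hi
    set l := s.arr 4 (c * D + i) with hldef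
    have hcl := h.coin_le hlm
    have hL := h.lt_L
    have hm := h.m_lt_L
    have hv := h.mod_lt_L (t + A l)
    refine (Runs.of_wp ?_).mono (by decide) (fun _ h => h)
    simp [h25, e20, e22, e24, a4, ← hldef, hT.coin_eq l hlm, hT.a_eq, hs, ha, AState.setArr_arr_fun]
    refine ⟨⟨⟨by omega, by omega⟩, by omega⟩, hv, fun hcond => ⟨hv, ?_, fun p => ?_, fun j hj => ?_⟩,
      fun hcond => ⟨hg', hmono, fun j hj => ?_⟩⟩
    · exact hg'.update hc hl (add_mem hu (coin_mem_feas hlm)) (by omega) rfl hcond (h.mod_lt _)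
    · by_cases hpe : p = (t + A l) % A 0
      · rw [if_pos hpe, hpe]; exact hcond.le.trans (hmono _)
      · rw [if_neg hpe]; exact hmono p
    · by_cases hpe : (t + A (s.arr 4 (c * D + j))) % A 0 = (t + A l) % A 0
      · rw [if_pos hpe]
        rcases Nat.lt_or_eq_of_le hj with hj | rfl
        · have := hdone j hj; rw [hpe] at this; omega
        · exact le_rfl
      · rw [if_neg hpe]
        rcases Nat.lt_or_eq_of_le hj with hj | rfl
        · exact hdone j hj
        · exact absurd rfl hpe
    · rcases Nat.lt_or_eq_of_le hj with hj | rfl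
      · exact hdone j hj
      · exact hcond
  · rintro s' - ⟨hs, h⟩
    exact ⟨hs.mono, h⟩

/-- Amortized time: relaxation happens at t only if the entry of its residue equals t, and entries
never increase. So each residue pays for at most one list, of length at most D. -/
theorem runs_scan (h : Setup M A m T D s)
    (hpm : IsPairMin A m (T + 1) (s.arr 2))
    (hcl : IsClassified A m D m (s.arr 2) (s.arr 3) (s.arr 4) (s.arr 5) (s.arr 6))
    (hg : IsGood A m T (s.arr 6) (s.arr 1) (s.arr 7))
    (hr : IsReached A m (s.arr 6) 1 (s.arr 1)) :
    Runs M scan s ((T + 1) * 60 + A 0 * (D * 80 + 100) + 6) (fun s' => SameBelow 20 s s' ∧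
      SameArr [1, 7] s s' ∧ IsGood A m T (s.arr 6) (s'.arr 1) (s'.arr 7) ∧
      IsReached A m (s.arr 6) (T + 1) (s'.arr 1)) := by
  have hL := h.lt_L
  have hM := M.two_le
  -- The budget is 60 for each value left and D · 80 + 100 for each residue whose entry is not yet
  -- below t. The index `max 1 t` accounts for t = 0, which has no last coin and whose successors,
  -- the coins, are entered beforehand.
  refine (Runs.forLoop_budget (K := T + 1) (fun t β s' => SameBelow 20 s s' ∧
      SameArr [1, 7] s s' ∧ IsGood A m T (s.arr 6) (s'.arr 1) (s'.arr 7) ∧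
      IsReached A m (s.arr 6) (max 1 t) (s'.arr 1) ∧
      (T + 1 - t) * 60 + (A 0 - #{p ∈ range (A 0) | s'.arr 1 p < t}) * (D * 80 + 100) ≤ β)
      (by omega) ?_ ?_ ?_ ?_)
  · simpa using ⟨hg, hr⟩
  · intro t β s' _ hs
    rw [hs.1 6 (by omega), h.inf_eq]
  · rintro t β s' ht h20 ⟨hs, ha, hg', hr', hβ⟩
    have hT : Setup M A m T D s' := h.of_same hs (ha 0 (by decide))
    have hv := h.mod_lt t
    have hv' := h.mod_lt_L t
    have e2 : T + 1 - t = (T + 1 - (t + 1)) + 1 := by omega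
    have hcardle : ∀ b' : ℕ → ℕ, (∀ p, b' p ≤ s'.arr 1 p) →
        #{p ∈ range (A 0) | s'.arr 1 p < t} ≤ #{p ∈ range (A 0) | b' p < t + 1} := by
      intro b' hb'
      refine card_le_card fun p hp => ?_
      have := mem_filter.1 hp
      have := hb' p
      exact mem_filter.2 ⟨by tauto, by omega⟩
    have hstep1 : Runs M (assign 21 (reg 20 % reg 1)) s' 4 (fun s₁ => s₁ = s'.setReg 21 (t % A 0)) :=
      Runs.of_wp (by simp [h20, hT.a_eq])
    by_cases hpop : s'.arr 1 (t % A 0) = t ∧ 0 < t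
    · obtain ⟨hpop, hpos⟩ := hpop
      obtain ⟨-, h' | ⟨hc, hlight, u, hu, htu⟩⟩ := (hg' _ hv).2.resolve_left (by omega)
      · omega
      set c := s'.arr 7 (t % A 0) with hcdef
      have hlen := hcl.len_le c hc hlight
      have hlt := hcl.list_lt c hc hlight
      have hcD : c * D + D ≤ m * D := by
        rw [← add_one_mul]; exact Nat.mul_le_mul_right _ hc
      have hmD := h.list_lt
      have hmD' : (m + 1) * (D + 1) = m * D + m + D + 1 := by ring
      have hm := h.m_lt_L
      have a4 : s'.arr 4 = s.arr 4 := ha 4 (by decide)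
      have a5 : s'.arr 5 = s.arr 5 := ha 5 (by decide)
      have a6 : s'.arr 6 = s.arr 6 := ha 6 (by decide)
      refine ⟨D * 80 + 60, (T + 1 - (t + 1)) * 60 +
        (A 0 - #{p ∈ range (A 0) | s'.arr 1 p < t} - 1) * (D * 80 + 100), ?_, ?_⟩
      · have hlt' : #{p ∈ range (A 0) | s'.arr 1 p < t} < A 0 := by
          calc _ < #(range (A 0)) := card_lt_card ⟨filter_subset _ _, fun hh => by
                have := hh (mem_range.2 hv); rw [mem_filter] at this; omega⟩
            _ = A 0 := by simp
        obtain ⟨x, hx⟩ : ∃ x, A 0 - #{p ∈ range (A 0) | s'.arr 1 p < t} = x + 1 :=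
          ⟨A 0 - #{p ∈ range (A 0) | s'.arr 1 p < t} - 1, by omega⟩
        rw [hx, e2] at hβ
        rw [hx, Nat.add_sub_cancel]
        have : (x + 1) * (D * 80 + 100) = x * (D * 80 + 100) + (D * 80 + 100) := by ring
        omega
      · refine (hstep1.seq (B' := D * 80 + 56) ?_).mono (by omega) (fun _ h => h)
        rintro _ rfl
        refine (Runs.branch (B := D * 80 + 36) ?_ (fun hcond => ?_) (fun hcond => ?_)).mono
          (by simp only [scanCond, AExpr.cost]; omega) (fun _ h => h)
        · simp [scanCond, h20, hpop, hpos]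
          omega
        · refine (Runs.seq (B := 25) (B' := s.arr 5 c * 80 + 6) (Q := fun s₂ => SameBelow 21 s' s₂ ∧
            s₂.arr = s'.arr ∧ s₂.reg 22 = c ∧ s₂.reg 23 = s.arr 5 c ∧ s₂.reg 24 = c * D) ?_ ?_).mono
            (by omega) (fun _ h => h)
          · refine (Runs.of_wp ?_).mono (by decide) (fun _ h => h)
            simp [← hcdef, hT.D_eq, a5]
            omega
          · rintro s₂ ⟨hs₂, ha₂, h22, h23, h24⟩
            have hT₂ : Setup M A m T D s₂ := hT.of_same hs₂.mono (by rw [ha₂])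
            have h20₂ : s₂.reg 20 = t := by rw [hs₂ 20 (by omega), h20]
            refine (runs_relax hT₂ h20₂ h22 (by rw [h23, ha₂, a5]) h24 (by omega) hc
              (by rw [ha₂, a6]; exact hlight) hu (by omega) (by rw [ha₂, a6]; exact hg')
              (by rw [ha₂, a5]; exact hlen) (by rw [ha₂, a4, a5]; exact hlt)).mono
              (by rw [ha₂, a5]) ?_
            rintro s₃ ⟨hs₃, ha₃, hg₃, hmono, hnew⟩
            rw [ha₂] at hg₃ hmono hnew
            rw [a6] at hg₃
            rw [a4, a5] at hnew
            refine ⟨by rw [hs₃ 20 (by omega), h20₂], ?_, ?_, hg₃, ?_, ?_⟩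
            · simpa using (hs.trans hs₂).trans hs₃
            · simp only [sameArr_setReg]
              intro k hk
              rw [ha₃ k hk, ha₂, ha k hk]
            · rw [show max 1 (t + 1) = t + 1 by omega]
              rw [show max 1 t = t by omega] at hr'
              exact hr'.succ h.coins hg' hpm hcl h.two_mul_le hpos (by omega) hmono
                (fun _ => hnew)
            · rw [AState.setReg_arr]
              refine Nat.add_le_add_left (Nat.mul_le_mul_right _ ?_) _
              have hsub : insert (t % A 0) {p ∈ range (A 0) | s'.arr 1 p < t} ⊆
                  {p ∈ range (A 0) | s₃.arr 1 p < t + 1} := by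
                intro p hp
                rcases mem_insert.1 hp with rfl | hp
                · have := hmono (t % A 0)
                  exact mem_filter.2 ⟨mem_range.2 hv, by omega⟩
                · have := hmono p
                  have hp := mem_filter.1 hp
                  exact mem_filter.2 ⟨hp.1, by omega⟩
              have := card_le_card hsub
              rw [card_insert_of_notMem (by simp [hpop])] at this
              omega
        · simp [scanCond, h20, hpop, hpos] at hcond
    · refine ⟨40, (T + 1 - (t + 1)) * 60 +
        (A 0 - #{p ∈ range (A 0) | s'.arr 1 p < t}) * (D * 80 + 100), by omega, ?_⟩
      refine (hstep1.seq (B' := 36) ?_).mono (by omega) (fun _ h => h)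
      rintro _ rfl
      refine (Runs.branch (B := 10) ?_ (fun hcond => ?_) (fun hcond => ?_)).mono
          (by simp only [scanCond, AExpr.cost]; omega) (fun _ h => h)
      · simp [scanCond, h20]
        split_ifs <;> omega
      · refine absurd ?_ hpop
        simpa [scanCond, h20, and_comm] using hcond
      · refine (Runs.of_wp ?_).mono (B := 1) (by omega) (fun _ h => h)
        have := hcardle (s'.arr 1) (fun _ => le_rfl)
        refine ⟨by simp [h20], by simpa using hs, by simpa using ha, by simpa using hg', ?_, ?_⟩
        · intro v hv hp l hl u hu hut he
          rw [AState.setReg_arr]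
          rcases Nat.lt_or_ge u (max 1 t) with hlt | hge
          · exact hr' v hv hp l hl u hu hlt he
          -- A pure Apéry value t would have table entry t by `IsReached.eq`, but here t is not an
          -- entry. So there is nothing to extend.
          · have hut' : u = t ∧ 0 < t := by omega
            obtain ⟨rfl, hpos⟩ := hut'
            refine absurd ⟨?_, hpos⟩ hpop
            rw [show max 1 u = u by omega] at hr'
            have hadd : A l + u = u + A l := add_comm _ _
            exact hr'.eq h.coins hg' (.of_add (v := A l) (by rwa [← hadd, ← he]) hu
              (coin_mem_feas hl)) (.of_add (v := A l) (by rwa [← hadd, ← he])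
              (coin_mem_feas hl)) hpos (by omega)
        · exact Nat.add_le_add_left (Nat.mul_le_mul_right _ (Nat.sub_le_sub_left this _)) _
  · rintro β s' - ⟨hs, ha, hg', hr', -⟩
    exact ⟨hs, ha, hg', by simpa using hr'⟩

theorem runs_closeHeavy (h : Setup M A m T D s) (hb : ∀ p < A 0, s.arr 1 p ≤ T + 1) :
    Runs M closeHeavy s (m * 40 + #{c ∈ range m | s.arr 6 c ≠ 0} * (300 * A 0 + 120) + 6)
      (fun s' => SameBelow 20 s s' ∧ SameArr [1] s s' ∧
        IsHeavyClosure A m (s.arr 6) (s.arr 1) m (s'.arr 1)) := by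
  have hL := h.lt_L
  have hapos := h.coins.pos
  refine (Runs.forLoop_budget (K := m) (fun i β s' => SameBelow 20 s s' ∧ SameArr [1] s s' ∧
      IsHeavyClosure A m (s.arr 6) (s.arr 1) i (s'.arr 1) ∧ (m - i) * 40 +
      (#{c ∈ range m | s.arr 6 c ≠ 0} - #{c ∈ range i | s.arr 6 c ≠ 0}) * (300 * A 0 + 120) ≤ β)
      h.m_lt_L ?_ ?_ ?_ ?_)
  · simpa using IsHeavyClosure.zero _
  · intro t β s' _ hs
    rw [hs.1 0 (by omega), h.m_eq]
  · rintro i β s' hi h20 ⟨hs, ha, hc, hβ⟩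
    have hT : Setup M A m T D s' := h.of_same hs (ha 0 (by decide))
    have a6 : s'.arr 6 = s.arr 6 := ha 6 (by decide)
    have e2 : m - i = (m - (i + 1)) + 1 := by omega
    have hm := h.m_lt_L
    by_cases h6 : s.arr 6 i = 0
    · refine ⟨20, (m - (i + 1)) * 40 +
        (#{c ∈ range m | s.arr 6 c ≠ 0} - #{c ∈ range (i + 1) | s.arr 6 c ≠ 0}) *
          (300 * A 0 + 120), ?_, ?_⟩
      · rw [card_filter_range_succ, if_neg (by simp [h6])]
        simp only [add_zero]
        omega
      · refine (Runs.branch (B := 1) ?_ (fun hcond => ?_) (fun hcond => ?_)).mono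
          (by simp only [AExpr.cost]; omega) (fun _ h => h)
        · simp [h20]; omega
        · simp [h20, a6, h6] at hcond
        · refine (Runs.of_wp ?_).mono (B := 1) le_rfl (fun _ h => h)
          exact ⟨h20, by simpa using hs, by simpa using ha, by simpa using hc.succ_of_light h6,
            le_rfl⟩
    · have hcount : #{c ∈ range (i + 1) | s.arr 6 c ≠ 0} ≤ #{c ∈ range m | s.arr 6 c ≠ 0} :=
        card_le_card (filter_subset_filter _ (range_subset_range.2 hi))
      rw [card_filter_range_succ, if_pos h6] at hcount
      refine ⟨300 * A 0 + 120, (m - (i + 1)) * 40 +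
        (#{c ∈ range m | s.arr 6 c ≠ 0} - #{c ∈ range (i + 1) | s.arr 6 c ≠ 0}) *
          (300 * A 0 + 120), ?_, ?_⟩
      · rw [card_filter_range_succ, if_pos h6]
        obtain ⟨x, hx⟩ : ∃ x, #{c ∈ range m | s.arr 6 c ≠ 0} =
            #{c ∈ range i | s.arr 6 c ≠ 0} + 1 + x := ⟨_, (Nat.add_sub_of_le hcount).symm⟩
        rw [hx, add_assoc, Nat.add_sub_cancel_left] at hβ
        rw [hx, Nat.add_sub_cancel_left]
        have : (1 + x) * (300 * A 0 + 120) = x * (300 * A 0 + 120) + (300 * A 0 + 120) := by ring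
        omega
      · refine (Runs.branch (B := 300 * A 0 + 100) ?_ (fun hcond => ?_) (fun hcond => ?_)).mono
          (by simp only [AExpr.cost]; omega) (fun _ h => h)
        · simp [h20]; omega
        · have hcl := h.coin_le hi
          have hal := h.a_le
          refine (runs_roundRobin (Inf := T + 1) hapos hT.a_eq (by omega)
            (by rw [h20, hT.coin_eq i hi]) (fun p hp => ((hc p hp).1).trans (hb p hp))
            (by omega)).mono le_rfl ?_
          rintro s'' ⟨hs'', h20'', b', hb', hcc⟩
          have hread : s''.arr 1 = b' := by rw [hb']; simp
          refine ⟨by rw [h20'', h20], by simpa using hs.trans hs'', ?_, ?_, le_rfl⟩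
          · simp only [sameArr_setReg]
            intro k hk
            have : k ≠ 1 := by rintro rfl; exact hk (by decide)
            rw [hb', Function.update_of_ne this, ha k hk]
          · rw [AState.setReg_arr, hread]
            exact hc.succ h.coins hi hcc
        · simp [h20, a6, h6] at hcond
  · rintro β s' - ⟨hs, ha, hc, -⟩
    exact ⟨hs, ha, hc⟩

end ArrayRAM

/-! ### Fast sumsets: products of polynomials by tensor powers of a small transform -/

namespace TensorTransform

open Finset

variable {R : Type*} [CommRing R]

/-- The kernel of the tensor power of the matrix `V`: the product of its entries over the first
`j` digits in base `B`. -/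
def kernel (B : ℕ) (V : ℕ → ℕ → R) (j x y : ℕ) : R :=
  ∏ d ∈ range j, V (x / B ^ d % B) (y / B ^ d % B)

/-- The matrix `V` is applied to the digits below `j` in base `B`. -/
def transform (B : ℕ) (V : ℕ → ℕ → R) (j : ℕ) (f : ℕ → R) (x : ℕ) : R :=
  ∑ y ∈ range (B ^ j), kernel B V j x y * f (x - x % B ^ j + y)

theorem sum_range_mul (g : ℕ → R) (m q : ℕ) :
    ∑ y ∈ range (m * q), g y = ∑ i ∈ range m, ∑ y ∈ range q, g (i * q + y) := by
  induction m with
  | zero => simp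
  | succ m ih => rw [add_one_mul, sum_range_add, sum_range_succ, ih]

variable {B : ℕ} {V : ℕ → ℕ → R}

theorem digit_mod {d j : ℕ} (x : ℕ) (hd : d < j) : x % B ^ j / B ^ d % B = x / B ^ d % B := by
  obtain ⟨e, rfl⟩ : ∃ e, j = d + 1 + e := ⟨j - (d + 1), by omega⟩
  rw [pow_add, pow_succ, mul_assoc, Nat.mod_mul_right_div_self, Nat.mod_mul_right_mod]

theorem kernel_congr {j x x' y y' : ℕ} (hx : x % B ^ j = x' % B ^ j) (hy : y % B ^ j = y' % B ^ j) :
    kernel B V j x y = kernel B V j x' y' := by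
  refine prod_congr rfl fun d hd => ?_
  have hd := mem_range.1 hd
  rw [← digit_mod x hd, ← digit_mod y hd, hx, hy, digit_mod x' hd, digit_mod y' hd]

theorem kernel_succ {j x i y : ℕ} (hi : i < B) (hy : y < B ^ j) :
    kernel B V (j + 1) x (i * B ^ j + y) = V (x / B ^ j % B) i * kernel B V j x y := by
  unfold kernel
  rw [prod_range_succ, mul_comm]
  have hB : 0 < B ^ j := by omega
  congr 1
  · rw [mul_comm i, Nat.mul_add_div hB, Nat.div_eq_of_lt hy, add_zero, Nat.mod_eq_of_lt hi]
  · exact kernel_congr (V := V) rfl (by rw [mul_comm, Nat.mul_add_mod])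

theorem transform_zero (f : ℕ → R) (x : ℕ) : transform B V 0 f x = f x := by
  simp [transform, kernel, Nat.mod_one]

/-- Tensor structure: applying the matrix to one more digit combines the B partial transforms at the
numbers that differ from x in that digit only. -/
theorem transform_succ (hB : 0 < B) (j : ℕ) (f : ℕ → R) (x : ℕ) :
    transform B V (j + 1) f x = ∑ i ∈ range B, V (x / B ^ j % B) i *
      transform B V j f (x - x / B ^ j % B * B ^ j + i * B ^ j) := by
  have hq : 0 < B ^ j := by positivity
  rw [transform, pow_succ', sum_range_mul]
  refine sum_congr rfl fun i hi => ?_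
  have hi := mem_range.1 hi
  rw [transform, mul_sum]
  refine sum_congr rfl fun y hy => ?_
  have hy := mem_range.1 hy
  rw [kernel_succ hi hy, mul_assoc]
  have hx : x = B * B ^ j * (x / (B * B ^ j)) + x / B ^ j % B * B ^ j + x % B ^ j := by
    have h1 := Nat.div_add_mod x (B ^ j)
    have h2 := Nat.div_add_mod (x / B ^ j) B
    rw [Nat.div_div_eq_div_mul, mul_comm (B ^ j) B] at h2
    calc x = B ^ j * (x / B ^ j) + x % B ^ j := h1.symm
      _ = B ^ j * (B * (x / (B * B ^ j)) + x / B ^ j % B) + x % B ^ j := by rw [h2]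
      _ = _ := by ring
  have hm : x % (B * B ^ j) = x / B ^ j % B * B ^ j + x % B ^ j := by
    rw [mul_comm B, Nat.mod_mul]; ring
  have hdig : x - x / B ^ j % B * B ^ j = B ^ j * (B * (x / (B * B ^ j))) + x % B ^ j := by
    have : B * B ^ j * (x / (B * B ^ j)) = B ^ j * (B * (x / (B * B ^ j))) := by ring
    rw [this] at hx
    exact Nat.sub_eq_of_eq_add (by rw [add_right_comm]; exact hx)
  have hbase : (x - x / B ^ j % B * B ^ j + i * B ^ j) % B ^ j = x % B ^ j := by
    rw [hdig, add_right_comm, mul_comm i, ← mul_add, Nat.mul_add_mod, Nat.mod_mod]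
  rw [hbase]
  congr 2
  · exact kernel_congr (V := V) hbase.symm rfl
  · have h3 : B * B ^ j * (x / (B * B ^ j)) = B ^ j * (B * (x / (B * B ^ j))) := by ring
    rw [h3] at hx
    rw [hdig, hm]
    generalize x / B ^ j % B * B ^ j = u at hx ⊢
    generalize B ^ j * (B * (x / (B * B ^ j))) = v at hx ⊢
    generalize x % B ^ j = z at hx ⊢
    congr 1
    omega

theorem transform_of_lt {k x : ℕ} (f : ℕ → R) (hx : x < B ^ k) :
    transform B V k f x = ∑ y ∈ range (B ^ k), kernel B V k x y * f y := by
  refine sum_congr rfl fun y _ => ?_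
  rw [Nat.mod_eq_of_lt hx, Nat.sub_self, zero_add]

/-- If W V = D · 1, then the k-th tensor powers multiply to D^k · 1; the induction splits off the
leading digit. -/
theorem kernel_mul_kernel {W : ℕ → ℕ → R} {D : R} (hB : 0 < B)
    (hWV : ∀ i < B, ∀ j < B, ∑ l ∈ range B, W i l * V l j = if i = j then D else 0)
    (k x z : ℕ) (hx : x < B ^ k) (hz : z < B ^ k) :
    ∑ y ∈ range (B ^ k), kernel B W k x y * kernel B V k y z = if x = z then D ^ k else 0 := by
  induction k generalizing x z with
  | zero =>
    simp only [pow_zero, Nat.lt_one_iff] at hx hz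
    simp [kernel, hx, hz]
  | succ k ih =>
    have hq : 0 < B ^ k := by positivity
    rw [pow_succ', sum_range_mul]
    have hxd : x / B ^ k < B := Nat.div_lt_of_lt_mul (by rwa [← pow_succ])
    have hzd : z / B ^ k < B := Nat.div_lt_of_lt_mul (by rwa [← pow_succ])
    have hVk : ∀ i < B, ∀ y < B ^ k, kernel B V (k + 1) (i * B ^ k + y) z =
        V i (z / B ^ k) * kernel B V k y (z % B ^ k) := by
      intro i hi y hy
      conv_lhs => rw [← Nat.div_add_mod' z (B ^ k), kernel_succ hzd (Nat.mod_lt _ hq)]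
      rw [mul_comm i, Nat.mul_add_div hq, Nat.div_eq_of_lt hy, add_zero, Nat.mod_eq_of_lt hi]
      congr 1
      exact kernel_congr (V := V) (by rw [Nat.mul_add_mod]) rfl
    have hWk : ∀ i < B, ∀ y < B ^ k, kernel B W (k + 1) x (i * B ^ k + y) =
        W (x / B ^ k) i * kernel B W k (x % B ^ k) y := by
      intro i hi y hy
      rw [kernel_succ hi hy, Nat.mod_eq_of_lt hxd]
      congr 1
      exact kernel_congr (V := W) (Nat.mod_mod _ _).symm rfl
    have hsum : ∀ i ∈ range B, ∑ y ∈ range (B ^ k), kernel B W (k + 1) x (i * B ^ k + y) *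
        kernel B V (k + 1) (i * B ^ k + y) z = W (x / B ^ k) i * V i (z / B ^ k) *
          (if x % B ^ k = z % B ^ k then D ^ k else 0) := by
      intro i hi
      have hi := mem_range.1 hi
      rw [← ih _ _ (Nat.mod_lt x hq) (Nat.mod_lt z hq), mul_sum]
      refine sum_congr rfl fun y hy => ?_
      have hy := mem_range.1 hy
      rw [hVk i hi y hy, hWk i hi y hy]
      ring
    rw [sum_congr rfl hsum, ← sum_mul, hWV _ hxd _ hzd]
    have hiff : x = z ↔ x / B ^ k = z / B ^ k ∧ x % B ^ k = z % B ^ k := by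
      refine ⟨fun h => by simp [h], fun h => ?_⟩
      rw [← Nat.div_add_mod x (B ^ k), ← Nat.div_add_mod z (B ^ k), h.1, h.2]
    by_cases h1 : x / B ^ k = z / B ^ k <;> by_cases h2 : x % B ^ k = z % B ^ k <;>
      simp [hiff, h1, h2, pow_succ']

theorem transform_transform {W : ℕ → ℕ → R} {D : R} (hB : 0 < B)
    (hWV : ∀ i < B, ∀ j < B, ∑ l ∈ range B, W i l * V l j = if i = j then D else 0)
    {k x : ℕ} (f : ℕ → R) (hx : x < B ^ k) :
    ∑ y ∈ range (B ^ k), kernel B W k x y * ∑ z ∈ range (B ^ k), kernel B V k y z * f z =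
      D ^ k * f x := by
  simp_rw [mul_sum, ← mul_assoc]
  rw [sum_comm]
  simp_rw [← sum_mul]
  rw [sum_eq_single_of_mem x (mem_range.2 hx)]
  · rw [kernel_mul_kernel hB hWV k x x hx hx, if_pos rfl]
  · intro z hz hne
    rw [kernel_mul_kernel hB hWV k x z hx (mem_range.1 hz), if_neg hne.symm, zero_mul]

/-! Numbers with small digits -/

/-- The number with the base `r` digits that are the base `B` digits of `c`. -/
def rebase (B r c : ℕ) : ℕ := Nat.ofDigits r (Nat.digits B c)

/-- All base `B` digits are less than `r`. -/
def SmallDigits (B r c : ℕ) : Prop := ∀ d ∈ Nat.digits B c, d < r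

theorem rebase_zero (B r : ℕ) : rebase B r 0 = 0 := by simp [rebase]

theorem smallDigits_zero (B r : ℕ) : SmallDigits B r 0 := by simp [SmallDigits]

theorem rebase_eq {r : ℕ} (hB : 1 < B) (c : ℕ) :
    rebase B r c = c % B + r * rebase B r (c / B) := by
  rcases Nat.eq_zero_or_pos c with rfl | hc
  · simp [rebase]
  · simp [rebase, Nat.digits_def' hB hc, Nat.ofDigits_cons]

theorem smallDigits_iff {r : ℕ} (hB : 1 < B) (hr : 0 < r) (c : ℕ) :
    SmallDigits B r c ↔ c % B < r ∧ SmallDigits B r (c / B) := by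
  rcases Nat.eq_zero_or_pos c with rfl | hc
  · simp [SmallDigits, hr]
  · simp [SmallDigits, Nat.digits_def' hB hc]

/-- Digits below r add up to less than 2r, so no carry occurs and the sum can be evaluated digit by
digit. Carries in base r are harmless because only the value counts. -/
theorem rebase_add {r : ℕ} (hr : 0 < r) (c : ℕ) : ∀ c', SmallDigits (2 * r) r c →
    SmallDigits (2 * r) r c' → rebase (2 * r) r (c + c') = rebase (2 * r) r c + rebase (2 * r) r c' := by
  have hB : 1 < 2 * r := by omega
  induction c using Nat.strong_induction_on with
  | _ c ih =>
    intro c' hc hc'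
    rcases Nat.eq_zero_or_pos c with rfl | hpos
    · simp [rebase_zero]
    · have h1 := (smallDigits_iff hB hr c).1 hc
      have h2 := (smallDigits_iff hB hr c').1 hc'
      have hadd : (c + c') / (2 * r) = c / (2 * r) + c' / (2 * r) :=
        Nat.add_div_eq_of_add_mod_lt (by omega)
      have hmod : (c + c') % (2 * r) = c % (2 * r) + c' % (2 * r) :=
        Nat.add_mod_of_add_mod_lt (by omega)
      rw [rebase_eq hB (c + c'), rebase_eq hB c, rebase_eq hB c', hadd, hmod,
        ih _ (Nat.div_lt_self hpos hB) _ h1.2 h2.2]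
      ring

/-- This keeps the sum of two codes inside the index range of the transform. -/
theorem two_mul_lt_pow {r : ℕ} (hr : 0 < r) (k : ℕ) : ∀ c, SmallDigits (2 * r) r c →
    c < (2 * r) ^ k → 2 * c < (2 * r) ^ k := by
  have hB : 1 < 2 * r := by omega
  induction k with
  | zero => intro c _ hc; simp at hc; simp [hc]
  | succ k ih =>
    intro c hs hc
    have h1 := (smallDigits_iff hB hr c).1 hs
    have h2 := ih (c / (2 * r)) h1.2 (Nat.div_lt_of_lt_mul (by rwa [← pow_succ']))
    have h3 := Nat.div_add_mod c (2 * r)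
    rw [pow_succ']
    have h4 : 2 * r * (2 * (c / (2 * r)) + 1) ≤ 2 * r * (2 * r) ^ k := Nat.mul_le_mul_left _ h2
    nlinarith

theorem digit_add {r : ℕ} (hr : 0 < r) (d : ℕ) : ∀ c c', SmallDigits (2 * r) r c →
    SmallDigits (2 * r) r c' → (c + c') / (2 * r) ^ d % (2 * r) =
      c / (2 * r) ^ d % (2 * r) + c' / (2 * r) ^ d % (2 * r) := by
  have hB : 1 < 2 * r := by omega
  induction d with
  | zero =>
    intro c c' hc hc'
    have h1 := (smallDigits_iff hB hr c).1 hc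
    have h2 := (smallDigits_iff hB hr c').1 hc'
    simpa using Nat.add_mod_of_add_mod_lt (by omega)
  | succ d ih =>
    intro c c' hc hc'
    have h1 := (smallDigits_iff hB hr c).1 hc
    have h2 := (smallDigits_iff hB hr c').1 hc'
    have e (n : ℕ) : n / (2 * r) ^ (d + 1) = n / (2 * r) / (2 * r) ^ d := by
      rw [pow_succ', Nat.div_div_eq_div_mul]
    rw [e, e, e, Nat.add_div_eq_of_add_mod_lt (by omega)]
    exact ih _ _ h1.2 h2.2

/-- The code is obtained by reading the base r digits of e in base 2r. -/
theorem exists_rebase_eq {r : ℕ} (hr : 1 < r) {e k : ℕ} (he : e < r ^ k) :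
    ∃ c < (2 * r) ^ k, SmallDigits (2 * r) r c ∧ rebase (2 * r) r c = e := by
  have hB : 1 < 2 * r := by omega
  have hdig : Nat.digits (2 * r) (Nat.ofDigits (2 * r) (Nat.digits r e)) = Nat.digits r e := by
    refine Nat.digits_ofDigits (2 * r) hB _ (fun l hl => ?_) (fun h => ?_)
    · have := Nat.digits_lt_base hr hl; omega
    · exact Nat.getLast_digit_ne_zero r (Nat.digits_ne_nil_iff_ne_zero.1 h)
  refine ⟨Nat.ofDigits (2 * r) (Nat.digits r e), ?_, ?_, ?_⟩
  · rw [← Nat.digits_length_le_iff hB, hdig, Nat.digits_length_le_iff hr]; exact he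
  · intro d hd
    rw [hdig] at hd
    exact Nat.digits_lt_base hr hd
  · rw [rebase, hdig, Nat.ofDigits_digits]

/-- The kernel entry is a monomial whose exponents are the digits, evaluated at the digits of x;
without carries exponents add and monomials multiply. -/
theorem kernel_pow_add {r : ℕ} (hr : 0 < r) {k x c c' : ℕ} (hc : SmallDigits (2 * r) r c)
    (hc' : SmallDigits (2 * r) r c') :
    kernel (2 * r) (fun i j => (i : R) ^ j) k x (c + c') =
      kernel (2 * r) (fun i j => (i : R) ^ j) k x c *
        kernel (2 * r) (fun i j => (i : R) ^ j) k x c' := by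
  unfold kernel
  rw [← prod_mul_distrib]
  refine prod_congr rfl fun d _ => ?_
  simp only
  rw [digit_add hr d c c' hc hc', pow_add]

/-- The square of the transform of `f` is the transform of the additive convolution. -/
theorem transform_sq {r : ℕ} (hr : 0 < r) {k x : ℕ} (f : ℕ → R)
    (hf : ∀ c < (2 * r) ^ k, ¬ SmallDigits (2 * r) r c → f c = 0) :
    (∑ y ∈ range ((2 * r) ^ k), kernel (2 * r) (fun i j => (i : R) ^ j) k x y * f y) *
      (∑ y ∈ range ((2 * r) ^ k), kernel (2 * r) (fun i j => (i : R) ^ j) k x y * f y) =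
    ∑ c ∈ range ((2 * r) ^ k), kernel (2 * r) (fun i j => (i : R) ^ j) k x c *
      ∑ p ∈ range ((2 * r) ^ k) ×ˢ range ((2 * r) ^ k) with p.1 + p.2 = c, f p.1 * f p.2 := by
  set Z := (2 * r) ^ k with hZ
  set K := kernel (2 * r) (fun i j => (i : R) ^ j) k x with hK
  rw [sum_mul_sum, ← sum_product']
  -- Only pairs of small-digit codes contribute, and for them the sum is a valid index c below Z.
  have hterm : ∀ p ∈ range Z ×ˢ range Z, K p.1 * f p.1 * (K p.2 * f p.2) =
      ∑ c ∈ range Z, if p.1 + p.2 = c then K c * (f p.1 * f p.2) else 0 := by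
    intro p hp
    have hp := mem_product.1 hp
    rw [sum_ite_eq]
    by_cases h1 : SmallDigits (2 * r) r p.1
    · by_cases h2 : SmallDigits (2 * r) r p.2
      · have b1 := two_mul_lt_pow hr k _ h1 (mem_range.1 hp.1)
        have b2 := two_mul_lt_pow hr k _ h2 (mem_range.1 hp.2)
        rw [if_pos (mem_range.2 (by omega)), hK, kernel_pow_add hr h1 h2]
        ring
      · simp [hf _ (mem_range.1 hp.2) h2]
    · simp [hf _ (mem_range.1 hp.1) h1]
  rw [sum_congr rfl hterm, sum_comm]
  refine sum_congr rfl fun c _ => ?_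
  rw [mul_sum, sum_filter]

/-- Integer matrices that invert the Vandermonde matrix up to a factor. -/
theorem exists_vandermonde_inverse (B : ℕ) : ∃ (W : ℕ → ℕ → ℤ) (D : ℤ), D ≠ 0 ∧
    ∀ i < B, ∀ j < B, ∑ l ∈ range B, W i l * (l : ℤ) ^ j = if i = j then D else 0 := by
  set V : Matrix (Fin B) (Fin B) ℤ := Matrix.vandermonde (fun i => ((i : ℕ) : ℤ)) with hV
  -- The adjugate times V is the determinant times the identity, and the determinant is not zero
  -- because the nodes 0, …, B - 1 are distinct.
  refine ⟨fun i l => if h : i < B ∧ l < B then V.adjugate ⟨i, h.1⟩ ⟨l, h.2⟩ else 0, V.det, ?_, ?_⟩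
  · rw [hV, Matrix.det_vandermonde_ne_zero_iff]
    intro i j hij
    exact Fin.ext (Int.ofNat_inj.1 hij)
  · intro i hi j hj
    have h := congrFun (congrFun (Matrix.adjugate_mul V) ⟨i, hi⟩) ⟨j, hj⟩
    rw [Matrix.mul_apply, Matrix.smul_apply, Matrix.one_apply] at h
    rw [sum_range]
    simpa [hi, hV, Matrix.vandermonde_apply] using h

end TensorTransform

/-! ### The tensor transform on the machine -/

namespace TensorTransform

open Finset

section
variable {R : Type*} [CommRing R]

/-- The pairs of marked numbers with a given sum. -/
def sumPairs (Z : ℕ) (P : ℕ → Prop) [DecidablePred P] (c : ℕ) : Finset (ℕ × ℕ) :=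
  {p ∈ range Z ×ˢ range Z | p.1 + p.2 = c ∧ P p.1 ∧ P p.2}

theorem card_sumPairs_le (Z : ℕ) (P : ℕ → Prop) [DecidablePred P] (c : ℕ) :
    #(sumPairs Z P c) ≤ Z * Z :=
  (card_filter_le _ _).trans (by simp)

/-- Evaluate, square pointwise, interpolate: for an indicator function this counts representations
as sums of two marked codes, up to the factor D^k. -/
theorem transform_mul_self_transform {r : ℕ} (hr : 0 < r) {k x : ℕ} {W : ℕ → ℕ → R} {D : R}
    (hWV : ∀ i < 2 * r, ∀ j < 2 * r, ∑ l ∈ range (2 * r), W i l * (l : R) ^ j =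
      if i = j then D else 0) (P : ℕ → Prop) [DecidablePred P]
    (hP : ∀ c, P c → SmallDigits (2 * r) r c) {f g : ℕ → R}
    (hf : ∀ c < (2 * r) ^ k, f c = if P c then 1 else 0)
    (hg : ∀ c < (2 * r) ^ k, g c = transform (2 * r) (fun i j => (i : R) ^ j) k f c *
      transform (2 * r) (fun i j => (i : R) ^ j) k f c) (hx : x < (2 * r) ^ k) :
    transform (2 * r) W k g x = D ^ k * (#(sumPairs ((2 * r) ^ k) P x) : R) := by
  have hg' : ∀ y ∈ range ((2 * r) ^ k), kernel (2 * r) W k x y * g y = kernel (2 * r) W k x y *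
      ∑ c ∈ range ((2 * r) ^ k), kernel (2 * r) (fun i j => (i : R) ^ j) k y c *
        (#(sumPairs ((2 * r) ^ k) P c) : R) := by
    intro y hy
    have hy := mem_range.1 hy
    rw [hg y hy, transform_of_lt f hy, transform_sq hr f]
    · congr 1
      refine sum_congr rfl fun c _ => ?_
      congr 1
      rw [sumPairs, card_eq_sum_ones, Nat.cast_sum, sum_filter, sum_filter]
      refine sum_congr rfl fun p hp => ?_
      have hp := mem_product.1 hp
      rw [hf _ (mem_range.1 hp.1), hf _ (mem_range.1 hp.2)]
      by_cases h1 : P p.1 <;> by_cases h2 : P p.2 <;> simp [h1, h2]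
    · intro c hc hs
      rw [hf c hc, if_neg fun h => hs (hP c h)]
  rw [transform_of_lt g hx, sum_congr rfl hg', transform_transform (by omega) hWV _ hx]

end

/-- D need not be invertible modulo 2^w, so the count itself cannot be recovered. But an integer
that is not zero and is below 2^w in absolute value remains nonzero. -/
theorem pow_mul_natCast_ne_zero {w k n : ℕ} {D : ℤ} (hD : D ≠ 0) (hn : n ≠ 0)
    (h : D.natAbs ^ k * n < 2 ^ w) : (D : ZMod (2 ^ w)) ^ k * (n : ZMod (2 ^ w)) ≠ 0 := by
  intro h0
  have h1 : ((D ^ k * n : ℤ) : ZMod (2 ^ w)) = 0 := by push_cast; exact h0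
  rw [ZMod.intCast_zmod_eq_zero_iff_dvd] at h1
  have h2 := Int.natAbs_dvd_natAbs.2 h1
  rw [Int.natAbs_mul, Int.natAbs_pow, Int.natAbs_natCast, Int.natAbs_natCast] at h2
  have h3 : 0 < D.natAbs ^ k * n :=
    Nat.mul_pos (Nat.pow_pos (Int.natAbs_pos.2 hD)) (Nat.pos_of_ne_zero hn)
  exact absurd (Nat.le_of_dvd h3 h2) (by omega)

/-- Replacing one digit by another does not leave the range of k-digit numbers. -/
theorem sub_digit_add_lt {B : ℕ} {k d c i : ℕ} (hd : d < k) (hc : c < B ^ k)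
    (hi : i < B) : c - c / B ^ d % B * B ^ d + i * B ^ d < B ^ k := by
  have hq : 0 < B ^ d := Nat.pow_pos (by omega)
  obtain ⟨e, rfl⟩ : ∃ e, k = d + 1 + e := ⟨k - (d + 1), by omega⟩
  have h1 := Nat.div_add_mod c (B ^ d)
  have h2 := Nat.div_add_mod (c / B ^ d) B
  have h3 : c / B ^ d / B < B ^ e := by
    rw [Nat.div_div_eq_div_mul, ← pow_succ]
    exact Nat.div_lt_of_lt_mul (by rwa [← pow_add])
  have h4 := Nat.mod_lt c hq
  set z := c / B ^ d / B
  set y := c / B ^ d % B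
  have e1 : c = B ^ d * (B * z) + c % B ^ d + y * B ^ d := by
    conv_lhs => rw [← h1, ← h2]
    ring
  have e2 : c - y * B ^ d = B ^ d * (B * z) + c % B ^ d := Nat.sub_eq_of_eq_add e1
  rw [e2]
  calc B ^ d * (B * z) + c % B ^ d + i * B ^ d < B ^ d * (B * z) + B ^ d + i * B ^ d := by omega
    _ = B ^ d * (B * z + (i + 1)) := by ring
    _ ≤ B ^ d * (B * z + B) := Nat.mul_le_mul_left _ (by omega)
    _ = B ^ d * (B * (z + 1)) := by ring
    _ ≤ B ^ d * (B * B ^ e) := Nat.mul_le_mul_left _ (Nat.mul_le_mul_left _ h3)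
    _ = _ := by ring

end TensorTransform

/-! ### The transform with word arithmetic modulo 2^w. -/

namespace ArrayRAM

open AExpr ACmd Finset TensorTransform

theorem cast_apply_add (w x y : ℕ) :
    ((WordRAM.Op.add.apply w x y : ℕ) : ZMod (2 ^ w)) = x + y := by
  simp only [WordRAM.Op.apply]
  rw [show (2 : ℕ) ^ w = 2 ^ w from rfl, ZMod.natCast_mod]
  push_cast; rfl

theorem cast_apply_mul (w x y : ℕ) :
    ((WordRAM.Op.mul.apply w x y : ℕ) : ZMod (2 ^ w)) = x * y := by
  simp only [WordRAM.Op.apply]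
  rw [ZMod.natCast_mod]
  push_cast; rfl

theorem cast_apply_sub (w x y : ℕ) :
    ((WordRAM.Op.sub.apply w x y : ℕ) : ZMod (2 ^ w)) = x - y := by
  simp only [WordRAM.Op.apply]
  have h := (Nat.mod_lt y (show 0 < 2 ^ w by positivity)).le
  rw [ZMod.natCast_mod, Nat.cast_add, Nat.cast_sub h, ZMod.natCast_mod, ZMod.natCast_self]
  ring

variable {M : Machine} {s : AState}

/-- Stores the integers `f 0, …, f (n - 1)` as words in array `t`. -/
def storeTable (t : Fin 16) (f : ℕ → ℤ) : ℕ → ACmd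
  | 0 => .skip
  | n + 1 => .seq (storeTable t f n)
      (store t (const n) (wbin .sub (const (f n).toNat) (const (-f n).toNat)))

/-- An integer is stored as the wrapping difference of its positive and negative parts, one of which
is zero; both are constants of the program. -/
theorem runs_storeTable (t : Fin 16) (f : ℕ → ℤ) (n : ℕ) (hn : n ≤ M.L)
    (hf : ∀ j < n, (f j).natAbs < M.L) :
    Runs M (storeTable t f n) s (n * 11 + 1) (fun s' => s'.reg = s.reg ∧ SameArr [t] s s' ∧
      ∀ j < n, (s'.arr t j : ZMod (2 ^ M.w)) = f j) := by
  induction n with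
  | zero =>
    refine (Runs.of_wp (p := .skip) ?_).mono (by decide) (fun _ h => h)
    simp
  | succ n ih =>
    refine ((ih (by omega) fun j hj => hf j (by omega)).seq (B' := 11) ?_).mono (by ring_nf; rfl)
      (fun _ h => h)
    rintro s₁ ⟨h1, h2, h3⟩
    have hfn := hf n (by omega)
    refine (Runs.of_wp ?_).mono (by simp [ACmd.cost, AExpr.cost]) (fun _ h => h)
    refine ⟨by simp; omega, by simp; omega, by simp; omega, by simpa using h1,
      h2.setArr t _ _ (by simp), fun j hj => ?_⟩
    simp only [AState.setArr_arr, if_true, eval_const, eval_wbin]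
    split_ifs with hjn
    · subst hjn
      have h4 : ((f j).toNat : ℤ) - ((-f j).toNat : ℤ) = f j := by omega
      calc _ = ((((f j).toNat : ℤ) - ((-f j).toNat : ℤ) : ℤ) : ZMod (2 ^ M.w)) := by
            rw [cast_apply_sub, Int.cast_sub, Int.cast_natCast, Int.cast_natCast]
        _ = _ := by rw [h4]
    · exact h3 j (by omega)

/-- One entry of the transform along one axis: register `20` is the weight of the digit. -/
def axisEntry (t : Fin 16) : ACmd := .seq (block [
  assign 23 (reg 22 / reg 20 % reg 10),
  assign 24 (reg 22 - reg 23 * reg 20),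
  assign 23 (reg 23 * reg 10),
  assign 25 0])
  (.seq (forLoop 26 10 (assign 25 (wbin .add (reg 25)
      (wbin .mul (load t (reg 23 + reg 26)) (load 11 (reg 24 + reg 26 * reg 20))))))
    (store 12 (reg 22) (reg 25)))

/-- The transform of array `11` along one axis. -/
def axisStep (t : Fin 16) : ACmd := .seq (forLoop 22 9 (axisEntry t))
  (.seq (forLoop 22 9 (store 11 (reg 22) (load 12 (reg 22)))) (assign 20 (reg 20 * reg 10)))

/-- The transform of array `11` by the matrix in array `t` along all axes. -/
def tensorTransform (t : Fin 16) : ACmd := .seq (assign 20 1) (forLoop 21 8 (axisStep t))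

theorem runs_axisEntry {t : Fin 16} {B q c Z : ℕ} (h10 : s.reg 10 = B)
    (h20 : s.reg 20 = q) (h22 : s.reg 22 = c) (hc : c < Z) (hZ : Z < M.L) (hB : B * B < M.L)
    (hBpos : 0 < B) (hi : ∀ i < B, c - c / q % B * q + i * q < Z) :
    Runs M (axisEntry t) s (B * 40 + 60) (fun s' => SameBelow 23 s s' ∧ SameArr [12] s s' ∧
      (∀ c', c' ≠ c → s'.arr 12 c' = s.arr 12 c') ∧ (s'.arr 12 c : ZMod (2 ^ M.w)) =
        ∑ i ∈ range B, (s.arr t (c / q % B * B + i) : ZMod (2 ^ M.w)) *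
          (s.arr 11 (c - c / q % B * q + i * q) : ZMod (2 ^ M.w))) := by
  have hM := M.two_le
  set y := c / q % B with hy
  have hyB : y < B := Nat.mod_lt _ hBpos
  have hyB' : y * B + B ≤ B * B := by rw [← add_one_mul]; exact Nat.mul_le_mul_right _ hyB
  have hyq : y * q ≤ c := by
    calc y * q ≤ c / q * q := Nat.mul_le_mul_right _ (Nat.mod_le _ _)
      _ ≤ c := Nat.div_mul_le_self _ _
  have hBL : B < M.L := by nlinarith
  refine (Runs.seq (B := 40) (B' := B * 40 + 20) (Q := fun s' => SameBelow 23 s s' ∧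
    s'.arr = s.arr ∧ s'.reg 23 = y * B ∧ s'.reg 24 = c - y * q ∧ s'.reg 25 = 0) ?_ ?_).mono
    (by omega) (fun _ h => h)
  · refine (Runs.of_wp ?_).mono (by decide) (fun _ h => h)
    simp [h10, h20, h22, ← hy]
    omega
  · rintro s₁ ⟨hs₁, ha₁, h23, h24, h25⟩
    refine (Runs.seq (B := B * (28 + 8) + 6) (B' := 10) (Q := fun s' => SameBelow 23 s s' ∧
      s'.arr = s.arr ∧ (s'.reg 25 : ZMod (2 ^ M.w)) =
        ∑ i ∈ range B, (s.arr t (y * B + i) : ZMod (2 ^ M.w)) *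
          (s.arr 11 (c - y * q + i * q) : ZMod (2 ^ M.w))) ?_ ?_).mono (by omega) (fun _ h => h)
    · refine Runs.forLoop (K := B) (c := 28) (fun j s' => SameBelow 23 s s' ∧ s'.reg 23 = y * B ∧
        s'.reg 24 = c - y * q ∧ s'.arr = s.arr ∧ (s'.reg 25 : ZMod (2 ^ M.w)) =
        ∑ i ∈ range j, (s.arr t (y * B + i) : ZMod (2 ^ M.w)) *
          (s.arr 11 (c - y * q + i * q) : ZMod (2 ^ M.w))) hBL ?_ ?_ ?_ ?_
      · simp [hs₁, ha₁, h23, h24, h25]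
      · intro j s' _ hs
        rw [hs.1 10 (by omega), h10]
      · rintro j s' hj h26 ⟨hs, h23, h24, ha, hv⟩
        have h20' : s'.reg 20 = q := (hs 20 (by omega)).trans h20
        have := hi j hj
        refine (Runs.of_wp ?_).mono (by simp [ACmd.cost, AExpr.cost]) (fun _ h => h)
        simp [h23, h24, h26, h20', ha, hs, cast_apply_add, cast_apply_mul, hv, sum_range_succ]
        omega
      · exact fun s' _ hs => ⟨hs.1, hs.2.2.2⟩
    · rintro s₂ ⟨hs₂, ha₂, hv⟩
      have h22' : s₂.reg 22 = c := (hs₂ 22 (by omega)).trans h22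
      refine (Runs.of_wp ?_).mono (by decide) (fun _ h => h)
      have hsa : SameArr [12] s s₂ := fun k _ => by rw [ha₂]
      simp [h22', hs₂, hv, hsa, ha₂, hc.trans hZ]
      exact fun c' hc' h => absurd h hc'

/-- Every old entry is needed for B new ones, so the results are collected in array 12 and copied
back afterwards. -/
theorem runs_axisStep {t : Fin 16} (ht : t ≠ 11 ∧ t ≠ 12) {B d k : ℕ} (h10 : s.reg 10 = B)
    (h9 : s.reg 9 = B ^ k) (h20 : s.reg 20 = B ^ d) (hd : d < k) (hZ : B ^ k < M.L)
    (hB : B * B < M.L) (hBpos : 0 < B) :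
    Runs M (axisStep t) s (B ^ k * (B * 40 + 100) + 30) (fun s' => SameBelow 20 s s' ∧
      s'.reg 20 = B ^ (d + 1) ∧ s'.reg 21 = s.reg 21 ∧ SameArr [11, 12] s s' ∧
      ∀ c < B ^ k, (s'.arr 11 c : ZMod (2 ^ M.w)) =
        ∑ i ∈ range B, (s.arr t (c / B ^ d % B * B + i) : ZMod (2 ^ M.w)) *
          (s.arr 11 (c - c / B ^ d % B * B ^ d + i * B ^ d) : ZMod (2 ^ M.w))) := by
  set v : ℕ → ZMod (2 ^ M.w) := fun c =>
    ∑ i ∈ range B, (s.arr t (c / B ^ d % B * B + i) : ZMod (2 ^ M.w)) *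
      (s.arr 11 (c - c / B ^ d % B * B ^ d + i * B ^ d) : ZMod (2 ^ M.w)) with hv
  refine (Runs.seq (B := B ^ k * (B * 40 + 60 + 8) + 6) (B' := B ^ k * 28 + 14)
    (Q := fun s' => SameBelow 22 s s' ∧ SameArr [12] s s' ∧
      ∀ c < B ^ k, (s'.arr 12 c : ZMod (2 ^ M.w)) = v c) ?_ ?_).mono
    (by ring_nf; omega) (fun _ h => h)
  · refine Runs.forLoop (K := B ^ k) (c := B * 40 + 60) (fun j s' => SameBelow 22 s s' ∧
      SameArr [12] s s' ∧ ∀ c < j, (s'.arr 12 c : ZMod (2 ^ M.w)) = v c) hZ ?_ ?_ ?_ ?_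
    · simp
    · intro j s' _ hs
      rw [hs.1 9 (by omega), h9]
    · rintro j s' hj h22 ⟨hs, ha, hj'⟩
      refine (runs_axisEntry (t := t) ((hs 10 (by omega)).trans h10)
        ((hs 20 (by omega)).trans h20) h22 hj hZ hB hBpos fun i hi => sub_digit_add_lt hd hj hi).mono
        le_rfl ?_
      rintro s'' ⟨hs'', ha'', hne, he⟩
      rw [ha t (by simp [ht]), ha 11 (by decide)] at he
      have hsb : SameBelow 22 s s'' := hs.trans (hs''.mono (l' := 22))
      refine ⟨(hs'' 22 (by omega)).trans h22, by simpa using hsb,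
        by simpa using ha.trans ha'', fun c hc => ?_⟩
      rw [AState.setReg_arr]
      rcases Nat.lt_succ_iff_lt_or_eq.1 hc with hc | rfl
      · rw [hne c (by omega), hj' c hc]
      · exact he
    · exact fun s' _ hs => hs
  · rintro s₁ ⟨hs₁, ha₁, hv₁⟩
    refine (Runs.seq (B := B ^ k * (20 + 8) + 6) (B' := 8)
      (Q := fun s' => SameBelow 22 s s' ∧ SameArr [11, 12] s s' ∧
        ∀ c < B ^ k, (s'.arr 11 c : ZMod (2 ^ M.w)) = v c) ?_ ?_).mono
      (by omega) (fun _ h => h)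
    · refine Runs.forLoop (K := B ^ k) (c := 20) (fun j s' => SameBelow 22 s s' ∧
        SameArr [11, 12] s s' ∧ s'.arr 12 = s₁.arr 12 ∧
        ∀ c < j, (s'.arr 11 c : ZMod (2 ^ M.w)) = v c) hZ ?_ ?_ ?_ ?_
      · have : SameArr [11, 12] s s₁ := fun k hk => ha₁ k (by simp at hk ⊢; exact hk.2)
        simp [hs₁, this]
      · intro j s' _ hs
        rw [hs.1 9 (by omega), h9]
      · rintro j s' hj h22 ⟨hs, ha, h12, hj'⟩
        refine (Runs.of_wp ?_).mono (by decide) (fun _ h => h)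
        simp [h22, hs, ha, h12, hj.trans hZ, AState.setArr_arr_fun]
        intro c hc
        by_cases hcj : c = j
        · rw [if_pos hcj, ← hcj]; exact hv₁ c (by omega)
        · rw [if_neg hcj]; exact hj' c (by omega)
      · exact fun s' _ hs => ⟨hs.1, hs.2.1, hs.2.2.2⟩
    · rintro s₂ ⟨hs₂, ha₂, hv₂⟩
      have h10' : s₂.reg 10 = B := (hs₂ 10 (by omega)).trans h10
      have h20' : s₂.reg 20 = B ^ d := (hs₂ 20 (by omega)).trans h20
      have h21' : s₂.reg 21 = s.reg 21 := hs₂ 21 (by omega)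
      have hle : B ^ (d + 1) ≤ B ^ k := Nat.pow_le_pow_right hBpos hd
      have hsb : SameBelow 20 s s₂ := hs₂.mono
      rw [pow_succ] at hle
      refine (Runs.of_wp ?_).mono (by decide) (fun _ h => h)
      simp [h10', h20', h21', hsb, ha₂, pow_succ]
      exact ⟨by omega, hv₂⟩

theorem runs_tensorTransform {t : Fin 16} (ht : t ≠ 11 ∧ t ≠ 12) {B k : ℕ} (h10 : s.reg 10 = B)
    (h9 : s.reg 9 = B ^ k) (h8 : s.reg 8 = k) (hZ : B ^ k < M.L) (hk : k < M.L)
    (hB : B * B < M.L) (hBpos : 0 < B) :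
    Runs M (tensorTransform t) s (k * (B ^ k * (B * 40 + 100) + 38) + 8) (fun s' =>
      SameBelow 20 s s' ∧ SameArr [11, 12] s s' ∧
      ∀ c < B ^ k, (s'.arr 11 c : ZMod (2 ^ M.w)) =
        transform B (fun i j => (s.arr t (i * B + j) : ZMod (2 ^ M.w))) k
          (fun c => (s.arr 11 c : ZMod (2 ^ M.w))) c) := by
  have hM := M.two_le
  refine (Runs.seq (B := 2) (B' := k * (B ^ k * (B * 40 + 100) + 30 + 8) + 6)
    (Q := fun s' => s' = s.setReg 20 1) ?_ ?_).mono (le_of_eq (by ring)) (fun _ h => h)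
  · refine (Runs.of_wp ?_).mono (by decide) (fun _ h => h)
    simp
    omega
  rintro _ rfl
  refine Runs.forLoop (K := k) (c := B ^ k * (B * 40 + 100) + 30) (fun d s' => SameBelow 20 s s' ∧
    SameArr [11, 12] s s' ∧ s'.reg 20 = B ^ d ∧ ∀ c < B ^ k, (s'.arr 11 c : ZMod (2 ^ M.w)) =
        transform B (fun i j => (s.arr t (i * B + j) : ZMod (2 ^ M.w))) d
          (fun c => (s.arr 11 c : ZMod (2 ^ M.w))) c) hk ?_ ?_ ?_ ?_
  · simp [transform_zero]
  · intro j s' _ hs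
    rw [hs.1 8 (by omega), h8]
  · rintro d s' hd h21 ⟨hs, ha, h20, hv⟩
    refine (runs_axisStep ht ((hs 10 (by omega)).trans h10) ((hs 9 (by omega)).trans h9) h20 hd hZ
      hB hBpos).mono le_rfl ?_
    rintro s'' ⟨hs'', h20'', h21'', ha'', hv''⟩
    refine ⟨h21''.trans h21, by simpa using hs.trans hs'', ?_, by simpa using h20'', fun c hc => ?_⟩
    · simp only [sameArr_setReg]
      intro k hk
      rw [ha'' k hk, ha k hk]
    · rw [AState.setReg_arr, hv'' c hc, transform_succ hBpos, ha t (by simp [ht])]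
      refine sum_congr rfl fun i hi => ?_
      rw [hv _ (sub_digit_add_lt hd hc (mem_range.1 hi))]
  · exact fun s' _ hs => ⟨hs.1, hs.2.1, hs.2.2.2⟩

end ArrayRAM

/-! ### Residue tables by repeated doubling of sumsets -/

open Finset

namespace TensorTransform

theorem transform_congr {R : Type*} [CommRing R] {B k x : ℕ} {V V' : ℕ → ℕ → R} {f f' : ℕ → R}
    (hB : 0 < B) (hV : ∀ i < B, ∀ j < B, V i j = V' i j) (hf : ∀ y < B ^ k, f y = f' y)
    (hx : x < B ^ k) : transform B V k f x = transform B V' k f' x := by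
  rw [transform_of_lt f hx, transform_of_lt f' hx]
  refine sum_congr rfl fun y hy => ?_
  rw [hf y (mem_range.1 hy)]
  congr 1
  exact prod_congr rfl fun d _ => hV _ (Nat.mod_lt _ hB) _ (Nat.mod_lt _ hB)

theorem rebase_le {B r : ℕ} (hB : 1 < B) (hr : r ≤ B) (c : ℕ) : rebase B r c ≤ c := by
  induction c using Nat.strong_induction_on with
  | _ c ih =>
    rcases Nat.eq_zero_or_pos c with rfl | hpos
    · simp [rebase_zero]
    · rw [rebase_eq hB]
      have h1 := ih _ (Nat.div_lt_self hpos hB)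
      have h2 := Nat.mod_add_div c B
      have h3 := Nat.mul_le_mul hr h1
      omega

/-- Several codes can have the same value t, so t is a sum exactly if some code of t has a
representation; the small-digit codes of the two summands provide one. -/
theorem exists_sumPairs_iff {r k : ℕ} (hr : 1 < r) {E : Set ℕ} (hE : ∀ e ∈ E, e < r ^ k) (t : ℕ)
    (P : ℕ → Prop) [DecidablePred P]
    (hP : ∀ c, P c ↔ SmallDigits (2 * r) r c ∧ rebase (2 * r) r c ∈ E) :
    (∃ c < (2 * r) ^ k, #(sumPairs ((2 * r) ^ k) P c) ≠ 0 ∧ rebase (2 * r) r c = t) ↔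
      ∃ e ∈ E, ∃ e' ∈ E, e + e' = t := by
  constructor
  · rintro ⟨c, hc, hne, rfl⟩
    obtain ⟨p, hp⟩ := card_ne_zero.1 hne
    obtain ⟨-, rfl, h1, h2⟩ := mem_filter.1 hp
    rw [hP] at h1 h2
    exact ⟨_, h1.2, _, h2.2, (rebase_add (by omega) _ _ h1.1 h2.1).symm⟩
  · rintro ⟨e, he, e', he', rfl⟩
    obtain ⟨c, hc, hs, rfl⟩ := exists_rebase_eq hr (hE e he)
    obtain ⟨c', hc', hs', rfl⟩ := exists_rebase_eq hr (hE e' he')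
    have h1 := two_mul_lt_pow (by omega) k c hs hc
    have h2 := two_mul_lt_pow (by omega) k c' hs' hc'
    refine ⟨c + c', by omega, card_ne_zero.2 ⟨(c, c'), ?_⟩, rebase_add (by omega) _ _ hs hs'⟩
    simp only [sumPairs, mem_filter, mem_product, mem_range, true_and, hP]
    exact ⟨⟨hc, hc'⟩, ⟨hs, he⟩, hs', he'⟩

end TensorTransform

/-- The values up to `T` that are sums of at most `2 ^ i` coins. -/
def sumLevel (A : ℕ → ℕ) (m T : ℕ) : ℕ → Set ℕ
  | 0 => insert 0 (A '' Set.Iio m)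
  | i + 1 => {t | t ≤ T ∧ ∃ e ∈ sumLevel A m T i, ∃ e' ∈ sumLevel A m T i, e + e' = t}

section
variable {A : ℕ → ℕ} {m T : ℕ}

theorem zero_mem_sumLevel (i : ℕ) : 0 ∈ sumLevel A m T i := by
  induction i with
  | zero => exact Set.mem_insert _ _
  | succ i ih => exact ⟨Nat.zero_le _, 0, ih, 0, ih, rfl⟩

theorem le_of_mem_sumLevel (hT : ∀ i < m, A i ≤ T) {i t : ℕ} (ht : t ∈ sumLevel A m T i) :
    t ≤ T := by
  cases i with
  | zero =>
    rcases ht with rfl | ⟨i, hi, rfl⟩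
    · exact Nat.zero_le _
    · exact hT i hi
  | succ i => exact ht.1

theorem mem_feas_of_mem_sumLevel {i t : ℕ} (ht : t ∈ sumLevel A m T i) : t ∈ Feas A m := by
  induction i generalizing t with
  | zero =>
    rcases ht with rfl | h
    · exact zero_mem _
    · exact AddSubmonoid.subset_closure h
  | succ i ih =>
    obtain ⟨-, e, he, e', he', rfl⟩ := ht
    exact add_mem (ih he) (ih he')

/-- Halve the list of coins. Partial sums are at most the total, so cutting off above T at every
level loses nothing. -/
theorem sum_mem_sumLevel (i : ℕ) (l : List ℕ) (hl : ∀ x ∈ l, x ∈ A '' Set.Iio m)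
    (hi : l.length ≤ 2 ^ i) (hT : l.sum ≤ T) : l.sum ∈ sumLevel A m T i := by
  induction i generalizing l with
  | zero =>
    match l, hi with
    | [], _ => exact .inl rfl
    | [x], _ => exact .inr (by simpa using hl)
    | _ :: _ :: _, hi => simp at hi
  | succ i ih =>
    have hsum : (l.take (2 ^ i)).sum + (l.drop (2 ^ i)).sum = l.sum := by
      rw [← List.sum_append, List.take_append_drop]
    refine ⟨hT, _, ih (l.take (2 ^ i)) (fun x hx => hl x (List.mem_of_mem_take hx)) ?_ ?_, _,
      ih (l.drop (2 ^ i)) (fun x hx => hl x (List.mem_of_mem_drop hx)) ?_ ?_, hsum⟩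
    · simp
    · omega
    · rw [List.length_drop]; rw [pow_succ] at hi; omega
    · omega

/-- Coins are at least 1, so a value t uses at most t coins. -/
theorem CoinSystem.mem_sumLevel (hA : CoinSystem A m) {i t : ℕ} (ht : t ∈ Feas A m) (hT : t ≤ T)
    (hi : t ≤ 2 ^ i) : t ∈ sumLevel A m T i := by
  obtain ⟨l, hl, rfl⟩ := AddSubmonoid.exists_list_of_mem_closure ht
  refine sum_mem_sumLevel i l hl (le_trans ?_ hi) hT
  refine List.length_le_sum_of_one_le l fun x hx => ?_
  obtain ⟨j, hj, rfl⟩ := hl x hx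
  have := hA.pos_of_lt hj
  have := hA.pos
  omega

end

/-! ### Sumset doubling on the machine. -/

namespace ArrayRAM

open AExpr ACmd TensorTransform

/-- The parameters of the sumset computation: number of digits, size of the transform, base. -/
structure SumSetup (M : Machine) (A : ℕ → ℕ) (m T D r k : ℕ) (s : AState) : Prop
    extends Setup M A m T D s where
  k_eq : s.reg 8 = k
  Z_eq : s.reg 9 = (2 * r) ^ k
  B_eq : s.reg 10 = 2 * r
  one_lt : 1 < r
  T_lt : T < r ^ k
  k_lt : k < M.L
  Z_lt : (2 * r) ^ k < M.L
  B_lt : 2 * r * (2 * r) < M.L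

/-- Array `13` holds the Vandermonde matrix, array `14` holds the matrix `W`. -/
structure HasMatrices (M : Machine) (r : ℕ) (W : ℕ → ℕ → ℤ) (s : AState) : Prop where
  vandermonde : ∀ i < 2 * r, ∀ j < 2 * r,
    (s.arr 13 (i * (2 * r) + j) : ZMod (2 ^ M.w)) = (i : ZMod (2 ^ M.w)) ^ j
  inverse : ∀ i < 2 * r, ∀ j < 2 * r, (s.arr 14 (i * (2 * r) + j) : ZMod (2 ^ M.w)) = W i j

open Classical in
/-- Array `9` holds the values of all digit sequences, array `10` marks small digits. -/
def HasCodes (r k : ℕ) (s : AState) : Prop :=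
  ∀ c < (2 * r) ^ k, s.arr 9 c = rebase (2 * r) r c ∧
    s.arr 10 c = if SmallDigits (2 * r) r c then 1 else 0

open Classical in
/-- Array `8` is the indicator function of `E` up to `T`. -/
def IsIndicator (T : ℕ) (E : Set ℕ) (s : AState) : Prop :=
  ∀ t ≤ T, s.arr 8 t = if t ∈ E then 1 else 0

theorem IsIndicator.congr {T : ℕ} {E E' : Set ℕ} {s : AState} (h : IsIndicator T E s)
    (hE : ∀ t ≤ T, t ∈ E ↔ t ∈ E') : IsIndicator T E' s := by
  classical
  intro t ht
  rw [h t ht]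
  exact if_congr (hE t ht) rfl rfl

theorem IsIndicator.of_same {T : ℕ} {E : Set ℕ} {s s' : AState} (h : IsIndicator T E s)
    (h8 : s'.arr 8 = s.arr 8) : IsIndicator T E s' := by
  unfold IsIndicator
  rw [h8]
  exact h

variable {M : Machine} {A : ℕ → ℕ} {m T D r k : ℕ} {s : AState}

theorem SumSetup.of_same' {s' : AState} (h : SumSetup M A m T D r k s) (hr : SameBelow 20 s s')
    (ha : s'.arr 0 = s.arr 0) : SumSetup M A m T D r k s' where
  toSetup := h.toSetup.of_same hr ha
  k_eq := (hr _ (by omega)).trans h.k_eq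
  Z_eq := (hr _ (by omega)).trans h.Z_eq
  B_eq := (hr _ (by omega)).trans h.B_eq
  one_lt := h.one_lt
  T_lt := h.T_lt
  k_lt := h.k_lt
  Z_lt := h.Z_lt
  B_lt := h.B_lt

/-- Computes the arrays of `HasCodes`. -/
def initCodes (r : ℕ) : ACmd := .seq (block [store 9 0 0, store 10 0 1]) (forLoop 22 9 (block [
  store 9 (reg 22) (reg 22 % reg 10 + const r * load 9 (reg 22 / reg 10)),
  store 10 (reg 22) (bin .lt (reg 22 % reg 10) (const r) * load 10 (reg 22 / reg 10))]))

/-- Marks zero and the coins in array `8`. -/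
def initSums : ACmd := .seq (forLoop 22 6 (store 8 (reg 22) 0)) (.seq (store 8 0 1)
  (forLoop 22 0 (store 8 (load 0 (reg 22)) 1)))

/-- Copies array `8` to the positions in array `11` whose digits are small. -/
def loadSums : ACmd := forLoop 22 9 (branch (load 10 (reg 22) * bin .lt (load 9 (reg 22)) (reg 6))
  (store 11 (reg 22) (load 8 (load 9 (reg 22)))) (store 11 (reg 22) 0))

/-- Squares all entries of array `11`. -/
def squareAll : ACmd := forLoop 22 9
  (store 11 (reg 22) (wbin .mul (load 11 (reg 22)) (load 11 (reg 22))))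

/-- Marks the values of the positions with nonzero entries in array `11`. -/
def storeSums : ACmd := forLoop 22 9 (branch (wbin .add (load 11 (reg 22)) 0)
  (branch (bin .lt (load 9 (reg 22)) (reg 6)) (store 8 (load 9 (reg 22)) 1) skip) skip)

/-- Replaces the set in array `8` by its sumset with itself. -/
def sumsetStep : ACmd := .seq loadSums (.seq (tensorTransform 13) (.seq squareAll
  (.seq (tensorTransform 14) storeSums)))

/-- Entries are computed by dropping the last digit, from c / (2r) < c. The exception is c = 0,
which refers to itself; it is therefore set before the loop, and its recomputation does not change
it. -/
theorem runs_initCodes (h : SumSetup M A m T D r k s) :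
    Runs M (initCodes r) s ((2 * r) ^ k * 70 + 40) (fun s' => SameBelow 20 s s' ∧
      SameArr [9, 10] s s' ∧ HasCodes r k s') := by
  classical
  have hB : 1 < 2 * r := by have := h.one_lt; omega
  have hM := M.two_le
  have hZ := h.Z_lt
  have hrL : r < M.L := by have := h.one_lt; have := h.B_lt; nlinarith
  refine (Runs.seq (B := 20) (B' := (2 * r) ^ k * (62 + 8) + 6) (Q := fun s' => SameBelow 20 s s' ∧
      SameArr [9, 10] s s' ∧ s'.arr 9 0 = 0 ∧ s'.arr 10 0 = 1) ?_ ?_).mono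
    (by omega) (fun _ h => h)
  · refine (Runs.of_wp ?_).mono (by decide) (fun _ h => h)
    simp
    omega
  · rintro s₁ ⟨hs₁, ha₁, h9, h10⟩
    refine Runs.forLoop (K := (2 * r) ^ k) (c := 62) (fun j s' => SameBelow 20 s s' ∧
      SameArr [9, 10] s s' ∧ ∀ c < max 1 j, s'.arr 9 c = rebase (2 * r) r c ∧
        s'.arr 10 c = if SmallDigits (2 * r) r c then 1 else 0) h.Z_lt ?_ ?_ ?_ ?_
    · refine ⟨by simpa using hs₁, by simpa using ha₁, fun c hc => ?_⟩
      obtain rfl : c = 0 := by omega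
      simp [h9, h10, rebase_zero, smallDigits_zero]
    · intro j s' _ hs
      rw [hs.1 9 (by omega), h.Z_eq]
    · rintro c s' hc h22 ⟨hs, ha, hj⟩
      have h10' : s'.reg 10 = 2 * r := (hs 10 (by omega)).trans h.B_eq
      have hdiv : c / (2 * r) ≤ c := Nat.div_le_self _ _
      have hlt : c / (2 * r) < max 1 c := by
        rcases Nat.eq_zero_or_pos c with rfl | hpos
        · simp
        · have := Nat.div_lt_self hpos hB; omega
      have hle : c % (2 * r) + r * rebase (2 * r) r (c / (2 * r)) ≤ c := by
        rw [← rebase_eq hB]; exact rebase_le hB (by omega) c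
      have hcL : c < M.L := hc.trans hZ
      refine (Runs.of_wp ?_).mono (Nat.le_of_ble_eq_true rfl) (fun _ h => h)
      have hne : c / (2 * r) = c → c = 0 := fun he => by
        by_contra h0
        have := Nat.div_lt_self (Nat.pos_of_ne_zero h0) hB; omega
      obtain ⟨e9, e10⟩ := hj _ hlt
      simp [h22, h10', hs, ha, e9, e10]
      refine ⟨by omega, by omega, ?_, hcL, fun x hx => ?_⟩
      · split_ifs <;> omega
      · by_cases hxc : x = c
        · subst hxc
          simp only [if_true]
          refine ⟨(rebase_eq hB x).symm, ?_⟩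
          rw [smallDigits_iff hB (by omega) x]
          split_ifs <;> simp_all
        · simp only [if_neg hxc]
          exact hj x (by omega)
    · rintro s' - ⟨hs, ha, hj⟩
      exact ⟨hs, ha, fun c hc => hj c (by omega)⟩

theorem runs_initSums (h : SumSetup M A m T D r k s) :
    Runs M initSums s (T * 30 + m * 40 + 60) (fun s' => SameBelow 20 s s' ∧
      SameArr [8] s s' ∧ IsIndicator T (sumLevel A m T 0) s') := by
  classical
  have hM := M.two_le
  have hL := h.lt_L
  refine (Runs.seq (B := (T + 1) * (10 + 8) + 6) (B' := m * 40 + 30) (Q := fun s' =>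
    SameBelow 20 s s' ∧ SameArr [8] s s' ∧ ∀ t < T + 1, s'.arr 8 t = 0) ?_ ?_).mono
    (by omega) (fun _ h => h)
  · refine Runs.forLoop (K := T + 1) (c := 10) (fun j s' => SameBelow 20 s s' ∧
      SameArr [8] s s' ∧ ∀ t < j, s'.arr 8 t = 0) (by omega) ?_ ?_ ?_ ?_
    · simp
    · intro j s' _ hs
      rw [hs.1 6 (by omega), h.inf_eq]
    · rintro j s' hj h22 ⟨hs, ha, hz⟩
      refine (Runs.of_wp ?_).mono (by decide) (fun _ h => h)
      simp [h22, hs, ha]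
      exact ⟨by omega, by omega, fun t ht hne => hz t (by omega)⟩
    · exact fun s' _ hs => hs
  · rintro s₁ ⟨hs₁, ha₁, hz⟩
    refine (Runs.seq (B := 15) (B' := m * (30 + 8) + 6) (Q := fun s' => s' = s₁.setArr 8 0 1)
      ?_ ?_).mono (by omega) (fun _ h => h)
    · refine (Runs.of_wp ?_).mono (by decide) (fun _ h => h)
      simp
      omega
    rintro _ rfl
    refine Runs.forLoop (K := m) (c := 30) (fun j s' => SameBelow 20 s s' ∧
      SameArr [8] s s' ∧ ∀ t ≤ T, s'.arr 8 t = if t = 0 ∨ ∃ i < j, t = A i then 1 else 0)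
      h.m_lt_L ?_ ?_ ?_ ?_
    · simp [hs₁, ha₁]
      intro t ht
      split_ifs
      · rfl
      · exact hz t (by omega)
    · intro j s' _ hs
      rw [hs.1 0 (by omega), h.m_eq]
    · rintro j s' hj h22 ⟨hs, ha, ht⟩
      have hS := h.of_same hs (ha 0 (by decide))
      have hm := h.m_lt_L
      have hc := h.coin_le hj
      refine (Runs.of_wp ?_).mono (by decide) (fun _ h => h)
      simp [h22, hs, ha, hS.coin_eq j hj]
      refine ⟨by omega, by omega, by omega, fun t htT => ?_⟩
      by_cases hta : t = A j
      · rw [if_pos hta, if_pos (.inr ⟨j, le_rfl, hta⟩)]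
      · rw [if_neg hta, ht t htT]
        refine if_congr (or_congr_right ⟨?_, ?_⟩) rfl rfl
        · rintro ⟨i, hi, he⟩; exact ⟨i, hi.le, he⟩
        · rintro ⟨i, hi, he⟩
          rcases hi.lt_or_eq with hi | rfl
          · exact ⟨i, hi, he⟩
          · exact absurd he hta
    · rintro s' - ⟨hs, ha, ht⟩
      refine ⟨hs, ha, fun t htT => ?_⟩
      rw [ht t htT]
      refine if_congr (or_congr_right ⟨?_, ?_⟩) rfl rfl
      · rintro ⟨i, hi, rfl⟩; exact ⟨i, hi, rfl⟩
      · rintro ⟨i, hi, rfl⟩; exact ⟨i, hi, rfl⟩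

open Classical in
theorem runs_loadSums (h : SumSetup M A m T D r k s) (hcodes : HasCodes r k s) {E : Set ℕ}
    (hE : IsIndicator T E s) (hET : ∀ e ∈ E, e ≤ T) :
    Runs M loadSums s ((2 * r) ^ k * 70 + 6) (fun s' => SameBelow 20 s s' ∧
      SameArr [11] s s' ∧ ∀ c < (2 * r) ^ k, s'.arr 11 c =
        if SmallDigits (2 * r) r c ∧ rebase (2 * r) r c ∈ E then 1 else 0) := by
  have hM := M.two_le
  have hL := h.lt_L
  refine Runs.forLoop (K := (2 * r) ^ k) (c := 62) (fun j s' => SameBelow 20 s s' ∧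
      SameArr [11] s s' ∧ ∀ c < j, s'.arr 11 c =
        if SmallDigits (2 * r) r c ∧ rebase (2 * r) r c ∈ E then 1 else 0) h.Z_lt ?_ ?_ ?_ ?_
  · simp
  · intro j s' _ hs
    rw [hs.1 9 (by omega), h.Z_eq]
  · rintro c s' hc h22 ⟨hs, ha, hj⟩
    have hS := h.of_same' hs (ha 0 (by decide))
    have hcL : c < M.L := hc.trans h.Z_lt
    obtain ⟨e9, e10⟩ := hcodes c hc
    have hE' := hE (rebase (2 * r) r c)
    have hET' := hET (rebase (2 * r) r c)
    have a9 : s'.arr 9 = s.arr 9 := ha 9 (by decide)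
    have a10 : s'.arr 10 = s.arr 10 := ha 10 (by decide)
    have a8 : s'.arr 8 = s.arr 8 := ha 8 (by decide)
    refine (Runs.of_wp ?_).mono (by decide) (fun _ h => h)
    simp [h22, hs, ha, hS.inf_eq, a8, a9, a10, e9, e10, hcL]
    have hfin : ∀ v, v = (if SmallDigits (2 * r) r c ∧ rebase (2 * r) r c ∈ E then 1 else 0) →
        ∀ y ≤ c, (if y = c then v else s'.arr 11 y) =
          if SmallDigits (2 * r) r y ∧ rebase (2 * r) r y ∈ E then 1 else 0 := by
      intro v hv y hy
      by_cases hyc : y = c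
      · rw [if_pos hyc, hyc, hv]
      · rw [if_neg hyc]; exact hj y (by omega)
    refine ⟨by split_ifs <;> omega, fun hx hsm => ⟨by omega, hfin _ ?_⟩,
      fun hns => ⟨by omega, hfin _ ?_⟩⟩
    · rw [hE' hx]; simp [hsm]
    · rw [if_neg]
      exact fun h => hns (hET' h.2) h.1
  · exact fun s' _ hs => hs

theorem runs_squareAll (h : SumSetup M A m T D r k s) :
    Runs M squareAll s ((2 * r) ^ k * 40 + 6) (fun s' => SameBelow 20 s s' ∧
      SameArr [11] s s' ∧ ∀ c < (2 * r) ^ k, (s'.arr 11 c : ZMod (2 ^ M.w)) =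
        s.arr 11 c * s.arr 11 c) := by
  refine Runs.forLoop (K := (2 * r) ^ k) (c := 32) (fun j s' => SameBelow 20 s s' ∧
      SameArr [11] s s' ∧ (∀ c ≥ j, s'.arr 11 c = s.arr 11 c) ∧ ∀ c < j,
        (s'.arr 11 c : ZMod (2 ^ M.w)) = s.arr 11 c * s.arr 11 c) h.Z_lt ?_ ?_ ?_ ?_
  · simp
  · intro j s' _ hs
    rw [hs.1 9 (by omega), h.Z_eq]
  · rintro c s' hc h22 ⟨hs, ha, hge, hj⟩
    have hcL : c < M.L := hc.trans h.Z_lt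
    refine (Runs.of_wp ?_).mono (by decide) (fun _ h => h)
    simp [h22, hs, ha, hcL, hge c le_rfl]
    refine ⟨fun x hx => ?_, fun x hx => ?_⟩
    · rw [if_neg (by omega)]; exact hge x (by omega)
    · by_cases hxc : x = c
      · subst hxc; simp [cast_apply_mul]
      · rw [if_neg hxc]; exact hj x (by omega)
  · exact fun s' _ hs => ⟨hs.1, hs.2.1, hs.2.2.2⟩

open Classical in
theorem runs_storeSums (h : SumSetup M A m T D r k s) (hcodes : HasCodes r k s) {E : Set ℕ}
    (hE : IsIndicator T E s) {N : ℕ → Prop}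
    (hN : ∀ c < (2 * r) ^ k, (s.arr 11 c : ZMod (2 ^ M.w)) = 0 ↔ ¬ N c) :
    Runs M storeSums s ((2 * r) ^ k * 70 + 6) (fun s' => SameBelow 20 s s' ∧
      SameArr [8] s s' ∧
      IsIndicator T (E ∪ {t | ∃ c < (2 * r) ^ k, N c ∧ rebase (2 * r) r c = t}) s') := by
  have hM := M.two_le
  have hL := h.lt_L
  refine Runs.forLoop (K := (2 * r) ^ k) (c := 62) (fun j s' => SameBelow 20 s s' ∧
      SameArr [8] s s' ∧ IsIndicator T (E ∪ {t | ∃ c < j, N c ∧ rebase (2 * r) r c = t}) s')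
      h.Z_lt ?_ ?_ ?_ ?_
  · simpa [IsIndicator] using hE
  · intro j s' _ hs
    rw [hs.1 9 (by omega), h.Z_eq]
  · rintro c s' hc h22 ⟨hs, ha, hj⟩
    have hS := h.of_same' hs (ha 0 (by decide))
    have hcL : c < M.L := hc.trans h.Z_lt
    obtain ⟨e9, -⟩ := hcodes c hc
    -- The array entry is known modulo 2^w only; adding 0 as a word operation reduces it, so that
    -- the branch tests vanishing modulo 2^w.
    have hword : WordRAM.Op.add.apply M.w (s.arr 11 c) 0 = 0 ↔ ¬ N c := by
      rw [← hN c hc, ZMod.natCast_eq_zero_iff]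
      simp [WordRAM.Op.apply, Nat.dvd_iff_mod_eq_zero]
    have a9 : s'.arr 9 = s.arr 9 := ha 9 (by decide)
    have a11 : s'.arr 11 = s.arr 11 := ha 11 (by decide)
    refine (Runs.of_wp ?_).mono (by decide) (fun _ h => h)
    simp [h22, hs, ha, hS.inf_eq, a9, a11, e9, hcL, hword]
    have hset : ∀ t, (∃ c' ≤ c, N c' ∧ rebase (2 * r) r c' = t) ↔
        (∃ c' < c, N c' ∧ rebase (2 * r) r c' = t) ∨ (N c ∧ rebase (2 * r) r c = t) := by
      intro t
      constructor
      · rintro ⟨c', hc', h1, h2⟩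
        rcases hc'.lt_or_eq with hc' | rfl
        · exact .inl ⟨c', hc', h1, h2⟩
        · exact .inr ⟨h1, h2⟩
      · rintro (⟨c', hc', h1, h2⟩ | ⟨h1, h2⟩)
        · exact ⟨c', hc'.le, h1, h2⟩
        · exact ⟨c, le_rfl, h1, h2⟩
    refine ⟨by omega, fun hNc => ⟨fun hx => ⟨by omega, by omega, fun t ht => ?_⟩,
      fun hx t ht => ?_⟩, fun hNc t ht => ?_⟩
    · simp only [AState.setReg_arr, AState.setArr_arr, if_true, Set.mem_union, Set.mem_ofPred_eq,
        hset]
      by_cases hxt : t = rebase (2 * r) r c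
      · rw [if_pos hxt, if_pos (.inr (.inr ⟨hNc, hxt.symm⟩))]
      · rw [if_neg hxt, hj t ht]
        simp [Ne.symm hxt]
    · rw [AState.setReg_arr, hj t ht]
      simp only [Set.mem_union, Set.mem_ofPred_eq, hset]
      have : rebase (2 * r) r c ≠ t := by omega
      simp [this]
    · rw [AState.setReg_arr, hj t ht]
      simp only [Set.mem_union, Set.mem_ofPred_eq, hset]
      simp [hNc]
  · exact fun s' _ hs => hs

theorem Setup.of_sameBelow {s' : AState} (h : Setup M A m T D s) (hr : SameBelow 12 s s')
    (ha : s'.arr 0 = s.arr 0) : Setup M A m T D s' where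
  coins := h.coins
  m_eq := (hr _ (by omega)).trans h.m_eq
  a_eq := (hr _ (by omega)).trans h.a_eq
  T_eq := (hr _ (by omega)).trans h.T_eq
  inf_eq := (hr _ (by omega)).trans h.inf_eq
  D_eq := (hr _ (by omega)).trans h.D_eq
  coin_eq := fun i hi => by rw [ha]; exact h.coin_eq i hi
  two_mul_le := h.two_mul_le
  lt_L := h.lt_L
  list_lt := h.list_lt

theorem HasMatrices.of_same {W : ℕ → ℕ → ℤ} {s' : AState} (h : HasMatrices M r W s)
    (h13 : s'.arr 13 = s.arr 13) (h14 : s'.arr 14 = s.arr 14) : HasMatrices M r W s' :=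
  ⟨by rw [h13]; exact h.1, by rw [h14]; exact h.2⟩

theorem HasCodes.of_same {s' : AState} (h : HasCodes r k s)
    (h9 : s'.arr 9 = s.arr 9) (h10 : s'.arr 10 = s.arr 10) : HasCodes r k s' := by
  unfold HasCodes
  rw [h9, h10]
  exact h

/-- The final array 11 holds d^k times the number of pairs, at most Z² for Z = (2r)^k, and `hdw`
keeps this below 2^w. Old marks in array 8 may stay, because 0 belongs to every level and hence E ⊆
E + E. -/
theorem runs_sumsetStep (h : SumSetup M A m T D r k s) (hcodes : HasCodes r k s)
    {W : ℕ → ℕ → ℤ} {d : ℤ} (hd : d ≠ 0) (hW : ∀ i < 2 * r, ∀ j < 2 * r,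
      ∑ l ∈ range (2 * r), W i l * (l : ℤ) ^ j = if i = j then d else 0)
    (hm : HasMatrices M r W s) (hdw : d.natAbs ^ k * ((2 * r) ^ k * (2 * r) ^ k) < 2 ^ M.w)
    {i : ℕ} (hE : IsIndicator T (sumLevel A m T i) s) :
    Runs M sumsetStep s (k * ((2 * r) ^ k * (r * 160 + 200) + 76) + (2 * r) ^ k * 180 + 34)
      (fun s' => SameBelow 20 s s' ∧ SameArr [8, 11, 12] s s' ∧
        IsIndicator T (sumLevel A m T (i + 1)) s') := by
  classical
  have hET : ∀ e ∈ sumLevel A m T i, e ≤ T :=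
    fun e he => le_of_mem_sumLevel (fun j hj => by have := h.coin_le hj; omega) he
  have hr := h.one_lt
  set E := sumLevel A m T i with hEdef
  set P : ℕ → Prop := fun c => SmallDigits (2 * r) r c ∧ rebase (2 * r) r c ∈ E with hP
  refine ((runs_loadSums h hcodes hE hET).seq (B' := k * (((2 * r) ^ k) * (r * 160 + 200) + 76) + ((2 * r) ^ k) * 110 + 28)
    ?_).mono (le_of_eq (by ring)) (fun _ h => h)
  rintro s₁ ⟨hs₁, ha₁, hf⟩
  have h₁ := h.of_same' hs₁ (ha₁ 0 (by decide))
  refine ((runs_tensorTransform (t := 13) (by decide) h₁.B_eq h₁.Z_eq h₁.k_eq h₁.Z_lt h₁.k_lt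
    h₁.B_lt (by omega)).seq (B' := k * (((2 * r) ^ k) * (r * 80 + 100) + 38) + ((2 * r) ^ k) * 110 + 20)
    ?_).mono (le_of_eq (by ring)) (fun _ h => h)
  rintro s₂ ⟨hs₂, ha₂, hv₂⟩
  have h₂ := h₁.of_same' hs₂ (ha₂ 0 (by decide))
  refine ((runs_squareAll h₂).seq (B' := k * (((2 * r) ^ k) * (r * 80 + 100) + 38) + ((2 * r) ^ k) * 70 + 14)
    ?_).mono (le_of_eq (by ring)) (fun _ h => h)
  rintro s₃ ⟨hs₃, ha₃, hv₃⟩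
  have h₃ := h₂.of_same' hs₃ (ha₃ 0 (by decide))
  refine ((runs_tensorTransform (t := 14) (by decide) h₃.B_eq h₃.Z_eq h₃.k_eq h₃.Z_lt h₃.k_lt
    h₃.B_lt (by omega)).seq (B' := ((2 * r) ^ k) * 70 + 6)
    ?_).mono (le_of_eq (by ring)) (fun _ h => h)
  rintro s₄ ⟨hs₄, ha₄, hv₄⟩
  have h₄ := h₃.of_same' hs₄ (ha₄ 0 (by decide))
  have harr : ∀ x, x ≠ 11 → x ≠ 12 → s₄.arr x = s.arr x := by
    intro x h11 h12
    rw [ha₄ x (by simp [h11, h12]), ha₃ x (by simp [h11]), ha₂ x (by simp [h11, h12]),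
      ha₁ x (by simp [h11])]
  have hE₄ : IsIndicator T E s₄ := hE.of_same (harr 8 (by decide) (by decide))
  have hWV : ∀ i < 2 * r, ∀ j < 2 * r, ∑ l ∈ range (2 * r), (W i l : ZMod (2 ^ M.w)) *
      (l : ZMod (2 ^ M.w)) ^ j = if i = j then (d : ZMod (2 ^ M.w)) else 0 := by
    intro i hi j hj
    have := congrArg (Int.cast : ℤ → ZMod (2 ^ M.w)) (hW i hi j hj)
    push_cast at this
    exact this
  have hval : ∀ c < ((2 * r) ^ k), (s₄.arr 11 c : ZMod (2 ^ M.w)) = (d : ZMod (2 ^ M.w)) ^ k *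
      (#(sumPairs ((2 * r) ^ k) P c) : ZMod (2 ^ M.w)) := by
    intro c hc
    rw [hv₄ c hc, transform_congr (V' := fun i j => (W i j : ZMod (2 ^ M.w)))
      (f' := fun c => (s₃.arr 11 c : ZMod (2 ^ M.w))) (by omega) ?_ (fun _ _ => rfl) hc]
    · refine transform_mul_self_transform (by omega) hWV P (fun c hc => hc.1)
        (f := fun c => (s₁.arr 11 c : ZMod (2 ^ M.w))) (fun c hc => ?_) (fun c hc => ?_) hc
      · rw [hf c hc]
        split_ifs <;> simp
      · rw [hv₃ c hc]
        rw [hv₂ c hc, transform_congr (V' := fun i j => (i : ZMod (2 ^ M.w)) ^ j)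
          (f' := fun c => (s₁.arr 11 c : ZMod (2 ^ M.w))) (by omega) ?_ (fun _ _ => rfl) hc]
        intro i hi j hj
        rw [ha₁ 13 (by decide)]
        exact hm.vandermonde i hi j hj
    · intro i hi j hj
      rw [ha₃ 14 (by decide), ha₂ 14 (by decide), ha₁ 14 (by decide)]
      exact hm.inverse i hi j hj
  refine (runs_storeSums h₄ (hcodes.of_same (harr 9 (by decide) (by decide))
    (harr 10 (by decide) (by decide))) hE₄ (N := fun c => #(sumPairs ((2 * r) ^ k) P c) ≠ 0) ?_).mono le_rfl ?_
  · intro c hc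
    rw [hval c hc]
    refine ⟨fun h0 hne => ?_, fun hne => ?_⟩
    · refine pow_mul_natCast_ne_zero hd hne (lt_of_le_of_lt ?_ hdw) h0
      exact Nat.mul_le_mul_left _ (card_sumPairs_le _ _ _)
    · rw [not_not.1 hne]; simp
  · rintro s₅ ⟨hs₅, ha₅, hi⟩
    refine ⟨((((hs₁.trans hs₂).trans hs₃).trans hs₄).trans hs₅), fun x hx => ?_,
      hi.congr fun t ht => ?_⟩
    · simp at hx
      rw [ha₅ x (by simp [hx]), harr x hx.2.1 hx.2.2]
    · rw [Set.mem_union, Set.mem_ofPred_eq, exists_sumPairs_iff hr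
        (fun e he => (hET e he).trans_lt h.T_lt) t P (fun c => Iff.rfl)]
      constructor
      · rintro (h0 | h0)
        · exact ⟨ht, t, h0, 0, zero_mem_sumLevel i, add_zero t⟩
        · exact ⟨ht, h0⟩
      · exact fun h0 => .inr h0.2

/-- Doubles the set in array `8` as often as register `11` says. -/
def doubleSums : ACmd := forLoop 19 11 sumsetStep

theorem runs_doubleSums (h : SumSetup M A m T D r k s) (hcodes : HasCodes r k s)
    {W : ℕ → ℕ → ℤ} {d : ℤ} (hd : d ≠ 0) (hW : ∀ i < 2 * r, ∀ j < 2 * r,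
      ∑ l ∈ range (2 * r), W i l * (l : ℤ) ^ j = if i = j then d else 0)
    (hm : HasMatrices M r W s) (hdw : d.natAbs ^ k * ((2 * r) ^ k * (2 * r) ^ k) < 2 ^ M.w)
    (hE : IsIndicator T (sumLevel A m T 0) s) {q : ℕ} (hq : s.reg 11 = q) (hqL : q < M.L) :
    Runs M doubleSums s
      (q * (k * ((2 * r) ^ k * (r * 160 + 200) + 76) + (2 * r) ^ k * 180 + 42) + 6)
      (fun s' => SameBelow 19 s s' ∧ SameArr [8, 11, 12] s s' ∧
        IsIndicator T (sumLevel A m T q) s') := by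
  refine Runs.forLoop (K := q)
    (c := k * ((2 * r) ^ k * (r * 160 + 200) + 76) + (2 * r) ^ k * 180 + 34)
    (fun j s' => SameBelow 19 s s' ∧ SameArr [8, 11, 12] s s' ∧
      IsIndicator T (sumLevel A m T j) s') hqL ?_ ?_ ?_ ?_
  · exact ⟨by simp, by simp, hE⟩
  · intro j s' _ hs
    rw [hs.1 11 (by omega), hq]
  · rintro j s' hj h19 ⟨hs, ha, hj'⟩
    have h' : SumSetup M A m T D r k s' := {
      toSetup := h.toSetup.of_sameBelow hs.mono (ha 0 (by decide))
      k_eq := (hs _ (by omega)).trans h.k_eq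
      Z_eq := (hs _ (by omega)).trans h.Z_eq
      B_eq := (hs _ (by omega)).trans h.B_eq
      one_lt := h.one_lt
      T_lt := h.T_lt
      k_lt := h.k_lt
      Z_lt := h.Z_lt
      B_lt := h.B_lt }
    refine (runs_sumsetStep h' (hcodes.of_same (ha 9 (by decide)) (ha 10 (by decide))) hd hW
      (hm.of_same (ha 13 (by decide)) (ha 14 (by decide))) hdw hj').mono le_rfl ?_
    rintro s'' ⟨hs'', ha'', hi⟩
    refine ⟨(hs'' 19 (by omega)).trans h19, ?_, ?_, hi⟩
    · simpa using hs.trans (hs''.mono (l' := 19))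
    · simpa using ha.trans ha''
  · exact fun s' _ hs => hs

/-- Enters the values marked in array `8` into the table. -/
def readTable : ACmd := forLoop 22 6 (branch (load 8 (reg 22)) (.seq (assign 23 (reg 22 % reg 1))
  (branch (bin .lt (reg 22) (load 1 (reg 23))) (store 1 (reg 23) (reg 22)) skip)) skip)

/-- Every residue has its Apéry value among the marked numbers up to T, so taking minima over these
is enough. -/
theorem runs_readTable (h : Setup M A m T D s) (hb : ∀ p < A 0, s.arr 1 p = if p = 0 then 0 else T + 1)
    (hE : IsIndicator T {t | t ∈ Feas A m} s) (hT : TableBound A m T) :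
    Runs M readTable s (T * 60 + 66) (fun s' => SameBelow 20 s s' ∧ SameArr [1] s s' ∧
      IsAperyTable A m (s'.arr 1)) := by
  classical
  have hM := M.two_le
  have hL := h.lt_L
  refine (Runs.forLoop (K := T + 1) (c := 52) (fun j s' => SameBelow 20 s s' ∧ SameArr [1] s s' ∧
    (∀ p < A 0, s'.arr 1 p = T + 1 ∨ s'.arr 1 p ∈ Feas A m ∧ s'.arr 1 p ≡ p [MOD A 0]) ∧
    ∀ t < j, t ∈ Feas A m → s'.arr 1 (t % A 0) ≤ t) (Q := fun s' => SameBelow 20 s s' ∧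
      SameArr [1] s s' ∧ IsAperyTable A m (s'.arr 1)) (by omega) ?_ ?_ ?_ ?_).mono (by omega)
      (fun _ h => h)
  · refine ⟨by simp, by simp, fun p hp => ?_, by simp⟩
    rw [AState.setReg_arr, hb p hp]
    split_ifs with h0
    · exact .inr ⟨zero_mem _, by rw [h0]⟩
    · exact .inl rfl
  · intro j s' _ hs
    rw [hs.1 6 (by omega), h.inf_eq]
  · rintro t s' ht h22 ⟨hs, ha, hg, hle⟩
    have hS := h.of_same hs (ha 0 (by decide))
    have a8 : s'.arr 8 = s.arr 8 := ha 8 (by decide)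
    have e8 := hE t (by omega)
    have hlt := h.mod_lt_L t
    refine (Runs.of_wp ?_).mono (by decide) (fun _ h => h)
    simp [h22, hs, ha, a8, e8, hS.a_eq]
    refine ⟨by omega, fun htf => ⟨by omega, fun htlt => ⟨by omega, fun p hp => ?_, fun x hx hxf => ?_⟩,
      fun hge => ⟨hg, fun x hx hxf => ?_⟩⟩, fun htf => ⟨hg, fun x hx hxf => ?_⟩⟩
    · by_cases hpt : p = t % A 0
      · rw [if_pos hpt, hpt]
        exact .inr ⟨htf, (Nat.mod_modEq _ _).symm⟩
      · rw [if_neg hpt]; exact hg p hp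
    · by_cases he : x % A 0 = t % A 0
      · rw [if_pos he]
        rcases hx.lt_or_eq with hx | rfl
        · have := hle x hx hxf; rw [he] at this; omega
        · exact le_rfl
      · rw [if_neg he]
        rcases hx.lt_or_eq with hx | rfl
        · exact hle x hx hxf
        · exact absurd rfl he
    · rcases hx.lt_or_eq with hx | rfl
      · exact hle x hx hxf
      · exact hge
    · rcases hx.lt_or_eq with hx | rfl
      · exact hle x hx hxf
      · exact absurd hxf htf
  · rintro s' - ⟨hs, ha, hg, hle⟩
    refine ⟨hs, ha, fun p hp => ?_⟩
    obtain ⟨v, hv, hvp, hvT⟩ := hT.exists_apery p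
    have h1 := hle v (by omega) hv.1
    have e : v % A 0 = p := by rw [hvp, Nat.mod_eq_of_lt hp]
    rw [e] at h1
    obtain ⟨hf, hmod⟩ := (hg p hp).resolve_left (by omega)
    have h2 := hv.2 _ hf (hmod.trans hvp.symm)
    rw [show s'.arr 1 p = v by omega]
    exact ⟨hv, hvp⟩

/-- The residue table by repeated doubling of sumsets. -/
def denseTable (r : ℕ) (W : ℕ → ℕ → ℤ) : ACmd :=
  .seq (storeTable 13 (fun n => ((n / (2 * r) : ℕ) : ℤ) ^ (n % (2 * r))) (2 * r * (2 * r)))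
  (.seq (storeTable 14 (fun n => W (n / (2 * r)) (n % (2 * r))) (2 * r * (2 * r)))
  (.seq (initCodes r) (.seq initSums (.seq doubleSums (.seq initTable readTable)))))

theorem runs_denseTable (h : SumSetup M A m T D r k s) (hT : TableBound A m T)
    {W : ℕ → ℕ → ℤ} {d : ℤ} (hd : d ≠ 0) (hW : ∀ i < 2 * r, ∀ j < 2 * r,
      ∑ l ∈ range (2 * r), W i l * (l : ℤ) ^ j = if i = j then d else 0)
    (hV : (2 * r) ^ (2 * r) < M.L) (hWL : ∀ i < 2 * r, ∀ j < 2 * r, (W i j).natAbs < M.L)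
    (hdw : d.natAbs ^ k * ((2 * r) ^ k * (2 * r) ^ k) < 2 ^ M.w)
    {q : ℕ} (hq : s.reg 11 = q) (hqL : q < M.L) (hqT : T ≤ 2 ^ q) :
    Runs M (denseTable r W) s (q * (k * ((2 * r) ^ k * (r * 160 + 200) + 76) + (2 * r) ^ k * 180 + 42)
      + (2 * r) ^ k * 70 + T * 150 + r * r * 88 + 210)
      (fun s' => SameBelow 19 s s' ∧ IsAperyTable A m (s'.arr 1)) := by
  have hr := h.one_lt
  have hB := h.B_lt
  have hBB : ∀ i < 2 * r, ∀ j < 2 * r, i * (2 * r) + j < 2 * r * (2 * r) := fun i hi j hj => by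
    calc _ < i * (2 * r) + 2 * r := by omega
      _ = (i + 1) * (2 * r) := by ring
      _ ≤ _ := Nat.mul_le_mul_right _ hi
  have hdiv : ∀ i < 2 * r, ∀ j < 2 * r, (i * (2 * r) + j) / (2 * r) = i ∧
      (i * (2 * r) + j) % (2 * r) = j := fun i hi j hj => by
    constructor
    · rw [mul_comm, Nat.mul_add_div (by omega), Nat.div_eq_of_lt hj, add_zero]
    · rw [mul_comm, Nat.mul_add_mod, Nat.mod_eq_of_lt hj]
  have hdivlt : ∀ n < 2 * r * (2 * r), n / (2 * r) < 2 * r ∧ n % (2 * r) < 2 * r := fun n hn =>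
    ⟨Nat.div_lt_of_lt_mul hn, Nat.mod_lt _ (by omega)⟩
  have hm2 := h.m_le
  have ha2 := h.a_le
  refine ((runs_storeTable 13 (fun n => ((n / (2 * r) : ℕ) : ℤ) ^ (n % (2 * r))) (2 * r * (2 * r))
    hB.le (fun n hn => ?_)).seq (B' := q * (k * ((2 * r) ^ k * (r * 160 + 200) + 76) +
      (2 * r) ^ k * 180 + 42) + (2 * r) ^ k * 70 + T * 150 + r * r * 44 + 209) ?_).mono
      (le_of_eq (by ring)) (fun _ h => h)
  · rw [Int.natAbs_pow, Int.natAbs_natCast]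
    obtain ⟨h1, h2⟩ := hdivlt n hn
    calc _ ≤ (2 * r) ^ (n % (2 * r)) := Nat.pow_le_pow_left h1.le _
      _ ≤ (2 * r) ^ (2 * r) := Nat.pow_le_pow_right (by omega) h2.le
      _ < _ := hV
  rintro s₁ ⟨hs₁, ha₁, hv₁⟩
  refine ((runs_storeTable 14 (fun n => W (n / (2 * r)) (n % (2 * r))) (2 * r * (2 * r))
    hB.le (fun n hn => hWL _ (hdivlt n hn).1 _ (hdivlt n hn).2)).seq
      (B' := q * (k * ((2 * r) ^ k * (r * 160 + 200) + 76) +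
      (2 * r) ^ k * 180 + 42) + (2 * r) ^ k * 70 + T * 150 + 208) ?_).mono
      (le_of_eq (by ring)) (fun _ h => h)
  rintro s₂ ⟨hs₂, ha₂, hv₂⟩
  have hsb₂ : SameBelow 20 s s₂ := fun x _ => by rw [hs₂, hs₁]
  have h₂ := h.of_same' hsb₂ (by rw [ha₂ 0 (by decide), ha₁ 0 (by decide)])
  have hm₂ : HasMatrices M r W s₂ := by
    constructor
    · intro i hi j hj
      rw [ha₂ 13 (by decide), hv₁ _ (hBB i hi j hj), (hdiv i hi j hj).1, (hdiv i hi j hj).2]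
      push_cast; rfl
    · intro i hi j hj
      rw [hv₂ _ (hBB i hi j hj), (hdiv i hi j hj).1, (hdiv i hi j hj).2]
  refine ((runs_initCodes h₂).seq (B' := q * (k * ((2 * r) ^ k * (r * 160 + 200) + 76) +
      (2 * r) ^ k * 180 + 42) + T * 150 + 168) ?_).mono (le_of_eq (by ring)) (fun _ h => h)
  rintro s₃ ⟨hs₃, ha₃, hc₃⟩
  have h₃ := h₂.of_same' hs₃ (ha₃ 0 (by decide))
  refine ((runs_initSums h₃).seq (B' := q * (k * ((2 * r) ^ k * (r * 160 + 200) + 76) +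
      (2 * r) ^ k * 180 + 42) + T * 100 + 108) ?_).mono (by omega) (fun _ h => h)
  rintro s₄ ⟨hs₄, ha₄, hE₄⟩
  have h₄ := h₃.of_same' hs₄ (ha₄ 0 (by decide))
  have hm₄ := (hm₂.of_same (ha₃ 13 (by decide)) (ha₃ 14 (by decide))).of_same
    (ha₄ 13 (by decide)) (ha₄ 14 (by decide))
  have hq₄ : s₄.reg 11 = q := by
    rw [hs₄ 11 (by omega), hs₃ 11 (by omega), hsb₂ 11 (by omega), hq]
  refine ((runs_doubleSums h₄ (hc₃.of_same (ha₄ 9 (by decide)) (ha₄ 10 (by decide))) hd hW hm₄ hdw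
    hE₄ hq₄ hqL).seq (B' := T * 100 + 102) ?_).mono (by omega) (fun _ h => h)
  rintro s₅ ⟨hs₅, ha₅, hE₅⟩
  have h₅ : Setup M A m T D s₅ := h₄.toSetup.of_sameBelow hs₅.mono (ha₅ 0 (by decide))
  refine ((runs_initTable h₅).seq (B' := T * 60 + 66) ?_).mono (by omega) (fun _ h => h)
  rintro s₆ ⟨hs₆, ha₆, hb₆⟩
  have h₆ := h₅.of_same hs₆ (ha₆ 0 (by decide))
  refine (runs_readTable h₆ hb₆ ?_ hT).mono le_rfl ?_
  · refine (hE₅.of_same (ha₆ 8 (by decide))).congr fun t ht => ⟨mem_feas_of_mem_sumLevel, fun hf => ?_⟩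
    exact h.coins.mem_sumLevel hf ht (ht.trans hqT)
  · rintro s₇ ⟨hs₇, -, hap⟩
    refine ⟨?_, hap⟩
    exact ((((hsb₂.trans hs₃).trans hs₄).mono (l' := 19)).trans hs₅).trans
      ((hs₆.trans hs₇).mono (l' := 19))

end ArrayRAM

/-! ### The parameters of the algorithm -/

open Finset

namespace ArrayRAM

open AExpr ACmd

variable {M : Machine} {A : ℕ → ℕ} {m T D : ℕ} {s : AState}

/-- Computes the number of base `b` digits of register `x` in register `κ`, and a power of `2 * b`
with that exponent in register `9`. -/
def powers (b x κ : ℕ) : ACmd := .seq (block [assign κ 0, assign 13 1, assign 9 1])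
  (.loop (bin .eq (bin .lt (reg x) (reg 13)) 0) (block [assign κ (reg κ + 1),
    assign 13 (reg 13 * const b), assign 9 (reg 9 * const (2 * b))]))

/-- The loop stops at the first power of b above X. For b = 2 the exponent is the binary length; for
b = r it is the number of digits, and register 9 is the size of the transform. -/
theorem runs_powers {b x κ X : ℕ} (hb : 2 ≤ b) (hx : s.reg x = X) (hX : X ≠ 0)
    (hne : x ≠ κ ∧ x ≠ 13 ∧ x ≠ 9 ∧ κ ≠ 13 ∧ κ ≠ 9) (hL : X * X * (2 * b) < M.L) :
    Runs M (powers b x κ) s (Nat.log b X * 40 + 80) (fun s' => s'.arr = s.arr ∧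
      (∀ i, i ≠ κ → i ≠ 13 → i ≠ 9 → s'.reg i = s.reg i) ∧ s'.reg κ = Nat.log b X + 1 ∧
      s'.reg 9 = (2 * b) ^ (Nat.log b X + 1)) := by
  obtain ⟨n1, n2, n3, n4, n5⟩ := hne
  have hM := M.two_le
  have hX1 : 1 ≤ X := Nat.pos_of_ne_zero hX
  have hbL : 2 * b < M.L := (Nat.le_mul_of_pos_left _ (by positivity)).trans_lt hL
  refine (Runs.seq (B := 8) (B' := Nat.log b X * 40 + 72) (Q := fun s' => s'.arr = s.arr ∧
      (∀ i, i ≠ κ → i ≠ 13 → i ≠ 9 → s'.reg i = s.reg i) ∧ s'.reg κ = 0 ∧ s'.reg 13 = 1 ∧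
      s'.reg 9 = 1) ?_ ?_).mono (by omega) (fun _ h => h)
  · refine (Runs.of_wp ?_).mono (Nat.le_of_ble_eq_true rfl) (fun _ h => h)
    simp [n4, n5]
    refine ⟨by omega, by omega, fun i h1 h2 h3 => by simp [h1, h2, h3]⟩
  · rintro s₁ ⟨ha, hr, hκ, h13, h9⟩
    refine Runs.loop (fun β s' => ∃ j ≤ Nat.log b X + 1, s'.arr = s.arr ∧
      (∀ i, i ≠ κ → i ≠ 13 → i ≠ 9 → s'.reg i = s.reg i) ∧ s'.reg κ = j ∧ s'.reg 13 = b ^ j ∧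
      s'.reg 9 = (2 * b) ^ j ∧ (Nat.log b X + 1 - j) * 36 + 10 ≤ β) ?_
      ⟨0, by omega, ha, hr, hκ, by simpa using h13, by simpa using h9, by omega⟩
    rintro β s' ⟨j, hj, ha, hr, hκ, h13, h9, hβ⟩
    have hxs : s'.reg x = X := (hr x n1 n2 n3).trans hx
    have hiff : X < b ^ j ↔ j = Nat.log b X + 1 := by
      rw [← Nat.log_lt_iff_lt_pow hb hX]; omega
    refine ⟨by simp; omega, ?_⟩
    rcases hj.lt_or_eq with hj | rfl
    · right
      have hle : b ^ j ≤ X := by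
        by_contra hlt
        have := hiff.1 (by omega); omega
      refine ⟨by simp [hxs, h13, hle], 26, (Nat.log b X + 1 - (j + 1)) * 36 + 10, ?_, ?_⟩
      · simp only [AExpr.cost]; omega
      · have hjX : j < X := (Nat.lt_pow_self (by omega)).trans_le hle
        have hXL : X < M.L := ((Nat.le_mul_self X).trans (Nat.le_mul_of_pos_right _ (by omega))).trans_lt hL
        have h2j : 2 ^ j ≤ b ^ j := Nat.pow_le_pow_left hb j
        have hP : b ^ j * b < M.L := (Nat.mul_le_mul (hle.trans (Nat.le_mul_self X)) (by omega)).trans_lt hL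
        -- As long as b^j ≤ X, also 2^j ≤ X, so (2b)^j ≤ X².
        have hZ : (2 * b) ^ j * (2 * b) < M.L := by
          rw [mul_pow]
          calc 2 ^ j * b ^ j * (2 * b) ≤ X * X * (2 * b) :=
                Nat.mul_le_mul_right _ (Nat.mul_le_mul (h2j.trans hle) hle)
            _ < M.L := hL
        refine (Runs.of_wp ?_).mono (Nat.le_of_ble_eq_true rfl) (fun _ h => h)
        simp [n4, n5, n4.symm, n5.symm, hκ, h13, h9, ha]
        exact ⟨⟨by omega, by omega⟩, ⟨by omega, hP⟩, ⟨by omega, hZ⟩, by omega,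
          fun i h1 h2 h3 => by simp [h1, h2, h3, hr], by ring, by ring, by omega⟩
    · left
      have := hiff.2 rfl
      refine ⟨by simp [hxs, h13, this], by simp only [AExpr.cost]; omega, ha, hr, hκ, h9⟩

/-- Computes the rounded up square root of register `2` in register `4`. -/
def ceilSqrt : ACmd := .seq (assign 4 0) (.loop (bin .lt (reg 4 * reg 4) (reg 2))
  (assign 4 (reg 4 + 1)))

/-- Counting upwards is affordable because a time linear in N is negligible. The last clause
expresses that the root is minimal. -/
theorem runs_ceilSqrt {N : ℕ} (h2 : s.reg 2 = N) (hL : (N + 1) * (N + 1) < M.L) :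
    Runs M ceilSqrt s (N * 10 + 30) (fun s' => s'.arr = s.arr ∧
      (∀ i, i ≠ 4 → s'.reg i = s.reg i) ∧ N ≤ s'.reg 4 * s'.reg 4 ∧
      ∀ j < s'.reg 4, j * j < N) := by
  have hM := M.two_le
  refine (Runs.seq (B := 2) (B' := N * 10 + 28) (Q := fun s' => s' = s.setReg 4 0) ?_ ?_).mono
    (by omega) (fun _ h => h)
  · refine (Runs.of_wp ?_).mono (Nat.le_of_ble_eq_true rfl) (fun _ h => h)
    simp; omega
  rintro _ rfl
  refine Runs.loop (fun β s' => s'.arr = s.arr ∧ (∀ i, i ≠ 4 → s'.reg i = s.reg i) ∧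
      (∀ j < s'.reg 4, j * j < N) ∧ (N - s'.reg 4) * 10 + 20 ≤ β ∧ s'.reg 4 ≤ N) ?_
      ⟨rfl, fun i hi => by simp [hi], by simp, by simp, by simp⟩
  rintro β s' ⟨ha, hr, hj, hβ, hle⟩
  have h2' : s'.reg 2 = N := (hr 2 (by decide)).trans h2
  set x := s'.reg 4 with hx
  have hxx : x * x < M.L := by nlinarith
  have hNL : N + 1 < M.L := by nlinarith
  refine ⟨by simpa [← hx] using hxx, ?_⟩
  by_cases hlt : x * x < N
  · right
    have hxN : x < N := by nlinarith
    refine ⟨by simp [← hx, h2', hlt], 4, (N - (x + 1)) * 10 + 20, ?_, ?_⟩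
    · simp only [AExpr.cost]; omega
    · refine (Runs.of_wp ?_).mono (Nat.le_of_ble_eq_true rfl) (fun _ h => h)
      simp [← hx, ha]
      refine ⟨by omega, fun i hi => by simp [hi, hr], fun j hjx => ?_, by omega⟩
      rcases (Nat.lt_succ_iff_lt_or_eq.1 (show j < x + 1 by omega)) with h | rfl
      · exact hj j h
      · exact hlt
  · left
    refine ⟨by simp [← hx, h2', hlt], by simp only [AExpr.cost]; omega, ha, hr, by omega, hj⟩

/-- Marks all coins as heavy. -/
def allHeavy : ACmd := forLoop 20 0 (store 6 (reg 20) 1)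

/-- The residue table by closure under all coins. -/
def sparseTable : ACmd := .seq allHeavy (.seq initTable closeHeavy)

/-- If all coins are heavy, zero is the only pure value, so the initial table already satisfies the
hypotheses of `isAperyTable_of_heavyClosure`. -/
theorem runs_sparseTable (h : Setup M A m T D s) (hT : TableBound A m T) :
    Runs M sparseTable s (m * (300 * A 0 + 200) + A 0 * 40 + 60)
      (fun s' => SameBelow 20 s s' ∧ IsAperyTable A m (s'.arr 1)) := by
  refine (Runs.seq (B := m * (12 + 8) + 6) (B' := m * (300 * A 0 + 180) + A 0 * 40 + 50)
    (Q := fun s' => SameBelow 20 s s' ∧ SameArr [6] s s' ∧ ∀ c < m, s'.arr 6 c ≠ 0) ?_ ?_).mono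
    (by ring_nf; omega) (fun _ h => h)
  · refine Runs.forLoop (K := m) (c := 12) (fun j s' => SameBelow 20 s s' ∧ SameArr [6] s s' ∧
      ∀ c < j, s'.arr 6 c ≠ 0) h.m_lt_L ?_ ?_ ?_ ?_
    · simp
    · intro j s' _ hs
      rw [hs.1 0 (by omega), h.m_eq]
    · rintro j s' hj h20 ⟨hs, ha, hc⟩
      have := h.m_lt_L
      have hM := M.two_le
      refine (Runs.of_wp ?_).mono (by decide) (fun _ h => h)
      simp [h20, hs, ha]
      refine ⟨by omega, by omega, fun c hcj => ?_⟩
      split_ifs with hne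
      · simp
      · exact hc c (by omega)
    · exact fun s' _ hs => hs
  rintro s₁ ⟨hs₁, ha₁, h6⟩
  have h₁ := h.of_same hs₁ (ha₁ 0 (by decide))
  refine ((runs_initTable h₁).seq (B' := m * (300 * A 0 + 180) + 10) ?_).mono
    (by omega) (fun _ h => h)
  rintro s₂ ⟨hs₂, ha₂, hb⟩
  have h₂ := h₁.of_same hs₂ (ha₂ 0 (by decide))
  have h6₂ : s₂.arr 6 = s₁.arr 6 := ha₂ 6 (by decide)
  refine (runs_closeHeavy h₂ fun p hp => by rw [hb p hp]; split_ifs <;> omega).mono ?_ ?_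
  · have : #{c ∈ range m | s₂.arr 6 c ≠ 0} ≤ m := (card_filter_le _ _).trans (by simp)
    have := Nat.mul_le_mul_right (300 * A 0 + 120) this
    have e : m * (300 * A 0 + 180) = m * (300 * A 0 + 120) + m * 60 := by ring
    omega
  · rintro s₃ ⟨hs₃, ha₃, hc⟩
    refine ⟨(hs₁.trans hs₂).trans hs₃, isAperyTable_of_heavyClosure h.coins hT
      (fun p hp => ?_) (fun v hv hp hvT => ?_) hc⟩
    · rw [hb p hp]
      split_ifs with h0
      · exact .inr ⟨zero_mem _, by rw [h0]⟩
      · exact .inl rfl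
    · rcases feas_cases hv.1 with rfl | ⟨i, hi, u, hu, rfl⟩
      · rw [Nat.zero_mod, hb 0 h.coins.pos, if_pos rfl]
      · exact absurd rfl (hp i hi (by rw [h6₂]; exact h6 i hi) u hu)

/-- The residue table by a scan over the light coins and a closure under the heavy coins. -/
def scanTable : ACmd := .seq initPairs (.seq pairMin (.seq classify (.seq initTable
  (.seq initCoins (.seq scan (.seq (store 1 0 0) closeHeavy))))))

/-- H bounds the number of heavy coins, since each of them covers D residues of its own. -/
theorem runs_scanTable (h : Setup M A m T D s) (hT : TableBound A m T) {H : ℕ}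
    (hH : ∀ x, x * D ≤ A 0 → x ≤ H) :
    Runs M scanTable s (m * m * 230 + m * 300 + T * 60 + A 0 * (D * 80 + 220) +
        H * (300 * A 0 + 120) + 150)
      (fun s' => SameBelow 20 s s' ∧ IsAperyTable A m (s'.arr 1)) := by
  have hL := h.lt_L
  refine ((runs_initPairs h).seq (B' := m * m * 230 + m * 300 + T * 60 + A 0 * (D * 80 + 180) +
    H * (300 * A 0 + 120) + 140) ?_).mono (le_of_eq (by ring)) (fun _ h => h)
  rintro s₁ ⟨hs₁, ha₁, hp₁⟩
  have h₁ := h.of_same hs₁ (ha₁ 0 (by decide))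
  refine ((runs_pairMin h₁ fun p hp => (hp₁ p hp).1).seq (B' := m * m * 160 + m * 286 + T * 60 +
    A 0 * (D * 80 + 180) + H * (300 * A 0 + 120) + 134) ?_).mono (le_of_eq (by ring))
    (fun _ h => h)
  rintro s₂ ⟨hs₂, ha₂, hpm⟩
  have h₂ := h₁.of_same hs₂ (ha₂ 0 (by decide))
  refine ((runs_classify h₂ fun p hp => by rw [ha₂ 3 (by decide)]; exact (hp₁ p hp).2).seq
    (B' := m * 206 + T * 60 + A 0 * (D * 80 + 180) + H * (300 * A 0 + 120) + 128) ?_).mono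
    (le_of_eq (by ring)) (fun _ h => h)
  rintro s₃ ⟨hs₃, ha₃, hcl⟩
  have h₃ := h₂.of_same hs₃ (ha₃ 0 (by decide))
  refine ((runs_initTable h₃).seq (B' := m * 206 + T * 60 + A 0 * (D * 80 + 140) +
    H * (300 * A 0 + 120) + 98) ?_).mono (le_of_eq (by ring)) (fun _ h => h)
  rintro s₄ ⟨hs₄, ha₄, hb₄⟩
  have h₄ := h₃.of_same hs₄ (ha₄ 0 (by decide))
  refine ((runs_initCoins h₄ hb₄).seq (B' := m * 136 + T * 60 + A 0 * (D * 80 + 140) +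
    H * (300 * A 0 + 120) + 92) ?_).mono (le_of_eq (by ring)) (fun _ h => h)
  rintro s₅ ⟨hs₅, ha₅, hg₅, hr₅⟩
  have h₅ := h₄.of_same hs₅ (ha₅ 0 (by decide))
  have a6 : s₅.arr 6 = s₄.arr 6 := ha₅ 6 (by decide)
  have e (x : Fin 16) (h1 : x ≠ 1) (h7 : x ≠ 7) : s₅.arr x = s₃.arr x := by
    rw [ha₅ x (by simp [h1, h7]), ha₄ x (by simp [h1])]
  have hcl₅ : IsClassified A m D m (s₅.arr 2) (s₅.arr 3) (s₅.arr 4) (s₅.arr 5) (s₅.arr 6) := by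
    rw [e 2 (by decide) (by decide), e 3 (by decide) (by decide), e 4 (by decide) (by decide),
      e 5 (by decide) (by decide), e 6 (by decide) (by decide)]
    exact hcl
  have hpm₅ : IsPairMin A m (T + 1) (s₅.arr 2) := by
    rw [e 2 (by decide) (by decide), ha₃ 2 (by decide)]
    exact hpm
  rw [← a6] at hg₅ hr₅
  refine ((runs_scan h₅ hpm₅ hcl₅ hg₅ hr₅).seq (B' := m * 40 + H * (300 * A 0 + 120) + 20) ?_).mono
    (by ring_nf; omega) (fun _ h => h)
  rintro s₆ ⟨hs₆, ha₆, hg₆, hr₆⟩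
  have h₆ := h₅.of_same hs₆ (ha₆ 0 (by decide))
  -- `IsGood` and `IsReached` do not record the entry of residue zero, whose Apéry value 0 has no
  -- last coin; it is written again instead of being tracked.
  refine (Runs.seq (B := 10) (B' := m * 40 + H * (300 * A 0 + 120) + 6)
    (Q := fun s' => s' = s₆.setArr 1 0 0) ?_ ?_).mono (by omega) (fun _ h => h)
  · refine (Runs.of_wp ?_).mono (by decide) (fun _ h => h)
    simp
    omega
  rintro _ rfl
  have h₇ : Setup M A m T D (s₆.setArr 1 0 0) := h₆.of_same (by simp) rfl
  have a6' : (s₆.setArr 1 0 0).arr 6 = s₅.arr 6 := by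
    rw [← ha₆ 6 (by decide)]; simp [AState.setArr_arr_fun]
  have hv (p : ℕ) : (s₆.setArr 1 0 0).arr 1 p = if p = 0 then 0 else s₆.arr 1 p := by simp
  refine (runs_closeHeavy h₇ fun p hp => ?_).mono ?_ ?_
  · have := (hg₆ p hp).1
    rw [hv]; split_ifs <;> omega
  · have := Nat.mul_le_mul_right (300 * A 0 + 120) (hH _ hcl₅.card_heavy_mul_le)
    rw [a6']
    omega
  · rintro s₇ ⟨hs₇, ha₇, hc⟩
    refine ⟨((((((hs₁.trans hs₂).trans hs₃).trans hs₄).trans hs₅).trans hs₆).trans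
      (show SameBelow 20 s₆ s₇ from hs₇)),
      isAperyTable_of_heavyClosure h.coins hT (fun p hp => ?_) (fun v hv' hp hvT => ?_) hc⟩
    · rw [hv]
      split_ifs with h0
      · exact .inr ⟨zero_mem _, by rw [h0]⟩
      · by_cases hinf : s₆.arr 1 p = T + 1
        · exact .inl hinf
        · exact .inr (hg₆.mem_feas hp hinf)
    · rw [a6'] at hp
      rw [hv]
      split_ifs with h0
      · exact Nat.zero_le _
      · have hpos : 0 < v := Nat.pos_of_ne_zero fun h => h0 (by rw [h, Nat.zero_mod])
        have hrv : IsReached A m (s₅.arr 6) v (s₆.arr 1) :=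
          fun w hw hpw l hl u hu hut => hr₆ w hw hpw l hl u hu (by omega)
        exact (hrv.eq h.coins hg₆ hv' hp hpos hvT).le

end ArrayRAM

/-! ### The running time -/

open Finset

namespace TableCost

theorem size_eq_log {N : ℕ} (hN : N ≠ 0) : N.size = Nat.log 2 N + 1 :=
  le_antisymm (Nat.size_le.2 (Nat.lt_pow_succ_log_self (by decide) N))
    (Nat.lt_size.2 (Nat.pow_log_le_self 2 hN))

theorem exists_size_pow_le (e : ℕ) : ∃ K, ∀ N, N ≠ 0 → N.size ^ e ≤ K * N := by
  have h := tendsto_pow_const_div_const_pow_of_one_lt e (r := (2 : ℝ)) (by norm_num)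
  obtain ⟨b, hb⟩ := h.bddAbove_range
  refine ⟨2 * ⌈b⌉₊, fun N hN => ?_⟩
  have h1 : ((N.size : ℝ) ^ e) / 2 ^ N.size ≤ b := hb ⟨N.size, rfl⟩
  rw [div_le_iff₀ (by positivity)] at h1
  have h2 : N.size ^ e ≤ ⌈b⌉₊ * 2 ^ N.size := by
    have : ((N.size ^ e : ℕ) : ℝ) ≤ ((⌈b⌉₊ * 2 ^ N.size : ℕ) : ℝ) := by
      push_cast
      exact h1.trans (mul_le_mul_of_nonneg_right (Nat.le_ceil b) (by positivity))
    exact_mod_cast this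
  have h3 : 2 ^ N.size ≤ 2 * N := by
    rw [size_eq_log hN, pow_succ']
    exact Nat.mul_le_mul_left _ (Nat.pow_log_le_self 2 hN)
  calc _ ≤ ⌈b⌉₊ * 2 ^ N.size := h2
    _ ≤ ⌈b⌉₊ * (2 * N) := Nat.mul_le_mul_left _ h3
    _ = _ := by ring

variable {N m l S T Y : ℕ}

/-- Costs are compared by their squares, which keeps the square root of N³ l inside natural number
arithmetic. -/
theorem le_mul_of_sq_le {t c Q : ℕ} (hY : Q ≤ Y * Y) (h : t * t ≤ c * c * Q) : t ≤ c * Y := by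
  refine Nat.mul_self_le_mul_self_iff.1 (h.trans ?_)
  calc c * c * Q ≤ c * c * (Y * Y) := Nat.mul_le_mul_left _ hY
    _ = _ := by ring

theorem self_le (hN : 1 ≤ N) (hl : 1 ≤ l) (hY : N ^ 3 * l ≤ Y * Y) : N ≤ Y := by
  have := le_mul_of_sq_le (t := N) (c := 1) hY (by
    calc N * N ≤ N * N * (N * l) := Nat.le_mul_of_pos_right _ (by positivity)
      _ = _ := by ring)
  omega

theorem mul_le_of_sq_le (h : m * m ≤ N * l) (hY : N ^ 3 * l ≤ Y * Y) : m * N ≤ Y := by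
  have := le_mul_of_sq_le (t := m * N) (c := 1) hY (by
    calc m * N * (m * N) = m * m * (N * N) := by ring
      _ ≤ N * l * (N * N) := Nat.mul_le_mul_right _ h
      _ = _ := by ring)
  omega

theorem bound_mul_le (hm : m ≤ N) (hT : T = 12 * (N / m + 1) * l * N) :
    T * m ≤ 24 * (N * N * l) := by
  have h1 : (N / m + 1) * m ≤ 2 * N := by
    rw [add_one_mul]; have := Nat.div_mul_le_self N m; omega
  calc T * m = 12 * ((N / m + 1) * m) * (l * N) := by rw [hT]; ring
    _ ≤ 12 * (2 * N) * (l * N) := Nat.mul_le_mul_right _ (Nat.mul_le_mul_left _ h1)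
    _ = _ := by ring

/-- Since T m ≤ 24 N² l, the condition m² ≥ N l gives T² ≤ 24² N³ l; below this threshold scanning
up to T would be too slow. -/
theorem bound_le (hN : 1 ≤ N) (hl : 1 ≤ l) (hm : m ≤ N) (hT : T = 12 * (N / m + 1) * l * N)
    (h : N * l ≤ m * m) (hY : N ^ 3 * l ≤ Y * Y) : T ≤ 24 * Y := by
  refine le_mul_of_sq_le hY (Nat.le_of_mul_le_mul_right ?_ (show 0 < N * l by positivity))
  calc T * T * (N * l) ≤ T * T * (m * m) := Nat.mul_le_mul_left _ h
    _ = T * m * (T * m) := by ring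
    _ ≤ 24 * (N * N * l) * (24 * (N * N * l)) := Nat.mul_self_le_mul_self (bound_mul_le hm hT)
    _ = _ := by ring

theorem ceilSqrt_sq_le (hN : 1 ≤ N) (hS : ∀ j < S, j * j < N) : S * S ≤ 4 * N := by
  rcases Nat.lt_or_ge S 2 with h | h
  · interval_cases S <;> omega
  · obtain ⟨x, rfl⟩ : ∃ x, S = x + 1 := ⟨S - 1, by omega⟩
    have := hS x (by omega)
    nlinarith

theorem mul_ceilSqrt_le (hN : 1 ≤ N) (hl : 1 ≤ l) (hS : ∀ j < S, j * j < N)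
    (hY : N ^ 3 * l ≤ Y * Y) : N * S ≤ 2 * Y := by
  refine le_mul_of_sq_le hY ?_
  calc N * S * (N * S) = N * N * (S * S) := by ring
    _ ≤ N * N * (4 * N) := Nat.mul_le_mul_left _ (ceilSqrt_sq_le hN hS)
    _ ≤ N * N * (4 * N) * l := Nat.le_mul_of_pos_right _ hl
    _ = _ := by ring

/-- With m² ≥ N S and S² ≥ N this says that T is O(N^(5/4) l), written as a fourth power to avoid
roots. -/
theorem bound_pow_le (hN : 1 ≤ N) (hm : m ≤ N) (hT : T = 12 * (N / m + 1) * l * N)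
    (h : N * S ≤ m * m) (hS : N ≤ S * S) : T ^ 4 ≤ 576 ^ 2 * N ^ 5 * l ^ 4 := by
  have h1 : T * T * S ≤ 576 * N ^ 3 * (l * l) := by
    refine Nat.le_of_mul_le_mul_right ?_ hN
    calc T * T * S * N = T * T * (N * S) := by ring
      _ ≤ T * T * (m * m) := Nat.mul_le_mul_left _ h
      _ = T * m * (T * m) := by ring
      _ ≤ 24 * (N * N * l) * (24 * (N * N * l)) := Nat.mul_self_le_mul_self (bound_mul_le hm hT)
      _ = _ := by ring
  refine Nat.le_of_mul_le_mul_right ?_ hN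
  calc T ^ 4 * N ≤ T ^ 4 * (S * S) := Nat.mul_le_mul_left _ hS
    _ = T * T * S * (T * T * S) := by ring
    _ ≤ 576 * N ^ 3 * (l * l) * (576 * N ^ 3 * (l * l)) := Nat.mul_self_le_mul_self h1
    _ = _ := by ring

/-- Doubling the base costs a factor 2 per digit. Since r = 2^8, all these factors together
contribute only an eighth root of T, up to constants. -/
theorem dense_size_pow_le {r : ℕ} (hr : r = 2 ^ 8) (hT : T ≠ 0) :
    ((2 * r) ^ (Nat.log r T + 1)) ^ 8 ≤ (2 * r) ^ 8 * T ^ 9 := by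
  have h1 := Nat.pow_log_le_self r hT
  have h2 : (2 ^ Nat.log r T) ^ 8 = r ^ Nat.log r T := by rw [hr, ← pow_mul, ← pow_mul, mul_comm]
  calc ((2 * r) ^ (Nat.log r T + 1)) ^ 8
      = (2 * r) ^ 8 * ((2 ^ Nat.log r T) ^ 8 * (r ^ Nat.log r T) ^ 8) := by
        rw [show (2 * r) ^ (Nat.log r T + 1) = 2 * r * (2 ^ Nat.log r T * r ^ Nat.log r T) by
          rw [pow_succ, mul_pow 2 r (Nat.log r T)]; ring]
        ring
    _ ≤ (2 * r) ^ 8 * (T * T ^ 8) := by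
        rw [h2]
        exact Nat.mul_le_mul_left _ (Nat.mul_le_mul h1 (Nat.pow_le_pow_left h1 8))
    _ = _ := by ring

/-- After taking 32nd powers the left side is O(N^45 l^100), where 100 = 64 + 36 comes from the two
factors l and from T^36. The right side is at least N^48 l^16, and N absorbs l^100. -/
theorem dense_cost_le {c d K Z : ℕ} (hN : 1 ≤ N) (hl : 1 ≤ l) (hZ : Z ^ 8 ≤ c * T ^ 9)
    (hT : T ^ 4 ≤ d * N ^ 5 * l ^ 4) (hK : l ^ 100 ≤ K * N) (hY : N ^ 3 * l ≤ Y * Y) :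
    l * l * Z ≤ (c ^ 4 * d ^ 9 * K) * Y := by
  refine le_of_pow_le_pow_left₀ (n := 32) (by decide) (Nat.zero_le _) ?_
  have h1 : Z ^ 32 ≤ c ^ 4 * (d * N ^ 5 * l ^ 4) ^ 9 := by
    calc Z ^ 32 = (Z ^ 8) ^ 4 := by rw [← pow_mul]
      _ ≤ (c * T ^ 9) ^ 4 := Nat.pow_le_pow_left hZ 4
      _ = c ^ 4 * (T ^ 4) ^ 9 := by ring
      _ ≤ _ := Nat.mul_le_mul_left _ (Nat.pow_le_pow_left hT 9)
  have h2 : N ^ 46 ≤ Y ^ 32 := by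
    calc N ^ 46 ≤ N ^ 46 * (N ^ 2 * l ^ 16) := Nat.le_mul_of_pos_right _ (by positivity)
      _ = (N ^ 3 * l) ^ 16 := by ring
      _ ≤ (Y * Y) ^ 16 := Nat.pow_le_pow_left hY 16
      _ = Y ^ 32 := by ring
  calc (l * l * Z) ^ 32 = l ^ 64 * Z ^ 32 := by ring
    _ ≤ l ^ 64 * (c ^ 4 * (d * N ^ 5 * l ^ 4) ^ 9) := Nat.mul_le_mul_left _ h1
    _ = c ^ 4 * d ^ 9 * N ^ 45 * l ^ 100 := by ring
    _ ≤ c ^ 4 * d ^ 9 * N ^ 45 * (K * N) := Nat.mul_le_mul_left _ hK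
    _ = c ^ 4 * d ^ 9 * K * N ^ 46 := by ring
    _ ≤ c ^ 4 * d ^ 9 * K * Y ^ 32 := Nat.mul_le_mul_left _ h2
    _ ≤ (c ^ 4 * d ^ 9 * K) ^ 32 * Y ^ 32 := Nat.mul_le_mul_right _ (Nat.le_self_pow (by decide) _)
    _ = _ := by ring

theorem size_bound_le (hN : 1 ≤ N) (hT : T = 12 * (N / m + 1) * N.size * N) :
    T.size ≤ 8 * N.size := by
  have h1 : N < 2 ^ N.size := Nat.lt_size_self N
  have h2 : N.size < 2 ^ N.size := Nat.lt_two_pow_self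
  have h3 : N / m ≤ N := Nat.div_le_self _ _
  have h4 : 1 ≤ N.size := Nat.size_pos.2 hN
  have h5 : T < 2 ^ (4 + N.size + N.size + N.size) := by
    rw [hT, pow_add, pow_add, pow_add]
    calc 12 * (N / m + 1) * N.size * N ≤ 12 * 2 ^ N.size * 2 ^ N.size * N := by gcongr; omega
      _ < 2 ^ 4 * 2 ^ N.size * 2 ^ N.size * 2 ^ N.size := by
        refine Nat.mul_lt_mul_of_le_of_lt ?_ h1 (by positivity)
        gcongr
        norm_num
  have := Nat.size_le.2 h5
  omega

end TableCost

/-! ### Choice of the algorithm and total cost. -/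

namespace ArrayRAM

open AExpr ACmd TableCost

variable {M : Machine} {A : ℕ → ℕ} {m T D N : ℕ} {s : AState}

/-- Computes the parameters of the algorithm from the numbers in registers `0`, `1`, `2`. -/
def setParams : ACmd := .seq (powers 2 2 3) (.seq ceilSqrt (block [
  assign 5 (12 * (reg 2 / reg 0 + 1) * reg 3 * reg 2), assign 6 (reg 5 + 1)]))

/-- Computes the parameters of the sumset computation. -/
def setSumParams (r : ℕ) : ACmd := .seq (powers 2 5 11) (.seq (powers r 5 8)
  (block [assign 10 (const (2 * r)), assign 7 0]))

/-- Chooses the algorithm by the number of coins. -/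
def residueTable (r : ℕ) (W : ℕ → ℕ → ℤ) : ACmd := .seq setParams
  (branch (bin .lt (reg 2 * reg 3) (reg 0 * reg 0))
    (branch (bin .lt (reg 2 * reg 4) (reg 0 * reg 0))
      (.seq (setSumParams r) (denseTable r W))
      (.seq (assign 7 (reg 4)) scanTable))
    (.seq (assign 7 0) sparseTable))

theorem runs_setParams (h0 : s.reg 0 = m) (h2 : s.reg 2 = N) (hN : 1 ≤ N)
    (hT : T = 12 * (N / m + 1) * N.size * N) (hL : (T + 2) * (T + 2) < M.L) :
    Runs M setParams s (N * 50 + 150) (fun s' => s'.arr = s.arr ∧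
      (∀ i < 3, s'.reg i = s.reg i) ∧ s'.reg 3 = N.size ∧ N ≤ s'.reg 4 * s'.reg 4 ∧
      (∀ j < s'.reg 4, j * j < N) ∧ s'.reg 5 = T ∧ s'.reg 6 = T + 1) := by
  have hM := M.two_le
  have hl : 1 ≤ N.size := Nat.size_pos.2 hN
  have hT1 : 12 * (N / m + 1) ≤ 12 * (N / m + 1) * N.size := Nat.le_mul_of_pos_right _ hl
  have hT2 : 12 * (N / m + 1) * N.size ≤ T := by rw [hT]; exact Nat.le_mul_of_pos_right _ hN
  have hNT : 12 * N ≤ T := by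
    rw [hT]
    exact Nat.mul_le_mul_right _ ((Nat.le_mul_of_pos_right 12 (Nat.succ_pos _)).trans hT1)
  have hTL : T + 2 < M.L := (Nat.le_mul_self _).trans_lt hL
  refine ((runs_powers (b := 2) (x := 2) (κ := 3) le_rfl h2 (by omega) (by decide) ?_).seq
    (B' := N * 10 + 65) ?_).mono ?_ (fun _ h => h)
  · nlinarith
  · rintro s₁ ⟨ha₁, hr₁, h3, -⟩
    refine ((runs_ceilSqrt ((hr₁ 2 (by decide) (by decide) (by decide)).trans h2)
      (by nlinarith)).seq (B' := 35) ?_).mono (by omega) (fun _ h => h)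
    rintro s₂ ⟨ha₂, hr₂, hle, hlt⟩
    have hr (i : ℕ) (hi : i < 3) : s₂.reg i = s.reg i := by
      rw [hr₂ i (by omega), hr₁ i (by omega) (by omega) (by omega)]
    have e0 := (hr 0 (by decide)).trans h0
    have e2 := (hr 2 (by decide)).trans h2
    have e3 : s₂.reg 3 = N.size := by rw [hr₂ 3 (by decide), h3, size_eq_log (by omega)]
    refine (Runs.of_wp ?_).mono (Nat.le_of_ble_eq_true rfl) (fun _ h => h)
    simp [e0, e2, e3, ha₁, ha₂]
    rw [← hT]
    exact ⟨⟨⟨⟨by omega, ⟨by omega, by omega⟩, by omega⟩, by omega⟩, by omega⟩, ⟨by omega, by omega⟩,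
      fun i hi => by rw [if_neg (by omega), if_neg (by omega), hr i hi], hle, hlt, rfl⟩
  · have := Nat.log_lt_self 2 (show N ≠ 0 by omega)
    omega

theorem runs_setSumParams {r : ℕ} (hr : 2 ≤ r) (h5 : s.reg 5 = T) (hT : 1 ≤ T)
    (hL : T * T * (2 * r) < M.L) :
    Runs M (setSumParams r) s (T.size * 80 + 200) (fun s' => s'.arr = s.arr ∧
      (∀ i < 7, s'.reg i = s.reg i) ∧ s'.reg 7 = 0 ∧ s'.reg 8 = Nat.log r T + 1 ∧
      s'.reg 9 = (2 * r) ^ (Nat.log r T + 1) ∧ s'.reg 10 = 2 * r ∧ s'.reg 11 = T.size) := by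
  have hM := M.two_le
  have hsz := size_eq_log (show T ≠ 0 by omega)
  refine ((runs_powers (b := 2) (x := 5) (κ := 11) le_rfl h5 (by omega) (by decide) ?_).seq
    (B' := T.size * 40 + 120) ?_).mono (by omega) (fun _ h => h)
  · exact (Nat.mul_le_mul_left _ (by omega)).trans_lt hL
  rintro s₁ ⟨ha₁, hr₁, h11, -⟩
  refine ((runs_powers (b := r) (x := 5) (κ := 8) hr ((hr₁ 5 (by decide) (by decide)
    (by decide)).trans h5) (by omega) (by decide) hL).seq (B' := 10) ?_).mono ?_ (fun _ h => h)
  · rintro s₂ ⟨ha₂, hr₂, h8, h9⟩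
    have h2r : 2 * r < M.L := (Nat.le_mul_of_pos_left _ (by positivity)).trans_lt hL
    refine (Runs.of_wp ?_).mono (Nat.le_of_ble_eq_true rfl) (fun _ h => h)
    simp [h8, h9, ha₁, ha₂, h2r]
    refine ⟨by omega, fun i hi => ?_, ?_⟩
    · rw [if_neg (by omega), if_neg (by omega), hr₂ i (by omega) (by omega) (by omega),
        hr₁ i (by omega) (by omega) (by omega)]
    · rw [hr₂ 11 (by decide) (by decide) (by decide), h11, hsz]
  · have := Nat.log_anti_left (b := r) (c := 2) (n := T) (by omega) hr
    omega

theorem sparse_cost_le {Y : ℕ} (hA : A 0 ≤ N) (hNY : N ≤ Y) (hY1 : 1 ≤ Y) (hm : m * N ≤ Y)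
    (hmN : m ≤ N) : m * (300 * A 0 + 200) + A 0 * 40 + 60 ≤ 600 * Y := by
  have h1 : m * (300 * A 0) ≤ 300 * (m * N) := by
    calc m * (300 * A 0) ≤ m * (300 * N) := by gcongr
      _ = _ := by ring
  rw [mul_add]
  omega

/-- The threshold S balances the two parts: the lists cost `A 0 * S`, the heavy coins about `A 0 / S
* N ≤ A 0 / S * S² ≤ A 0 * S`, and N S is O(Y). -/
theorem scan_cost_le {Y S : ℕ} (hA : A 0 ≤ N) (hNY : N ≤ Y) (hY1 : 1 ≤ Y) (hS : N * S ≤ 2 * Y)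
    (hNS : N ≤ S * S) (hm : m * m ≤ N * S) (hmN : m ≤ N) (hT : T ≤ 24 * Y) :
    m * m * 230 + m * 300 + T * 60 + A 0 * (S * 80 + 220) + A 0 / S * (300 * A 0 + 120) + 150 ≤
      5000 * Y := by
  have h1 : A 0 * S ≤ N * S := Nat.mul_le_mul_right _ hA
  have h2 : A 0 / S * N ≤ 2 * Y := by
    calc A 0 / S * N ≤ A 0 / S * (S * S) := Nat.mul_le_mul_left _ hNS
      _ = A 0 / S * S * S := by ring
      _ ≤ A 0 * S := Nat.mul_le_mul_right _ (Nat.div_mul_le_self _ _)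
      _ ≤ _ := h1.trans hS
  have h3 : A 0 / S * (300 * A 0) ≤ 300 * (A 0 / S * N) := by
    calc A 0 / S * (300 * A 0) ≤ A 0 / S * (300 * N) := by gcongr
      _ = _ := by ring
  have h4 : A 0 / S ≤ A 0 := Nat.div_le_self _ _
  have e1 : A 0 * (S * 80 + 220) = 80 * (A 0 * S) + 220 * A 0 := by ring
  rw [e1, mul_add]
  omega

theorem dense_cost_le {Y r k q l Z K : ℕ} (hT : T ≤ 24 * Y) (hl : 1 ≤ l) (hq : q ≤ 8 * l)
    (hk : k ≤ 8 * l) (hZ : 1 ≤ Z) (hY1 : 1 ≤ Y) (hK : l * l * Z ≤ K * Y) :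
    q * (k * (Z * (r * 160 + 200) + 76) + Z * 180 + 42) + Z * 70 + T * 150 + r * r * 88 + 210 ≤
      (64 * (r * 160 + 500) * K + 70 * K + r * r * 88) * Y + 4000 * Y := by
  have hZl : Z ≤ l * Z := Nat.le_mul_of_pos_left _ hl
  have hZll : l * Z ≤ l * l * Z := by rw [mul_assoc]; exact Nat.le_mul_of_pos_left _ hl
  have h1 : Z * (r * 160 + 200) + 76 ≤ Z * (r * 160 + 276) := by
    rw [mul_add, mul_add]; omega
  have h3 : k * (Z * (r * 160 + 200) + 76) ≤ 8 * l * (Z * (r * 160 + 276)) :=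
    Nat.mul_le_mul hk h1
  have h2 : k * (Z * (r * 160 + 200) + 76) + Z * 180 + 42 ≤ 8 * (l * Z * (r * 160 + 500)) := by
    have e1 : 8 * (l * Z * (r * 160 + 500)) = 1280 * (l * Z * r) + 4000 * (l * Z) := by ring
    have e2 : 8 * l * (Z * (r * 160 + 276)) = 1280 * (l * Z * r) + 2208 * (l * Z) := by ring
    rw [e1]
    rw [e2] at h3
    generalize k * (Z * (r * 160 + 200) + 76) = a at *
    generalize l * Z * r = b at *
    omega
  have h4 := Nat.mul_le_mul hq h2
  have h5 : 64 * (r * 160 + 500) * (l * l * Z) ≤ 64 * (r * 160 + 500) * (K * Y) :=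
    Nat.mul_le_mul_left _ hK
  have h6 : r * r * 88 ≤ r * r * 88 * Y := Nat.le_mul_of_pos_right _ hY1
  rw [show 8 * l * (8 * (l * Z * (r * 160 + 500))) = 64 * (r * 160 + 500) * (l * l * Z) by ring]
    at h4
  rw [show (64 * (r * 160 + 500) * K + 70 * K + r * r * 88) * Y =
    64 * (r * 160 + 500) * (K * Y) + 70 * (K * Y) + r * r * 88 * Y by ring]
  have h7 := h4.trans h5
  clear h1 h2 h3 h4 h5
  generalize q * (k * (Z * (r * 160 + 200) + 76) + Z * 180 + 42) = a at *
  generalize 64 * (r * 160 + 500) * (K * Y) = b at *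
  generalize K * Y = c at *
  generalize r * r * 88 * Y = d at *
  generalize r * r * 88 = e at *
  omega

-- One constant C serves all inputs and word sizes. It is chosen from r and the constant K for l^100
-- ≤ K N before the machine, the coins and the matrix W are introduced; the list length D is S for
-- the scan and 0 in the other two cases.
set_option maxHeartbeats 1000000 in
theorem exists_runs_residueTable {r : ℕ} (hr : r = 2 ^ 8) : ∃ C, ∀ (M : Machine) (A : ℕ → ℕ)
    (m N T Y : ℕ) (s : AState) (W : ℕ → ℕ → ℤ) (d : ℤ), CoinSystem A m → A (m - 1) = N →
    s.reg 0 = m → s.reg 1 = A 0 → s.reg 2 = N → (∀ i < m, s.arr 0 i = A i) →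
    T = 12 * (N / m + 1) * N.size * N → (T + 2) * (T + 2) * (4 * r) < M.L →
    2 * r * (2 * r) < M.L → (2 * r) ^ (2 * r) < M.L →
    (∀ i < 2 * r, ∀ j < 2 * r, (W i j).natAbs < M.L) → d ≠ 0 →
    (∀ i < 2 * r, ∀ j < 2 * r, ∑ l ∈ range (2 * r), W i l * (l : ℤ) ^ j =
      if i = j then d else 0) →
    d.natAbs ^ (Nat.log r T + 1) * ((2 * r) ^ (Nat.log r T + 1) * (2 * r) ^ (Nat.log r T + 1)) <
      2 ^ M.w → N ^ 3 * N.size ≤ Y * Y →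
    Runs M (residueTable r W) s (C * Y) (fun s' => s'.reg 1 = A 0 ∧
      IsAperyTable A m (s'.arr 1)) := by
  obtain ⟨K, hK⟩ := exists_size_pow_le 100
  set K' := ((2 * r) ^ 8) ^ 4 * (576 ^ 2) ^ 9 * K with hK'
  set Q := 64 * (r * 160 + 500) * K' + 70 * K' + r * r * 88 with hQ
  refine ⟨Q + 12000, ?_⟩
  intro M A m N T Y s W d hA hAN h0 h1 h2 hcoin hT hL hB hV hWL hd hW hdw hY
  have hr2 : 2 ≤ r := by rw [hr]; norm_num
  clear_value K' Q
  have hM := M.two_le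
  have hm0 := hA.size_pos
  have hmN : m ≤ N := hAN ▸ hA.size_le_last
  have hN : 1 ≤ N := by omega
  have hl : 1 ≤ N.size := Nat.size_pos.2 hN
  have hAle : A 0 ≤ N := hAN ▸ hA.le_last hm0
  have hNY := self_le hN hl hY
  have hlN : N.size ≤ N := by
    rw [size_eq_log (by omega)]; exact Nat.log_lt_self 2 (by omega)
  have hNT : 12 * N ≤ T := by
    rw [hT]
    refine Nat.mul_le_mul_right _ ((Nat.le_mul_of_pos_right 12 (Nat.succ_pos (N / m))).trans ?_)
    exact Nat.le_mul_of_pos_right _ hl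
  have hTT : (T + 2) * (T + 2) < M.L := (Nat.le_mul_of_pos_right _ (by omega)).trans_lt hL
  have hTT8 : (T + 2) * (T + 2) * 8 < M.L := (Nat.mul_le_mul_left _ (by omega)).trans_lt hL
  have hT4 : 4 * T + 10 < M.L := lt_of_le_of_lt (show 4 * T + 10 ≤ (T + 2) * 2 * 8 by omega)
    (lt_of_le_of_lt (Nat.mul_le_mul_right _ (Nat.mul_le_mul_left _ (by omega))) hTT8)
  have hTb : TableBound A m T := by have := hA.tableBound; rwa [hAN, ← hT] at this
  refine ((runs_setParams h0 h2 hN hT hTT).seq (B' := (Q * Y + 11500 * Y)) ?_).mono (by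
      rw [add_mul]; omega) (fun _ h => h)
  rintro s₁ ⟨ha, hreg, h3, hS, hSlt, h5, h6⟩
  have e0 := (hreg 0 (by decide)).trans h0
  have e1 := (hreg 1 (by decide)).trans h1
  have e2 := (hreg 2 (by decide)).trans h2
  generalize hSdef : s₁.reg 4 = S at hS hSlt
  have hSN : S ≤ N := by
    by_contra hlt
    have := hSlt N (by omega)
    nlinarith
  have hsetup : ∀ (D : ℕ) (s' : AState), D ≤ N → s'.arr = s₁.arr → (∀ i < 7, s'.reg i = s₁.reg i) →
      s'.reg 7 = D → Setup M A m T D s' := by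
    intro D s' hD ha' hr' h7
    exact {
      coins := hA
      m_eq := (hr' 0 (by decide)).trans e0
      a_eq := (hr' 1 (by decide)).trans e1
      T_eq := (hr' 5 (by decide)).trans h5
      inf_eq := (hr' 6 (by decide)).trans h6
      D_eq := h7
      coin_eq := fun i hi => by rw [ha', ha, hcoin i hi]
      two_mul_le := by omega
      lt_L := hT4
      list_lt := lt_of_le_of_lt (Nat.mul_le_mul (by omega) (by omega)) hTT }
  have hNN : ∀ x ≤ N, N * x < M.L := fun x hx =>
    lt_of_le_of_lt (Nat.mul_le_mul (by omega) (by omega)) hTT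
  have hmm : m * m < M.L := lt_of_le_of_lt (Nat.mul_le_mul (by omega) (by omega)) hTT
  have hassign : ∀ (e : AExpr) (D : ℕ), e.Safe M s₁ → e.eval M s₁ = D → e.cost ≤ 1 → D ≤ N →
      Runs M (assign 7 e) s₁ 2 (fun s' => Setup M A m T D s') := by
    intro e D he hev hc hD
    refine (Runs.of_wp (p := assign 7 e) ⟨he, ?_⟩).mono (by simp only [ACmd.cost]; omega)
      (fun _ h => h)
    exact hsetup D _ hD rfl (fun i hi => by rw [AState.setReg_reg, if_neg (by omega)])
      (by rw [AState.setReg_reg, if_pos rfl, hev])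
  refine (Runs.branch (B := (Q * Y + 11400 * Y)) ?_
    (fun hc => ?_) (fun hc => ?_)).mono (by
      have : (bin .lt (reg 2 * reg 3) (reg 0 * reg 0)).cost = 7 := rfl
      omega) (fun _ h => h)
  · simpa [e0, e2, h3] using ⟨hNN _ hlN, hmm⟩
  · have hlm : N * N.size < m * m := by simpa [e0, e2, h3] using hc
    have hTY := bound_le hN hl hmN hT hlm.le hY
    refine (Runs.branch (B := (Q * Y + 11300 * Y)) ?_
      (fun hc => ?_) (fun hc => ?_)).mono (by
        have : (bin .lt (reg 2 * reg 4) (reg 0 * reg 0)).cost = 7 := rfl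
        omega) (fun _ h => h)
    · simpa [e0, e2, hSdef] using ⟨hNN _ hSN, hmm⟩
    · have hSm : N * S < m * m := by simpa [e0, e2, hSdef] using hc
      have hTr : T * T * (2 * r) < M.L := by
        refine lt_of_le_of_lt (Nat.mul_le_mul (Nat.mul_le_mul ?_ ?_) ?_) hL <;> omega
      have hTs := size_bound_le hN hT
      refine ((runs_setSumParams hr2 h5 (by omega) hTr).seq
        (B' := (Q * Y + 4000 * Y)) ?_).mono (by
        omega) (fun _ h => h)
      rintro s₂ ⟨ha₂, hr₂, h7, h8, h9, h10, h11⟩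
      have hlogle := Nat.pow_log_le_self r (show T ≠ 0 by omega)
      have h2log : 2 ^ Nat.log r T ≤ r ^ Nat.log r T := Nat.pow_le_pow_left hr2 _
      have hsum : SumSetup M A m T 0 r (Nat.log r T + 1) s₂ := {
        toSetup := hsetup 0 s₂ (by omega) ha₂ hr₂ h7
        k_eq := h8
        Z_eq := h9
        B_eq := h10
        one_lt := hr2
        T_lt := Nat.lt_pow_succ_log_self (by omega) T
        k_lt := by
          have := Nat.log_lt_self r (show T ≠ 0 by omega)
          omega
        Z_lt := by
          refine lt_of_le_of_lt ?_ hTr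
          rw [pow_succ, mul_pow]
          exact Nat.mul_le_mul_right _ (Nat.mul_le_mul (h2log.trans hlogle) hlogle)
        B_lt := hB }
      have hksz : Nat.log r T + 1 ≤ T.size := by
        rw [size_eq_log (show T ≠ 0 by omega)]
        have := Nat.log_anti_left (b := r) (c := 2) (n := T) (by omega) hr2
        omega
      have hdense := TableCost.dense_cost_le (d := 576 ^ 2) hN hl
        (dense_size_pow_le hr (show T ≠ 0 by omega)) (bound_pow_le hN hmN hT hSm.le hS)
        (hK N (by omega)) hY
      rw [← hK'] at hdense
      refine (runs_denseTable hsum hTb hd hW hV hWL hdw h11 ?_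
        (Nat.lt_size_self T).le).mono ?_ ?_
      · have : T.size ≤ T := by
          rw [size_eq_log (by omega)]; exact Nat.log_lt_self 2 (by omega)
        omega
      · exact dense_cost_le hTY hl hTs (hksz.trans hTs) (Nat.one_le_pow _ _ (by omega)) (by omega)
          hdense |>.trans (by rw [← hQ])
      · rintro s₃ ⟨hs₃, hap⟩
        exact ⟨by rw [hs₃ 1 (by decide), hr₂ 1 (by decide), e1], hap⟩
    · have hSm : m * m ≤ N * S := by simpa [e0, e2, hSdef] using hc
      refine ((hassign (reg 4) S trivial hSdef le_rfl hSN).seq (B' := 5000 * Y) ?_).mono (by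
        omega) (fun _ h => h)
      rintro s₂ hs₂
      have hS0 : 0 < S := by
        rcases Nat.eq_zero_or_pos S with rfl | h
        · omega
        · exact h
      refine (runs_scanTable hs₂ hTb (H := A 0 / S) fun x hx => (Nat.le_div_iff_mul_le hS0).2 hx).mono
        (scan_cost_le hAle hNY (by omega) (mul_ceilSqrt_le hN hl hSlt hY) hS hSm hmN hTY) ?_
      rintro s₃ ⟨hs₃, hap⟩
      exact ⟨by rw [hs₃ 1 (by decide), hs₂.a_eq], hap⟩
  · have hlm : m * m ≤ N * N.size := by simpa [e0, e2, h3] using hc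
    refine ((hassign 0 0 (by simp; omega) rfl le_rfl (by omega)).seq (B' := 600 * Y) ?_).mono (by
        omega) (fun _ h => h)
    rintro s₂ hs₂
    refine (runs_sparseTable hs₂ hTb).mono
      (sparse_cost_le hAle hNY (by omega) (mul_le_of_sq_le hlm hY) hmN) ?_
    rintro s₃ ⟨hs₃, hap⟩
    exact ⟨by rw [hs₃ 1 (by decide), hs₂.a_eq], hap⟩

end ArrayRAM

/-! ### The word RAM program -/

open Finset

namespace WordRAM

/-- Copies the input to array `0` of the array view. -/
def copyIn : Cmd := .loop (.bin .lt (.reg 30) (.reg 1)) (.seq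
  (.store (.bin .add (.reg 0) (.bin .mul (.const 16) (.reg 30))) (.load (.reg 30)))
  (.assign 30 (.bin .add (.reg 30) (.const 1))))

/-- Copies array `1` of the array view to the start of the memory, from index register `31` on. -/
def copyOut : Cmd := .loop (.bin .lt (.reg 31) (.reg 2)) (.seq
  (.store (.reg 31) (.load (.bin .add (.bin .add (.reg 0) (.bin .mul (.const 16) (.reg 31)))
    (.const 1))))
  (.assign 31 (.bin .add (.reg 31) (.const 1))))

/-- Loads the number of coins, the first coin, the last coin and the base address. -/
def loadParams : Cmd := .seq (.assign 1 (.reg 0))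
  (.seq (.assign 3 (.load (.bin .sub (.reg 1) (.const 1))))
  (.seq (.assign 2 (.load (.const 0))) (.assign 0 (.bin .add (.reg 3) (.const 1)))))

variable {w base m : ℕ} {s : State}

/-- All writes go to addresses from base on and the input lies below base, so no input cell is
overwritten before it is read. -/
theorem exec_copyIn (hfit : base + 16 * (m + 1) ≤ 2 ^ w) (hm : m ≤ base) (h0 : s.reg 0 = base)
    (h1 : s.reg 1 = m) (h30 : s.reg 30 = 0) (hmem : ∀ a, s.mem a < 2 ^ w) :
    ∃ t s', Exec w copyIn s t s' ∧ t ≤ m * 20 + 10 ∧ (∀ r, r ≠ 30 → s'.reg r = s.reg r) ∧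
      s'.reg 30 < 2 ^ w ∧ (∀ j < m, s'.mem (base + 16 * j) = s.mem j) ∧ ∀ a, s'.mem a < 2 ^ w := by
  refine ArrayRAM.exec_loop (fun b s' => ∃ j ≤ m, (∀ r, r ≠ 30 → s'.reg r = s.reg r) ∧
    s'.reg 30 = j ∧ (∀ i < j, s'.mem (base + 16 * i) = s.mem i) ∧
    (∀ i < base, s'.mem i = s.mem i) ∧ (∀ a, s'.mem a < 2 ^ w) ∧ (m - j) * 20 + 10 ≤ b) _ ?_ _ _
    ⟨0, Nat.zero_le _, fun _ _ => rfl, h30, by simp, fun _ _ => rfl, hmem, by omega⟩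
  rintro b s' ⟨j, hj, hr, h30, hi, hlow, hlt, hb⟩
  have e0 := (hr 0 (by decide)).trans h0
  have e1 := (hr 1 (by decide)).trans h1
  rcases hj.lt_or_eq with hj | rfl
  · right
    have haddr : (Expr.bin .add (.reg 0) (.bin .mul (.const 16) (.reg 30))).eval w s' =
        base + 16 * j := by
      simp only [Expr.eval, Op.apply, e0, h30]
      rw [Nat.mod_eq_of_lt (show 16 < 2 ^ w by omega), Nat.mod_eq_of_lt (show 16 * j < 2 ^ w by omega),
        Nat.mod_eq_of_lt (by omega)]
    have hl : (Expr.load (.reg 30)).eval w s' = s'.mem j := by simp [Expr.eval, h30]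
    refine ⟨?_, _, _, (m - (j + 1)) * 20 + 10, .seq (.store _ _ _) (.assign _ _ _),
      ⟨j + 1, hj, ?_, ?_, ?_, ?_, ?_, le_rfl⟩, ?_⟩
    · simp only [Expr.eval, Op.apply, e1, h30, if_pos hj]
      rw [Nat.mod_eq_of_lt (by omega)]; decide
    · intro r hr'
      simp [Function.update_of_ne hr', hr r hr']
    · simp only [Function.update_self, Expr.eval, Op.apply, h30]
      rw [Nat.mod_eq_of_lt (show 1 < 2 ^ w by omega), Nat.mod_eq_of_lt (by omega)]
    · intro i hij
      simp only [haddr, hl]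
      by_cases he : i = j
      · subst he; rw [Function.update_self, hlow i (by omega)]
      · rw [Function.update_of_ne (by omega), hi i (by omega)]
    · intro i hi'
      simp only [haddr]
      rw [Function.update_of_ne (by omega), hlow i hi']
    · intro a
      simp only [haddr, hl]
      by_cases he : a = base + 16 * j
      · rw [he, Function.update_self]; exact hlt _
      · rw [Function.update_of_ne he]; exact hlt a
    · simp only [Expr.cost]; omega
  · left
    refine ⟨by simp [Expr.eval, Op.apply, e1, h30], by simp only [Expr.cost]; omega, hr,
      by omega, hi, hlt⟩

/-- Dually, writes stay below base and reads stay above. Here m is the table length, which is below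
base because the first coin is at most the last one. -/
theorem exec_copyOut (hfit : base + 16 * (m + 1) ≤ 2 ^ w) (hm : m ≤ base) (h0 : s.reg 0 = base)
    (h2 : s.reg 2 = m) (h31 : s.reg 31 = 0) :
    ∃ t s', Exec w copyOut s t s' ∧ t ≤ m * 20 + 10 ∧
      ∀ j < m, s'.mem j = s.mem (base + 16 * j + 1) := by
  refine ArrayRAM.exec_loop (fun b s' => ∃ j ≤ m, s'.reg 0 = base ∧ s'.reg 2 = m ∧ s'.reg 31 = j ∧
      (∀ i < j, s'.mem i = s.mem (base + 16 * i + 1)) ∧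
      (∀ i, base ≤ i → s'.mem i = s.mem i) ∧ (m - j) * 20 + 10 ≤ b) _ ?_ _ _
    ⟨0, Nat.zero_le _, h0, h2, h31, by simp, fun _ _ => rfl, by omega⟩
  rintro b s' ⟨j, hj, e0, e2, h31, hi, hhigh, hb⟩
  rcases hj.lt_or_eq with hj | rfl
  · right
    have haddr : (Expr.bin .add (.bin .add (.reg 0) (.bin .mul (.const 16) (.reg 31)))
        (.const 1)).eval w s' = base + 16 * j + 1 := by
      simp only [Expr.eval, Op.apply, e0, h31]
      rw [Nat.mod_eq_of_lt (show 16 < 2 ^ w by omega), Nat.mod_eq_of_lt (show 16 * j < 2 ^ w by omega),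
        Nat.mod_eq_of_lt (show 1 < 2 ^ w by omega), Nat.mod_eq_of_lt (show base + 16 * j < 2 ^ w by omega),
        Nat.mod_eq_of_lt (by omega)]
    refine ⟨?_, _, _, (m - (j + 1)) * 20 + 10, .seq (.store _ _ _) (.assign _ _ _),
      ⟨j + 1, hj, ?_, ?_, ?_, ?_, ?_, le_rfl⟩, ?_⟩
    · simp only [Expr.eval, Op.apply, e2, h31, if_pos hj]
      rw [Nat.mod_eq_of_lt (by omega)]; decide
    · simpa using e0
    · simpa using e2
    · simp only [Function.update_self, Expr.eval, Op.apply, h31]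
      rw [Nat.mod_eq_of_lt (show 1 < 2 ^ w by omega), Nat.mod_eq_of_lt (by omega)]
    · intro i hij
      have hl : (Expr.load (.bin .add (.bin .add (.reg 0) (.bin .mul (.const 16) (.reg 31)))
        (.const 1))).eval w s' = s'.mem (base + 16 * j + 1) := by rw [Expr.eval, haddr]
      simp only [hl]
      simp only [Expr.eval, h31]
      by_cases he : i = j
      · subst he; rw [Function.update_self, hhigh _ (by omega)]
      · rw [Function.update_of_ne he, hi i (by omega)]
    · intro i hi'
      simp only [Expr.eval, h31]
      rw [Function.update_of_ne (by omega), hhigh i hi']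
    · simp only [Expr.cost]; omega
  · left
    exact ⟨by simp [Expr.eval, Op.apply, e2, h31], by simp only [Expr.cost]; omega, hi⟩

theorem exec_loadParams {N a : ℕ} (hm : 1 ≤ m) (hmw : m < 2 ^ w) (hN : N + 1 < 2 ^ w)
    (h0 : s.reg 0 = m) (ha : s.mem 0 = a) (hlast : s.mem (m - 1) = N) :
    Exec w loadParams s 14 { s with reg := Function.update (Function.update (Function.update
      (Function.update s.reg 1 m) 3 N) 2 a) 0 (N + 1) } := by
  have e : (m + (2 ^ w - 1)) % 2 ^ w = m - 1 := by
    rw [show m + (2 ^ w - 1) = (m - 1) + 2 ^ w by omega, Nat.add_mod_right]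
    exact Nat.mod_eq_of_lt (by omega)
  have h := Exec.seq (Exec.assign (w := w) s 1 (.reg 0)) (.seq (.assign _ 3 (.load (.bin .sub (.reg 1)
    (.const 1)))) (.seq (.assign _ 2 (.load (.const 0))) (.assign _ 0 (.bin .add (.reg 3)
    (.const 1)))))
  have hw : 1 < 2 ^ w := by omega
  simpa [Expr.eval, Op.apply, h0, ha, hlast, Nat.mod_eq_of_lt hw, e, Nat.mod_eq_of_lt hN,
    Expr.cost, loadParams] using h

end WordRAM

/-! ### From the integer bound to the real bound. -/

namespace TableCost

/-- For N ≥ 2 the binary length is at most 4 log N, which contributes a factor 2 under the root. The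
summand 1 is at most the root itself and contributes another factor 2. -/
theorem cost_le_real {C N t : ℕ} (hN : 2 ≤ N) (ht : t ≤ C * (Nat.sqrt (N ^ 3 * N.size) + 1)) :
    (t : ℝ) ≤ 4 * C * (N : ℝ) ^ (3 / 2 : ℝ) * Real.log N ^ (1 / 2 : ℝ) := by
  have hN0 : (0 : ℝ) < N := by positivity
  have hN2 : (2 : ℝ) ≤ N := by exact_mod_cast hN
  have hlog2 : Real.log 2 ≤ Real.log N := Real.log_le_log (by norm_num) hN2
  have hl2 := Real.log_two_gt_d9
  have hsize : (N.size : ℝ) ≤ 4 * Real.log N := by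
    have h1 : (2 : ℝ) ^ Nat.log 2 N ≤ N := by exact_mod_cast Nat.pow_log_le_self 2 (by omega)
    have h2 := Real.log_le_log (by positivity) h1
    rw [Real.log_pow] at h2
    rw [size_eq_log (by omega)]
    push_cast
    have h3 : (0 : ℝ) ≤ Nat.log 2 N := by positivity
    nlinarith
  have hl : 1 ≤ N.size := Nat.size_pos.2 (by omega)
  have hQ1 : 1 ≤ N ^ 3 * N.size := Nat.one_le_iff_ne_zero.2 (by positivity)
  have hQ : ((N ^ 3 * N.size : ℕ) : ℝ) ≤ 4 * ((N : ℝ) ^ 3 * Real.log N) := by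
    push_cast
    nlinarith [mul_le_mul_of_nonneg_left hsize (show (0 : ℝ) ≤ (N : ℝ) ^ 3 by positivity)]
  have h1 : (1 : ℝ) ≤ √((N ^ 3 * N.size : ℕ) : ℝ) := by
    rw [Real.one_le_sqrt]; exact_mod_cast hQ1
  have h2 := Real.nat_sqrt_le_real_sqrt (a := N ^ 3 * N.size)
  have h3 : √((N ^ 3 * N.size : ℕ) : ℝ) ≤ 2 * ((N : ℝ) ^ (3 / 2 : ℝ) * Real.log N ^ (1 / 2 : ℝ)) := by
    refine (Real.sqrt_le_sqrt hQ).trans (le_of_eq ?_)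
    rw [Real.sqrt_mul (by norm_num), show (4 : ℝ) = 2 ^ 2 by norm_num, Real.sqrt_sq (by norm_num),
      Real.sqrt_eq_rpow, Real.mul_rpow (by positivity) (by linarith), ← Real.rpow_natCast,
      ← Real.rpow_mul hN0.le]
    norm_num
  have h4 : (t : ℝ) ≤ C * (Nat.sqrt (N ^ 3 * N.size) + 1) := by exact_mod_cast ht
  calc (t : ℝ) ≤ C * (Nat.sqrt (N ^ 3 * N.size) + 1) := h4
    _ ≤ C * (4 * ((N : ℝ) ^ (3 / 2 : ℝ) * Real.log N ^ (1 / 2 : ℝ))) := by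
      refine mul_le_mul_of_nonneg_left ?_ (by positivity)
      linarith
    _ = _ := by ring

end TableCost

/-! ### Translation between tuples of coins and coin sequences. -/

section
variable {n : ℕ} {a : Fin (n + 1) → ℕ}

/-- The coins as a sequence that is continued by zeros. -/
def coinSeq (a : Fin (n + 1) → ℕ) (i : ℕ) : ℕ := if h : i < n + 1 then a ⟨i, h⟩ else 0

theorem coinSeq_coe (i : Fin (n + 1)) : coinSeq a i = a i := dif_pos i.2

theorem coinSystem_coinSeq (ha : StrictMono a) (h0 : 0 < a 0) (hg : Finset.univ.gcd a = 1) :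
    CoinSystem (coinSeq a) (n + 1) where
  size_pos := Nat.succ_pos _
  pos := by simpa [coinSeq] using h0
  mono i j hij hj := by
    simp only [coinSeq, dif_pos hj, dif_pos (hij.trans hj)]
    exact ha hij
  gcd d hd := by
    refine Nat.dvd_one.1 (hg ▸ Finset.dvd_gcd fun i _ => ?_)
    rw [← coinSeq_coe (a := a)]
    exact hd i i.2

theorem isFeasible_iff (t : ℕ) : IsFeasible a t ↔ t ∈ Feas (coinSeq a) (n + 1) := by
  constructor
  · rintro ⟨x, rfl⟩
    refine sum_mem fun i _ => ?_
    rw [mul_comm, ← smul_eq_mul, ← coinSeq_coe (a := a) i]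
    exact nsmul_mem (coin_mem_feas i.2) _
  · intro ht
    induction ht using AddSubmonoid.closure_induction with
    | mem x hx =>
      obtain ⟨i, hi, rfl⟩ := hx
      refine ⟨Pi.single ⟨i, hi⟩ 1, ?_⟩
      rw [Finset.sum_eq_single ⟨i, hi⟩]
      · rw [Pi.single_eq_same, mul_one]
        exact (coinSeq_coe (a := a) ⟨i, hi⟩).symm
      · intro j _ hj
        rw [Pi.single_eq_of_ne hj, mul_zero]
      · simp
    | zero => exact ⟨0, by simp⟩
    | add x y _ _ hx hy =>
      obtain ⟨u, rfl⟩ := hx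
      obtain ⟨v, rfl⟩ := hy
      exact ⟨u + v, by simp [mul_add, Finset.sum_add_distrib]⟩

theorem isResidueTable_of_isAperyTable {b : ℕ → ℕ} (h : IsAperyTable (coinSeq a) (n + 1) b) :
    IsResidueTable a b := by
  intro i hi
  have h0 : coinSeq a 0 = a 0 := coinSeq_coe 0
  obtain ⟨⟨hf, hmin⟩, hmod⟩ := h i (by rwa [h0])
  rw [h0] at hmod hmin
  refine ⟨⟨hmod, (isFeasible_iff _).2 hf⟩, ?_⟩
  rintro t ⟨ht, htf⟩
  exact hmin t ((isFeasible_iff _).1 htf) (ht.trans hmod.symm)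

end

/-- The base r and the matrix W with its factor d are fixed numbers, so they are compiled into the
program, and their sizes enter only the constant c. -/
theorem exists_program : ∃ (P : WordRAM.Cmd) (c C : ℕ), ∀ (n : ℕ) (a : Fin (n + 1) → ℕ),
    StrictMono a → 0 < a 0 → Finset.univ.gcd a = 1 → 2 ≤ a (Fin.last n) →
    ∀ w : ℕ, c * Nat.size (a (Fin.last n)) ≤ w → ∃ (t : ℕ) (s : WordRAM.State),
      WordRAM.Exec w P (WordRAM.inputState a) t s ∧ IsResidueTable a s.mem ∧
      t ≤ C * (Nat.sqrt (a (Fin.last n) ^ 3 * (a (Fin.last n)).size) + 1) := by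
  obtain ⟨r, hr⟩ : ∃ r : ℕ, r = 2 ^ 8 := ⟨_, rfl⟩
  obtain ⟨C, hC⟩ := ArrayRAM.exists_runs_residueTable hr
  obtain ⟨W, d, hd, hW⟩ := TensorTransform.exists_vandermonde_inverse (2 * r)
  obtain ⟨δ, hδ⟩ : ∃ δ, d.natAbs ≤ 2 ^ δ := ⟨_, (Nat.lt_two_pow_self).le⟩
  obtain ⟨v, hv⟩ : ∃ v, ∀ i < 2 * r, ∀ j < 2 * r, (W i j).natAbs < 2 ^ v := by
    refine ⟨∑ i ∈ range (2 * r), ∑ j ∈ range (2 * r), (W i j).natAbs, fun i hi j hj => ?_⟩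
    refine lt_of_le_of_lt ?_ Nat.lt_two_pow_self
    exact (single_le_sum (f := fun j => (W i j).natAbs) (fun _ _ => Nat.zero_le _)
      (mem_range.2 hj)).trans (single_le_sum (f := fun i => ∑ j ∈ range (2 * r), (W i j).natAbs)
      (fun _ _ => Nat.zero_le _) (mem_range.2 hi))
  -- In the word size constant, 8δ is for d^k with |d| ≤ 2^δ and k ≤ 8l, v is for the entries of W,
  -- 18 r is for the Vandermonde entries up to (2r)^(2r) = 2^(18 r), and 200 covers T², Z² and the
  -- rest.
  refine ⟨.seq WordRAM.loadParams (.seq WordRAM.copyIn (.seq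
    (ArrayRAM.residueTable r W).compile (.seq (.assign 31 (.const 0)) WordRAM.copyOut))),
    8 * δ + v + 18 * r + 200, C + 100, ?_⟩
  intro n a ha h0 hg hN2 w hw
  set A := coinSeq a with hAdef
  set N := a (Fin.last n) with hN
  have hA : CoinSystem A (n + 1) := coinSystem_coinSeq ha h0 hg
  have hAN : A (n + 1 - 1) = N := coinSeq_coe (a := a) (Fin.last n)
  have hA0 : A 0 = a 0 := coinSeq_coe (a := a) 0
  have hnN : n + 1 ≤ N := hAN ▸ hA.size_le_last
  have hA0N : A 0 ≤ N := hAN ▸ hA.le_last (Nat.succ_pos n)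
  have hAle : ∀ i, A i ≤ N := by
    intro i
    by_cases hi : i < n + 1
    · exact hAN ▸ hA.le_last hi
    · simp [hAdef, coinSeq, hi]
  set l := N.size with hl
  have hl1 : 1 ≤ l := Nat.size_pos.2 (by omega)
  have hNl : N < 2 ^ l := Nat.lt_size_self N
  obtain ⟨T, hT⟩ : ∃ T, T = 12 * (N / (n + 1) + 1) * N.size * N := ⟨_, rfl⟩
  have hTs : T.size ≤ 8 * l := TableCost.size_bound_le (by omega) hT
  have hT2 : T < 2 ^ (8 * l) := (Nat.lt_size_self T).trans_le (Nat.pow_le_pow_right (by omega) hTs)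
  have hw' : 8 * δ * l + v + 18 * r + 200 * l ≤ w := by
    refine le_trans ?_ hw
    have h1 : v ≤ v * l := Nat.le_mul_of_pos_right _ hl1
    have h2 : 18 * r ≤ 18 * r * l := Nat.le_mul_of_pos_right _ hl1
    have e : (8 * δ + v + 18 * r + 200) * l = 8 * δ * l + v * l + 18 * r * l + 200 * l := by ring
    omega
  have hT0 : T ≠ 0 := by
    rw [hT]; positivity
  have hpow : ∀ x y : ℕ, x < y → 2 ^ x < 2 ^ y := fun x y h => Nat.pow_lt_pow_right (by omega) h
  -- The lower half of the address space has room for the input below base = N + 1; sixteen arrays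
  -- of length 2^(w - 5) take up as much space as the other half.
  have hsplit : 2 ^ w = 2 ^ (w - 1) + 16 * 2 ^ (w - 5) := by
    rw [show (16 : ℕ) = 2 ^ 4 by norm_num, ← pow_add, show 4 + (w - 5) = w - 1 by omega, ← two_mul,
      ← pow_succ', show w - 1 + 1 = w by omega]
  have hbase : N + 1 ≤ 2 ^ (w - 1) := hNl.trans_le (Nat.pow_le_pow_right (by omega) (by omega))
  obtain ⟨M, hMw, hML, hMb⟩ : ∃ M : ArrayRAM.Machine, M.w = w ∧ M.L = 2 ^ (w - 5) ∧
      M.base = N + 1 := ⟨{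
    w := w
    L := 2 ^ (w - 5)
    base := N + 1
    two_le := (hpow 0 _ (by omega)).trans_eq' (by norm_num)
    fits := by omega }, rfl, rfl, rfl⟩
  subst hMw
  have hrun := hC M A (n + 1) N T (Nat.sqrt (N ^ 3 * N.size) + 1)
  have hk : Nat.log r T + 1 ≤ 8 * l := by
    have h1 := Nat.log_anti_left (n := T) (b := r) (c := 2) (by omega) (by omega)
    have h2 := TableCost.size_eq_log hT0
    omega
  have h4r : 4 * r = 2 ^ 10 := by rw [hr]; norm_num
  have h2r : 2 * r = 2 ^ 9 := by rw [hr]; norm_num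
  have hT3 : T + 2 ≤ 2 ^ (8 * l + 1) := by
    have := Nat.one_le_two_pow (n := 8 * l)
    rw [pow_succ]; omega
  have hY : N ^ 3 * N.size ≤
      (Nat.sqrt (N ^ 3 * N.size) + 1) * (Nat.sqrt (N ^ 3 * N.size) + 1) :=
    (Nat.lt_succ_sqrt _).le
  have hNY : N ≤ Nat.sqrt (N ^ 3 * N.size) + 1 := TableCost.self_le (by omega) hl1 hY
  have b1 : (T + 2) * (T + 2) * (4 * r) < M.L := by
    rw [hML, h4r]
    refine (Nat.mul_le_mul_right _ (Nat.mul_le_mul hT3 hT3)).trans_lt ?_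
    rw [← pow_add, ← pow_add]
    exact hpow _ _ (by omega)
  have b2 : 2 * r * (2 * r) < M.L := by
    rw [hML, h2r, ← pow_add]
    exact hpow _ _ (by omega)
  have b3 : (2 * r) ^ (2 * r) < M.L := by
    have e : (2 * r) ^ (2 * r) = 2 ^ (9 * (2 * r)) := by
      rw [pow_mul 2 9 (2 * r)]; exact congrArg (· ^ (2 * r)) h2r
    rw [hML, e]
    exact hpow _ _ (by omega)
  have b4 : ∀ i < 2 * r, ∀ j < 2 * r, (W i j).natAbs < M.L := fun i hi j hj =>
    (hv i hi j hj).trans_le (hML ▸ Nat.pow_le_pow_right (by omega) (by omega))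
  have b5 : d.natAbs ^ (Nat.log r T + 1) *
      ((2 * r) ^ (Nat.log r T + 1) * (2 * r) ^ (Nat.log r T + 1)) < 2 ^ M.w := by
    have e : ∀ k, 2 ^ (δ * k) * (2 ^ (9 * k) * 2 ^ (9 * k)) = 2 ^ (δ * k + (9 * k + 9 * k)) :=
      fun k => by rw [pow_add, pow_add]
    rw [h2r]
    refine (Nat.mul_le_mul_right _ (Nat.pow_le_pow_left hδ _)).trans_lt ?_
    rw [← pow_mul, ← pow_mul, e]
    refine hpow _ _ ?_
    have h1 : δ * (Nat.log r T + 1) ≤ δ * (8 * l) := Nat.mul_le_mul_left _ hk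
    have h2 : δ * (8 * l) = 8 * δ * l := by ring
    omega
  have hNw : N + 1 < 2 ^ M.w := hbase.trans_lt (hpow _ _ (by omega))
  have hNL : N + 2 ≤ 2 ^ (M.w - 5) := by
    have h1 : 2 ^ l < 2 ^ (l + 1) := hpow _ _ (by omega)
    have h2 : 2 ^ (l + 1) ≤ 2 ^ (M.w - 5) := Nat.pow_le_pow_right (by omega) (by omega)
    omega
  have hmem : ∀ j, (WordRAM.inputState a).mem j = A j := fun j => rfl
  have hreg : ∀ j, (WordRAM.inputState a).reg j = if j = 0 then n + 1 else 0 := fun j => rfl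
  have e1 := WordRAM.exec_loadParams (w := M.w) (s := WordRAM.inputState a) (m := n + 1) (N := N)
    (a := A 0) (by omega) (by omega) hNw (by rw [hreg, if_pos rfl]) (hmem 0)
    ((hmem _).trans hAN)
  set s₁ : WordRAM.State := ⟨Function.update (Function.update (Function.update
    (Function.update (WordRAM.inputState a).reg 1 (n + 1)) 3 N) 2 (A 0)) 0 (N + 1),
    (WordRAM.inputState a).mem⟩ with hs₁
  have r0 : s₁.reg 0 = N + 1 := by simp [hs₁]
  have r1 : s₁.reg 1 = n + 1 := by simp [hs₁]
  have r2 : s₁.reg 2 = A 0 := by simp [hs₁]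
  have r3 : s₁.reg 3 = N := by simp [hs₁]
  have rr : ∀ k, 4 ≤ k → s₁.reg k = 0 := by
    intro k hk
    simp only [hs₁]
    rw [Function.update_of_ne (by omega), Function.update_of_ne (by omega),
      Function.update_of_ne (by omega), Function.update_of_ne (by omega), hreg, if_neg (by omega)]
  have hm₁ : ∀ j, s₁.mem j = A j := hmem
  have hmem₁ : ∀ j, s₁.mem j < 2 ^ M.w := fun j => (hm₁ j).trans_lt ((hAle j).trans_lt (by omega))
  obtain ⟨t₂, c, e2, ht₂, hc, hc30, hcm, hcw⟩ := WordRAM.exec_copyIn (w := M.w) (m := n + 1)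
    (base := N + 1) (by omega) (by omega) r0 r1 (rr 30 (by omega)) hmem₁
  have hcr : ∀ k, c.reg k < 2 ^ M.w := by
    intro k
    by_cases hk : k = 30
    · rw [hk]; exact hc30
    rw [hc k hk]
    have hk4 : k = 0 ∨ k = 1 ∨ k = 2 ∨ k = 3 ∨ 4 ≤ k := by omega
    rcases hk4 with rfl | rfl | rfl | rfl | hk4
    · omega
    · omega
    · omega
    · omega
    · rw [rr k hk4]; positivity
  have hrep : ArrayRAM.Rep M c (ArrayRAM.view M c) :=
    ⟨by rw [hc 0 (by decide), r0, hMb], hcr, hcw, rfl⟩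
  obtain ⟨t₃, c', s', e3, ht₃, hrep', hs'1, hs'⟩ := hrun (ArrayRAM.view M c) W d hA hAN
    ((hc 1 (by decide)).trans r1) ((hc 2 (by decide)).trans r2) ((hc 3 (by decide)).trans r3)
    (fun i hi => by
      show c.mem (M.base + 16 * i + 0) = A i
      rw [Nat.add_zero, hMb, hcm i hi, hm₁]) hT b1 b2 b3 b4 hd hW b5 hY c hrep
  have e4 := WordRAM.Exec.assign (w := M.w) c' 31 (.const 0)
  have hc'2 : c'.reg 2 = A 0 := by rw [← hs'1, ← hrep'.view_eq]; rfl
  obtain ⟨t₅, s, e5, ht₅, hs⟩ := WordRAM.exec_copyOut (w := M.w) (m := A 0) (base := N + 1)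
    (s := { c' with reg := Function.update c'.reg 31 ((WordRAM.Expr.const 0).eval M.w c') })
    (by omega) (by omega)
    (by simpa using hrep'.base.trans hMb) (by simpa using hc'2) (by simp [WordRAM.Expr.eval])
  refine ⟨_, s, .seq e1 (.seq e2 (.seq e3 (.seq e4 e5))), isResidueTable_of_isAperyTable ?_, ?_⟩
  · intro p hp
    have e : s.mem p = s'.arr 1 p := by
      rw [hs p hp, ← hrep'.view_eq, ← hMb]; rfl
    rw [e]
    exact hs' p hp
  · have e : (C + 100) * (Nat.sqrt (N ^ 3 * N.size) + 1) =
        C * (Nat.sqrt (N ^ 3 * N.size) + 1) + 100 * (Nat.sqrt (N ^ 3 * N.size) + 1) := by ring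
    have e' : (WordRAM.Expr.const 0).cost = 1 := rfl
    rw [e, e']
    omega

theorem mainTheorem9 :
    ∃ (P : WordRAM.Cmd) (c : ℕ) (C : ℝ),
      ∀ (n : ℕ) (a : Fin (n + 1) → ℕ),
        StrictMono a → 0 < a 0 → Finset.univ.gcd a = 1 → 2 ≤ a (Fin.last n) →
        ∀ w : ℕ, c * Nat.size (a (Fin.last n)) ≤ w →
          ∃ (T : ℕ) (s : WordRAM.State),
            WordRAM.Exec w P (WordRAM.inputState a) T s ∧
            IsResidueTable a s.mem ∧
            (T : ℝ) ≤ C * (a (Fin.last n) : ℝ) ^ (3 / 2 : ℝ) *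
              Real.log (a (Fin.last n) : ℝ) ^ (1 / 2 : ℝ) := by
  obtain ⟨P, c, C, h⟩ := exists_program
  refine ⟨P, c, 4 * C, fun n a ha h0 hg hN w hw => ?_⟩
  obtain ⟨t, s, h1, h2, h3⟩ := h n a ha h0 hg hN w hw
  exact ⟨t, s, h1, h2, TableCost.cost_le_real hN h3⟩
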